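/- **Setting.** On the phase space $\mathbb R^{2n}\oplus\mathbb R^{2d}\ni((p,q),(P,Q))$ consider the Hamiltonian $$H(p,q,P,Q)=h_\omega(p,q)+H_0(P,Q,q),\qquad h_\omega(p,q)=\sum_{j=1}^n\frac{p_j^2+\omega_j^2q_j^2}{2},$$ with frequencies $\omega_j>0$, and put $\epsilon:=1/\min_j\omega_j$. Here $H_0$ is a real function of class $C^\infty$ on an open set $D\subset\mathbb R^{2d+n}$. For $e\in\mathbb R$ and $\rho>0$ let $$\mathcal S_e=\{(P,Q): (P,Q,0)\in D,\ H_0(P,Q,0)\le e\},\qquad \mathcal B_\rho=\Big\{(p,q):\sum_j\tfrac{p_j^2+q_j^2}{2}\le\rho^2\Big\}.$$ Let $E^*,E_0^*>0$ be such that $\mathcal S_{3E_0^*}$ is closed in $\mathbb R^{2d}$ (automatic if $D=\mathbb R^{2d+n}$), that $H_0(P,Q,q)$ is defined for all $((p,q),(P,Q))\in\mathcal B_{3\sqrt{E^*}}\times\mathcal S_{3E_0^*}$, and that for every $k$ the derivatives of order $k$ of $H_0$ are bounded on that set. **Theorem.** Let $b>0$. For every $N>0$ there are constants $\epsilon_*>0$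 and $K>0$, which may depend on $H_0,E^*,E_0^*,n,d,N,b$ but not on the frequencies or on the initial datum, such that the following holds for every frequency vector $\omega$ with $0<\epsilon<\epsilon_*$ (no nonresonance condition is imposed) and every initial datum $(p,q,P,Q)$ with $$E:=h_\omega(p,q)<E^*,\qquad H_0(P,Q,0)<E_0^*$$ (the latter including $(P,Q,0)\in D$). The solution of Hamilton's equations exists for all $|t|\le\epsilon^{-N}$, and along it $$|h_\omega(t)-h_\omega(0)|\le \max(E,K\epsilon)\,b\qquad\text{for } |t|\le\epsilon^{-N}.$$ In particular $|h_\omega(t)-h_\omega(0)|\le E\,b$ for $|t|\le\epsilon^{-N}$ whenever $E\ge K\epsilon$. -/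

import Mathlib

namespace FastSlow

noncomputable section

/-- The fast energy `h_ω(p,q) = ∑ j, (p_j² + ω_j² q_j²) / 2`. -/
def fastEnergy {n : ℕ} (ω : Fin n → ℝ) (p q : EuclideanSpace ℝ (Fin n)) : ℝ :=
  ∑ j, (p j ^ 2 + ω j ^ 2 * q j ^ 2) / 2

/-- The total Hamiltonian `H(p,q,P,Q) = h_ω(p,q) + H₀(P,Q,q)`. -/
def hamiltonian {n d : ℕ} (ω : Fin n → ℝ)
    (H₀ : EuclideanSpace ℝ (Fin d) × EuclideanSpace ℝ (Fin d) × EuclideanSpace ℝ (Fin n) → ℝ)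
    (p q : EuclideanSpace ℝ (Fin n)) (P Q : EuclideanSpace ℝ (Fin d)) : ℝ :=
  fastEnergy ω p q + H₀ (P, Q, q)

/-- The sublevel set of the slow energy: the `(P,Q)` with `H₀(P,Q,0) ≤ e`, where `H₀` is a
function on the domain `D`. -/
def slowSublevel {n d : ℕ}
    (D : Set (EuclideanSpace ℝ (Fin d) × EuclideanSpace ℝ (Fin d) × EuclideanSpace ℝ (Fin n)))
    (H₀ : EuclideanSpace ℝ (Fin d) × EuclideanSpace ℝ (Fin d) × EuclideanSpace ℝ (Fin n) → ℝ)
    (e : ℝ) : Set (EuclideanSpace ℝ (Fin d) × EuclideanSpace ℝ (Fin d)) :=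
  {x | (x.1, x.2, 0) ∈ D ∧ H₀ (x.1, x.2, 0) ≤ e}

/-- The ball `∑ j, (p_j² + q_j²) / 2 ≤ ρ²` of the fast variables `(p,q)`. -/
def fastBall (n : ℕ) (ρ : ℝ) : Set (EuclideanSpace ℝ (Fin n) × EuclideanSpace ℝ (Fin n)) :=
  {x | ∑ j, (x.1 j ^ 2 + x.2 j ^ 2) / 2 ≤ ρ ^ 2}

/-- The standing assumptions on `H₀`, a smooth function on the open set `D` of `(P,Q,q)`:
`B_{3√E} × S_{3E₀}` lies in the domain, every `C^k` norm of `H₀` is bounded there, and the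
sublevel set `S_{3E₀}` is closed (which is automatic when `D` is the whole space). -/
structure IsAdmissible {n d : ℕ}
    (D : Set (EuclideanSpace ℝ (Fin d) × EuclideanSpace ℝ (Fin d) × EuclideanSpace ℝ (Fin n)))
    (H₀ : EuclideanSpace ℝ (Fin d) × EuclideanSpace ℝ (Fin d) × EuclideanSpace ℝ (Fin n) → ℝ)
    (E E₀ : ℝ) : Prop where
  isOpen_domain : IsOpen D
  smooth : ContDiffOn ℝ ((⊤ : ℕ∞) : WithTop ℕ∞) H₀ D
  isClosed_sublevel : IsClosed (slowSublevel D H₀ (3 * E₀))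
  subset_domain : ∀ x ∈ fastBall n (3 * √E), ∀ y ∈ slowSublevel D H₀ (3 * E₀),
    (y.1, y.2, x.2) ∈ D
  bounded_derivatives : ∀ k : ℕ, ∃ C : ℝ,
    ∀ x ∈ fastBall n (3 * √E), ∀ y ∈ slowSublevel D H₀ (3 * E₀),
      ‖iteratedFDeriv ℝ k H₀ (y.1, y.2, x.2)‖ ≤ C

/-- `(p,q,P,Q)` solves Hamilton's equations of `H = h_ω + H₀` on the set `I` of times (the
derivatives at end points of `I` are one-sided), staying in the domain `D` of `H₀`. -/
structure IsSolution {n d : ℕ} (ω : Fin n → ℝ)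
    (D : Set (EuclideanSpace ℝ (Fin d) × EuclideanSpace ℝ (Fin d) × EuclideanSpace ℝ (Fin n)))
    (H₀ : EuclideanSpace ℝ (Fin d) × EuclideanSpace ℝ (Fin d) × EuclideanSpace ℝ (Fin n) → ℝ)
    (I : Set ℝ) (p q : ℝ → EuclideanSpace ℝ (Fin n)) (P Q : ℝ → EuclideanSpace ℝ (Fin d)) :
    Prop where
  mem_domain : ∀ t ∈ I, (P t, Q t, q t) ∈ D
  deriv_p : ∀ t ∈ I,
    HasDerivWithinAt p (-gradient (fun y => hamiltonian ω H₀ (p t) y (P t) (Q t)) (q t)) I t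
  deriv_q : ∀ t ∈ I,
    HasDerivWithinAt q (gradient (fun x => hamiltonian ω H₀ x (q t) (P t) (Q t)) (p t)) I t
  deriv_P : ∀ t ∈ I,
    HasDerivWithinAt P (-gradient (fun Y => hamiltonian ω H₀ (p t) (q t) (P t) Y) (Q t)) I t
  deriv_Q : ∀ t ∈ I,
    HasDerivWithinAt Q (gradient (fun X => hamiltonian ω H₀ (p t) (q t) X (Q t)) (P t)) I t

end

end FastSlow

/-! Write `Ω` for the true frequencies and `ω = εΩ ≥ 1` for the scaled ones, and pass to `u = q/ε`,
`v_j = p_j/ω_j`. The fast energy becomes `h = ∑ ω_j²(u_j² + v_j²)/2`. The coupling `H₀(P,Q,εu)`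
expands in powers of `ε`, the coefficient of order `k` being homogeneous of degree `k` in `u`.
Multiplied by `ε`, the Poisson bracket has weights `1/ω_j` on the fast pairs and `ε` on the slow
pairs. The term `H₀(P,Q,0)` is not small, but it contains no fast variable, so a bracket with it
costs a factor `ε`. Hence only `h` acts at order zero and a normal form in powers of `ε` is
possible.

No nonresonance is needed because `ω` can be replaced by a rational neighbour `ω'` given by
Dirichlet's theorem. For integer vectors `ν` of bounded length, either `⟨ω',ν⟩ = 0` or `|⟨ω,ν⟩| ≥
γ`, with `γ` independent of `ω` (`exists_resonantApprox`). Lie series remove the monomials of the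
second kind with divisors at least `γ`; what remains commutes with `h' = ∑ ω_j ω'_j (u_j² +
v_j²)/2`. Pulling `h'` back gives `h' + j`, with `j = O(ε)`, which commutes with the Hamiltonian up
to a high power of `ε` (`exists_formal_integral`). In the original variables `h'` is the fast energy
with its `j`-th summand multiplied by `ω'_j/ω_j`, which is within `β` of 1; taking `β = b/8`
produces the relative error `b` of the theorem.

The frequencies have no upper bound, yet all constants must be uniform in them. The algebra is
therefore carried out on families indexed by all pairs `(ω, ω')` at once. No canonical
transformation is analysed: the Lie series are purely algebraic, and only the derivative of the
resulting observable along the Hamiltonian field is estimated (`exists_approximate_integral`).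

A continuity argument closes the proof. For `|t| ≤ ε^(-N)` the observable drifts by `O(ε)`, so the
fast energy is controlled; conservation of the total energy then controls `H₀(P,Q,0)`, and the
trajectory cannot reach the boundary of the region where the estimates hold
(`exists_fastEnergy_bound`, `exists_fastEnergy_almost_conserved`). -/

namespace FastSlow

/-! ### Normal forms in filtered Lie algebras -/

section LieNormalForm

variable {L : Type*} [LieRing L] [LieAlgebra ℚ L]

/-- A submodule stable under a nilpotent endomorphism is stable under its exponential. -/
theorem exp_mem_of_stable {V : Type*} [AddCommGroup V] [Module ℚ V] (a : Module.End ℚ V)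
    (U : Submodule ℚ V) (hU : ∀ x ∈ U, a x ∈ U) {x : V} (hx : x ∈ U) :
    IsNilpotent.exp a x ∈ U := by
  have hpow : ∀ i : ℕ, (a ^ i) x ∈ U := by
    intro i
    induction i with
    | zero => simpa using hx
    | succ i ih => rw [pow_succ', Module.End.mul_apply]; exact hU _ ih
  rw [IsNilpotent.exp, LinearMap.sum_apply]
  exact U.sum_mem fun i _ => U.smul_mem _ (hpow i)

/-- Without its zeroth term the exponential series starts at `a x`, so `x` itself may lie outside
`U`. This is needed for `x = h` and `x = h'`, which are not assumed to lie in `W`. -/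
theorem exp_sub_mem_of_stable {V : Type*} [AddCommGroup V] [Module ℚ V] (a : Module.End ℚ V)
    (ha : IsNilpotent a) (U : Submodule ℚ V) (hU : ∀ x ∈ U, a x ∈ U) {x : V} (hx : a x ∈ U) :
    IsNilpotent.exp a x - x ∈ U := by
  obtain ⟨k, hk⟩ := ha
  have hpow : ∀ i : ℕ, (a ^ (i + 1)) x ∈ U := by
    intro i
    induction i with
    | zero => simpa using hx
    | succ i ih => rw [pow_succ', Module.End.mul_apply]; exact hU _ ih
  -- One extra power guarantees a zeroth summand to split off, even when `k = 0`.
  have hk' : a ^ (k + 1) = 0 := by rw [pow_succ, hk, zero_mul]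
  rw [IsNilpotent.exp_eq_sum hk', LinearMap.sum_apply, Finset.sum_range_succ']
  simp only [Nat.factorial_zero, Nat.cast_one, inv_one, pow_zero, one_smul, Module.End.one_apply,
    add_sub_cancel_right]
  exact U.sum_mem fun i _ => U.smul_mem _ (hpow i)

theorem exp_sub_sub_mem_of_stable {V : Type*} [AddCommGroup V] [Module ℚ V] (a : Module.End ℚ V)
    (ha : IsNilpotent a) (U : Submodule ℚ V) (hU : ∀ x ∈ U, a x ∈ U) {x : V}
    (hx : a (a x) ∈ U) : IsNilpotent.exp a x - x - a x ∈ U := by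
  obtain ⟨k, hk⟩ := ha
  have hpow : ∀ i : ℕ, (a ^ (i + 2)) x ∈ U := by
    intro i
    induction i with
    | zero => simpa [pow_two] using hx
    | succ i ih => rw [show i + 1 + 2 = (i + 2) + 1 by ring, pow_succ', Module.End.mul_apply]
                   exact hU _ ih
  have hk' : a ^ (k + 2) = 0 := by rw [pow_add, hk, zero_mul]
  rw [IsNilpotent.exp_eq_sum hk', LinearMap.sum_apply, Finset.sum_range_succ',
    Finset.sum_range_succ']
  simp only [Nat.factorial_zero, Nat.cast_one, inv_one, pow_zero, one_smul, Module.End.one_apply,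
    zero_add, Nat.factorial_one, pow_one, add_assoc, one_add_one_eq_two]
  rw [← add_assoc, add_sub_cancel_right, add_sub_cancel_right]
  exact U.sum_mem fun i _ => U.smul_mem _ (hpow i)

/-- Normal form in a filtered Lie algebra whose filtration terminates: if the homological equation
is solvable inside `W`, then `h + F` has an integral of the form `h' + j`. -/
theorem exists_commuting_of_homological {M : ℕ} (I : ℕ → Submodule ℚ L)
    (hI0 : I 0 = ⊤) (hIM : I M = ⊥) (hanti : Antitone I)
    (hIlie : ∀ a b, ∀ x ∈ I a, ∀ y ∈ I b, ⁅x, y⁆ ∈ I (a + b))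
    (W : Submodule ℚ L) (hW : ∀ x ∈ W, ∀ y ∈ W, ⁅x, y⁆ ∈ W)
    (hWI : ∀ k, 1 ≤ k → ∀ χ ∈ W ⊓ I k, ∀ F ∈ W, ⁅χ, F⁆ ∈ I (k + 1))
    (h h' : L) (hhh : ⁅h, h'⁆ = 0)
    (hom : ∀ k, 1 ≤ k → k < M → ∀ F ∈ W, ⁅h', F⁆ ∈ I k →
      ∃ χ ∈ W ⊓ I k, ⁅χ, h⁆ ∈ W ∧ ⁅χ, h'⁆ ∈ W ∧ ⁅h', F + ⁅χ, h⁆⁆ ∈ I (k + 1))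
    (F : L) (hF : F ∈ W) (hF1 : ⁅h', F⁆ ∈ I 1) :
    ∃ j ∈ W ⊓ I 1, ⁅h + F, h' + j⁆ = 0 := by
  -- If `M = 0` the filtration forces the algebra to be trivial.
  rcases Nat.eq_zero_or_pos M with hM0 | hM0
  · subst hM0
    have hz : ∀ x : L, x = 0 := fun x => by
      have : x ∈ I 0 := by rw [hI0]; trivial
      rwa [hIM, Submodule.mem_bot] at this
    exact ⟨0, Submodule.zero_mem _, hz _⟩
  -- Induction on the number `r = M - k` of orders still to be normalised.
  suffices H : ∀ r k, 1 ≤ k → k + r = M → ∀ F ∈ W, ⁅h', F⁆ ∈ I k →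
      ∃ j ∈ W ⊓ I 1, ⁅h + F, h' + j⁆ = 0 from
    H (M - 1) 1 le_rfl (by omega) F hF hF1
  intro r
  induction r with
  | zero =>
    intro k _ hk F _ hFk
    obtain rfl : k = M := by omega
    rw [hIM, Submodule.mem_bot] at hFk
    refine ⟨0, Submodule.zero_mem _, ?_⟩
    rw [add_zero, add_lie, hhh, zero_add, ← lie_skew, hFk, neg_zero]
  | succ r ih =>
    intro k hk1 hk F hF hFk
    obtain ⟨χ, hχ, hχh, hχh', hχF⟩ := hom k hk1 (by omega) F hF hFk
    set D : LieDerivation ℚ L L := LieDerivation.ad ℚ L χ with hD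
    have hDx : ∀ x, D.toLinearMap x = ⁅χ, x⁆ := fun x => LieDerivation.ad_apply_apply ℚ L χ x
    have hDI : ∀ m, ∀ x ∈ I m, D.toLinearMap x ∈ I (m + 1) := fun m x hx =>
      by rw [hDx]; exact hanti (by omega : m + 1 ≤ k + m) (hIlie k m χ hχ.2 x hx)
    have hDI' : ∀ m, ∀ x ∈ I m, D.toLinearMap x ∈ I m := fun m x hx =>
      hanti (Nat.le_succ m) (hDI m x hx)
    have hDW : ∀ x ∈ W, D.toLinearMap x ∈ W := fun x hx => by
      rw [hDx]; exact hW _ hχ.1 _ hx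
    have hnil : IsNilpotent D.toLinearMap := by
      refine ⟨M, LinearMap.ext fun x => ?_⟩
      have : ∀ m, (D.toLinearMap ^ m) x ∈ I m := by
        intro m
        induction m with
        | zero => rw [hI0]; trivial
        | succ m ihm => rw [pow_succ', Module.End.mul_apply]; exact hDI _ _ ihm
      simpa [hIM] using this M
    have hnil' : IsNilpotent (-D.toLinearMap) := hnil.neg
    set T := LieDerivation.exp D hnil with hT
    have hTx : ∀ x, T x = IsNilpotent.exp D.toLinearMap x := fun x => rfl
    have hTs : ∀ x, T.symm x = IsNilpotent.exp (-D.toLinearMap) x := fun x => rfl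
    -- The new perturbation: `T = exp (ad χ)` carries `h + F` to `h + F'`. It stays in `W` although
    -- `h` need not, because `⁅χ, h⁆ ∈ W`.
    set F' : L := T F + (T h - h) with hF'
    have hTF : T (h + F) = h + F' := by rw [map_add, hF']; abel
    have hF'W : F' ∈ W :=
      W.add_mem (exp_mem_of_stable _ W hDW hF) (exp_sub_mem_of_stable _ hnil W hDW ((hDx h).symm ▸ hχh))
    -- Modulo `I (k + 1)` only the linear term `⁅χ, h⁆` survives: `⁅χ, F⁆` gains an order by `hWI`,
    -- and `⁅χ, ⁅χ, h⁆⁆` has order at least `k + 1`.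
    have hdiff : F' - (F + ⁅χ, h⁆) ∈ I (k + 1) := by
      have h1 : T F - F ∈ I (k + 1) :=
        exp_sub_mem_of_stable _ hnil _ (hDI' _)
          ((hDx F).symm ▸ hWI k hk1 χ hχ F hF)
      have h2 : T h - h - ⁅χ, h⁆ ∈ I (k + 1) := by
        rw [← hDx]
        refine exp_sub_sub_mem_of_stable _ hnil _ (hDI' _) ?_
        have : D.toLinearMap h ∈ I k := by
          rw [hDx]; exact hIlie k 0 χ hχ.2 h (by rw [hI0]; trivial)
        exact hDI _ _ this
      have : F' - (F + ⁅χ, h⁆) = (T F - F) + (T h - h - ⁅χ, h⁆) := by rw [hF']; abel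
      rw [this]; exact Submodule.add_mem _ h1 h2
    have hF'k : ⁅h', F'⁆ ∈ I (k + 1) := by
      have h3 : ⁅h', F' - (F + ⁅χ, h⁆)⁆ ∈ I (k + 1) := by
        have := hIlie 0 (k + 1) h' (by rw [hI0]; trivial) _ hdiff
        rwa [zero_add] at this
      have := Submodule.add_mem _ h3 hχF
      rwa [← lie_add, sub_add_cancel] at this
    obtain ⟨j', hj', hcomm⟩ := ih (k + 1) (by omega) (by omega) F' hF'W hF'k
    have hnW : ∀ x ∈ W, (-D.toLinearMap) x ∈ W := fun x hx => W.neg_mem (hDW x hx)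
    have hnI : ∀ x ∈ I 1, (-D.toLinearMap) x ∈ I 1 := fun x hx =>
      (I 1).neg_mem (hDI' 1 x hx)
    -- The integral `h' + j'` of the transformed Hamiltonian is pulled back by the automorphism
    -- `T.symm`.
    refine ⟨T.symm j' + (T.symm h' - h'), ⟨?_, ?_⟩, ?_⟩
    · exact W.add_mem (exp_mem_of_stable _ W hnW hj'.1)
        (exp_sub_mem_of_stable _ hnil' W hnW (W.neg_mem ((hDx h').symm ▸ hχh')))
    · refine (I 1).add_mem (exp_mem_of_stable _ (I 1) hnI hj'.2)
        (exp_sub_mem_of_stable _ hnil' (I 1) hnI ((I 1).neg_mem ?_))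
      rw [hDx]
      exact hanti hk1 (hIlie k 0 χ hχ.2 h' (by rw [hI0]; trivial))
    · have e1 : h + F = T.symm (h + F') := by rw [← hTF, LieEquiv.symm_apply_apply]
      have e2 : h' + (T.symm j' + (T.symm h' - h')) = T.symm (h' + j') := by
        rw [map_add]; abel
      rw [e1, e2, ← LieEquiv.map_lie, hcomm, map_zero]

/-- Normal form in a filtered Lie algebra modulo a member of the filtration. -/
theorem exists_commuting_modulo {M : ℕ} (hM : 1 ≤ M) (I : ℕ → LieIdeal ℚ L)
    (hI0 : I 0 = ⊤) (hanti : Antitone I)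
    (hIlie : ∀ a b, ∀ x ∈ I a, ∀ y ∈ I b, ⁅x, y⁆ ∈ I (a + b))
    (W : Submodule ℚ L) (hW : ∀ x ∈ W, ∀ y ∈ W, ⁅x, y⁆ ∈ W)
    (hWI : ∀ k, 1 ≤ k → ∀ χ ∈ W, χ ∈ I k → ∀ F ∈ W, ⁅χ, F⁆ ∈ I (k + 1))
    (h h' : L) (hhh : ⁅h, h'⁆ = 0)
    (hom : ∀ k, 1 ≤ k → k < M → ∀ F ∈ W, ⁅h', F⁆ ∈ I k →
      ∃ χ ∈ W, χ ∈ I k ∧ ⁅χ, h⁆ ∈ W ∧ ⁅χ, h'⁆ ∈ W ∧ ⁅h', F + ⁅χ, h⁆⁆ ∈ I (k + 1))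
    (F : L) (hF : F ∈ W) (hF1 : ⁅h', F⁆ ∈ I 1) :
    ∃ j ∈ W, j ∈ I 1 ∧ ⁅h + F, h' + j⁆ ∈ I M := by
  -- In the quotient by `I M` the filtration terminates, so the exponentials are finite sums.
  let π : L →ₗ⁅ℚ, L⁆ L ⧸ I M := LieSubmodule.Quotient.mk' (I M)
  have hπlie : ∀ x y : L, π ⁅x, y⁆ = ⁅π x, π y⁆ := fun x y => rfl
  have hπ0 : ∀ x : L, π x = 0 ↔ x ∈ I M := fun x => LieSubmodule.Quotient.mk_eq_zero (I M)
  have hπs : Function.Surjective π := LieSubmodule.Quotient.surjective_mk' (I M)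
  let J : ℕ → Submodule ℚ (L ⧸ I M) := fun k => Submodule.map (π : L →ₗ[ℚ] L ⧸ I M) (I k).toSubmodule
  let V : Submodule ℚ (L ⧸ I M) := Submodule.map (π : L →ₗ[ℚ] L ⧸ I M) W
  have hJ : ∀ k, k ≤ M → ∀ x, π x ∈ J k → x ∈ I k := by
    rintro k hk x ⟨y, hy, hxy⟩
    have h1 : x - y ∈ I M := by
      rw [← hπ0, map_sub, sub_eq_zero]; exact hxy.symm
    have := (I k).add_mem (hanti hk h1) hy
    simpa using this
  have hJbot : ∀ k, M ≤ k → J k = ⊥ := by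
    intro k hk
    rw [eq_bot_iff]
    rintro _ ⟨y, hy, rfl⟩
    exact (hπ0 y).2 (hanti hk hy)
  have hJmem : ∀ k x, x ∈ I k → π x ∈ J k := fun k x hx => ⟨x, hx, rfl⟩
  have key := exists_commuting_of_homological (M := M) J ?_ (hJbot M le_rfl) ?_ ?_ V ?_ ?_
    (π h) (π h') ?_ ?_ (π F) ⟨F, hF, rfl⟩ (hJmem 1 _ hF1)
  · obtain ⟨_, ⟨⟨j, hjW, rfl⟩, hj1⟩, hj⟩ := key
    refine ⟨j, hjW, hJ 1 hM j hj1, (hπ0 _).1 ?_⟩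
    rw [hπlie, map_add, map_add]
    exact hj
  · rw [eq_top_iff]
    intro x _
    obtain ⟨y, rfl⟩ := hπs x
    exact hJmem 0 y (by rw [hI0]; trivial)
  · exact fun a b hab => Submodule.map_mono (hanti hab)
  · rintro a b _ ⟨x, hx, rfl⟩ _ ⟨y, hy, rfl⟩
    exact hJmem (a + b) _ (hIlie a b x hx y hy)
  · rintro _ ⟨x, hx, rfl⟩ _ ⟨y, hy, rfl⟩
    exact ⟨_, hW x hx y hy, rfl⟩
  · rintro k hk _ ⟨⟨χ, hχ, rfl⟩, hχk⟩ _ ⟨G, hG, rfl⟩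
    rcases le_or_gt k M with hkM | hkM
    · exact hJmem _ _ (hWI k hk χ hχ (hJ k hkM χ hχk) G hG)
    · have h0 : (π : L →ₗ[ℚ] L ⧸ I M) χ = 0 := by
        rw [← Submodule.mem_bot ℚ, ← hJbot k hkM.le]; exact hχk
      rw [h0, zero_lie]
      exact Submodule.zero_mem _
  · rw [← hπlie, hhh, map_zero]
  · rintro k hk1 hkM _ ⟨G, hG, rfl⟩ hGk
    obtain ⟨χ, hχW, hχk, h1, h2, h3⟩ := hom k hk1 hkM G hG (hJ k hkM.le _ hGk)
    refine ⟨π χ, ⟨⟨χ, hχW, rfl⟩, hJmem k χ hχk⟩, ⟨_, h1, rfl⟩, ⟨_, h2, rfl⟩, ?_⟩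
    exact hJmem _ _ h3

end LieNormalForm
end FastSlow

namespace FastSlow

/-! ### Algebraic Poisson brackets -/

section PoissonBracket

variable {R B : Type*} [CommRing R] [CommRing B] [Algebra R B] {ι : Type*} [Fintype ι]

/-- The Poisson bracket of a finite family of conjugate pairs `(x i, y i)` of derivations, with
weights `c i`. -/
def poissonBracket (c : ι → B) (x y : ι → Derivation R B B) (F G : B) : B :=
  ∑ i, c i * (x i F * y i G - y i F * x i G)

variable (c : ι → B) (x y : ι → Derivation R B B)

theorem poissonBracket_self (F : B) : poissonBracket c x y F F = 0 :=
  Finset.sum_eq_zero fun i _ => by ring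

theorem poissonBracket_add_left (F F' G : B) : poissonBracket c x y (F + F') G =
    poissonBracket c x y F G + poissonBracket c x y F' G := by
  simp only [poissonBracket, map_add, ← Finset.sum_add_distrib]
  exact Finset.sum_congr rfl fun i _ => by ring

theorem poissonBracket_add_right (F G G' : B) : poissonBracket c x y F (G + G') =
    poissonBracket c x y F G + poissonBracket c x y F G' := by
  simp only [poissonBracket, map_add, ← Finset.sum_add_distrib]
  exact Finset.sum_congr rfl fun i _ => by ring

theorem poissonBracket_skew (F G : B) :
    poissonBracket c x y F G = -poissonBracket c x y G F := by
  simp only [poissonBracket, ← Finset.sum_neg_distrib]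
  exact Finset.sum_congr rfl fun i _ => by ring

theorem poissonBracket_smul_right (r : R) (F G : B) : poissonBracket c x y F (r • G) =
    r • poissonBracket c x y F G := by
  simp only [poissonBracket, Derivation.map_smul]
  simp only [Algebra.smul_def, Finset.mul_sum]
  exact Finset.sum_congr rfl fun i _ => by ring

variable {c x y}

/-- The Jacobi defect splits into a double sum over pairs `(i, j)` that is antisymmetric in `(i,
j)`; rational scalars allow division by 2. -/
theorem poissonBracket_leibniz [Algebra ℚ B]
    (hxx : ∀ i j F, x i (x j F) = x j (x i F)) (hxy : ∀ i j F, x i (y j F) = y j (x i F))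
    (hyy : ∀ i j F, y i (y j F) = y j (y i F))
    (hxc : ∀ i j, x i (c j) = 0) (hyc : ∀ i j, y i (c j) = 0) (F G H : B) :
    poissonBracket c x y F (poissonBracket c x y G H) =
      poissonBracket c x y (poissonBracket c x y F G) H +
        poissonBracket c x y G (poissonBracket c x y F H) := by
  set b : ι → B → B → B := fun i F G => c i * (x i F * y i G - y i F * x i G) with hb
  set S : ι → ι → B := fun i j =>
    b i F (b j G H) - (b i (b j F G) H + b i G (b j F H)) with hS
  -- A single `S i j` need not vanish: its second derivatives cancel only against those of `S j i`.
  have hanti : ∀ i j, S i j + S j i = 0 := by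
    intro i j
    have h1 : ∀ F, x j (x i F) = x i (x j F) := hxx j i
    have h2 : ∀ F, y j (x i F) = x i (y j F) := fun F => (hxy i j F).symm
    have h3 : ∀ F, x j (y i F) = y i (x j F) := hxy j i
    have h4 : ∀ F, y j (y i F) = y i (y j F) := hyy j i
    simp only [hS, hb, Derivation.leibniz, map_sub, smul_eq_mul, hxc, hyc, mul_zero, add_zero,
      h1, h2, h3, h4]
    ring
  have hsum : ∑ i, ∑ j, S i j = 0 := by
    have h2 : (∑ i, ∑ j, S i j) + ∑ i, ∑ j, S i j = 0 := by
      conv_lhs => arg 2; rw [Finset.sum_comm]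
      simp only [← Finset.sum_add_distrib, hanti, Finset.sum_const_zero]
    have : (2 : ℚ) • (∑ i, ∑ j, S i j) = 0 := by rw [two_smul, h2]
    exact (smul_eq_zero.1 this).resolve_left two_ne_zero
  have hexp1 : ∀ F G H, poissonBracket c x y F (poissonBracket c x y G H) =
      ∑ i, ∑ j, b i F (b j G H) := by
    intro F G H
    simp only [poissonBracket, hb, map_sum, Finset.mul_sum, ← Finset.sum_sub_distrib]
  have hexp2 : ∀ F G H, poissonBracket c x y (poissonBracket c x y F G) H =
      ∑ i, ∑ j, b i (b j F G) H := by
    intro F G H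
    simp only [poissonBracket, hb, map_sum, Finset.mul_sum, Finset.sum_mul,
      ← Finset.sum_sub_distrib]
  rw [← sub_eq_zero, hexp1, hexp2, hexp1, ← hsum]
  simp only [hS, Finset.sum_add_distrib, Finset.sum_sub_distrib]

/-- The Lie ring structure of a Poisson bracket. -/
abbrev poissonLieRing [Algebra ℚ B] (c : ι → B) (x y : ι → Derivation R B B)
    (hxx : ∀ i j F, x i (x j F) = x j (x i F)) (hxy : ∀ i j F, x i (y j F) = y j (x i F))
    (hyy : ∀ i j F, y i (y j F) = y j (y i F))
    (hxc : ∀ i j, x i (c j) = 0) (hyc : ∀ i j, y i (c j) = 0) : LieRing B where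
  toAddCommGroup := inferInstance
  bracket := poissonBracket c x y
  add_lie := poissonBracket_add_left c x y
  lie_add := poissonBracket_add_right c x y
  lie_self := poissonBracket_self c x y
  leibniz_lie := poissonBracket_leibniz hxx hxy hyy hxc hyc

end PoissonBracket

/-! ### Derivations acting on polynomial coefficients -/

section CoefficientwiseDerivation

open Polynomial

variable {R A : Type*} [CommRing R] [CommRing A] [Algebra R A]

/-- The derivation of `A[X]` that acts on coefficients by the derivation `δ` of `A`. -/
noncomputable def coeffDerivation (δ : Derivation R A A) : Derivation R A[X] A[X] :=
  ((PolynomialModule.equivPolynomialSelf (R := A)).toLinearMap).compDer δ.mapCoeffs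

@[simp]
theorem coeff_coeffDerivation (δ : Derivation R A A) (F : A[X]) (k : ℕ) :
    (coeffDerivation δ F).coeff k = δ (F.coeff k) := rfl

theorem coeffDerivation_comm {δ δ' : Derivation R A A} (h : ∀ f, δ (δ' f) = δ' (δ f)) (F : A[X]) :
    coeffDerivation δ (coeffDerivation δ' F) = coeffDerivation δ' (coeffDerivation δ F) := by
  ext k; simp [h]

theorem coeffDerivation_C (δ : Derivation R A A) (f : A) :
    coeffDerivation δ (C f) = C (δ f) := by
  ext k; simp [coeff_C]; split_ifs <;> simp

theorem coeffDerivation_X (δ : Derivation R A A) : coeffDerivation δ (X : A[X]) = 0 := by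
  ext k; simp [coeff_X]; split_ifs <;> simp

end CoefficientwiseDerivation
end FastSlow

namespace FastSlow

noncomputable section

theorem two_le_smooth : (2 : WithTop ℕ∞) ≤ ((⊤ : ℕ∞) : WithTop ℕ∞) :=
  WithTop.coe_le_coe.2 (le_top : (2 : ℕ∞) ≤ ⊤)

/-! ### Families of smooth functions and their directional derivatives -/

section SmoothFamily

variable (Λ Y : Type*) [NormedAddCommGroup Y] [NormedSpace ℝ Y]

/-- The algebra of families of smooth complex functions on `Y`, with parameter in `Λ`. -/
def smoothFamily : Subalgebra ℂ (Λ → Y → ℂ) where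
  carrier := {F | ∀ θ, ContDiff ℝ ((⊤ : ℕ∞) : WithTop ℕ∞) (F θ)}
  mul_mem' hF hG θ := (hF θ).mul (hG θ)
  add_mem' hF hG θ := (hF θ).add (hG θ)
  algebraMap_mem' _ _ := contDiff_const

variable {Λ Y}

variable (Λ Y) in
/-- The type of families of smooth complex functions on `Y`, with parameter in `Λ`. -/
def SmoothFamily : Type _ := smoothFamily Λ Y

instance : CommRing (SmoothFamily Λ Y) := inferInstanceAs (CommRing (smoothFamily Λ Y))

instance : Algebra ℂ (SmoothFamily Λ Y) := inferInstanceAs (Algebra ℂ (smoothFamily Λ Y))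

instance : Algebra ℚ (SmoothFamily Λ Y) := Algebra.compHom _ (algebraMap ℚ ℂ)

@[ext]
theorem SmoothFamily.ext {F G : SmoothFamily Λ Y} (h : ∀ θ y, F.1 θ y = G.1 θ y) : F = G :=
  Subtype.ext (funext fun θ => funext fun y => h θ y)

variable (Λ Y) in
/-- The value of a family at a parameter and a point, as a ring homomorphism. -/
def SmoothFamily.eval (θ : Λ) (y : Y) : SmoothFamily Λ Y →+* ℂ where
  toFun F := F.1 θ y
  map_one' := rfl
  map_mul' _ _ := rfl
  map_zero' := rfl
  map_add' _ _ := rfl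

theorem smoothFamily_differentiable (F : SmoothFamily Λ Y) (θ : Λ) :
    Differentiable ℝ (F.1 θ) := (F.2 θ).differentiable (by simp)

/-- The derivative in the direction `v`, as a derivation of the algebra of smooth families. -/
def dirDeriv (v : Y) : Derivation ℂ (SmoothFamily Λ Y) (SmoothFamily Λ Y) where
  toFun F := ⟨fun θ y => fderiv ℝ (F.1 θ) y v, fun θ =>
    ((F.2 θ).fderiv_right (by simp)).clm_apply contDiff_const⟩
  map_add' F G := by
    ext θ y
    change fderiv ℝ (F.1 θ + G.1 θ) y v = fderiv ℝ (F.1 θ) y v + fderiv ℝ (G.1 θ) y v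
    rw [fderiv_add (smoothFamily_differentiable F θ y) (smoothFamily_differentiable G θ y)]; rfl
  map_smul' c F := by
    ext θ y
    change fderiv ℝ (c • F.1 θ) y v = c • fderiv ℝ (F.1 θ) y v
    rw [fderiv_const_smul (smoothFamily_differentiable F θ y)]; rfl
  map_one_eq_zero' := by
    ext θ y
    change fderiv ℝ (fun _ : Y => (1 : ℂ)) y v = 0
    simp
  leibniz' F G := by
    ext θ y
    change fderiv ℝ (F.1 θ * G.1 θ) y v =
      F.1 θ y * fderiv ℝ (G.1 θ) y v + G.1 θ y * fderiv ℝ (F.1 θ) y v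
    rw [fderiv_mul (smoothFamily_differentiable F θ y) (smoothFamily_differentiable G θ y)]; rfl

theorem dirDeriv_apply (v : Y) (F : SmoothFamily Λ Y) (θ : Λ) (y : Y) :
    (dirDeriv v F).1 θ y = fderiv ℝ (F.1 θ) y v := rfl

theorem dirDeriv_comm (v v' : Y) (F : SmoothFamily Λ Y) :
    dirDeriv v (dirDeriv v' F) = dirDeriv v' (dirDeriv v F) := by
  ext θ y
  have hd : DifferentiableAt ℝ (fderiv ℝ (F.1 θ)) y :=
    ((F.2 θ).fderiv_right (m := 1) (by norm_cast)).differentiable (by simp) y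
  have h : ∀ a b : Y, (dirDeriv a (dirDeriv b F)).1 θ y = fderiv ℝ (fderiv ℝ (F.1 θ)) y a b := by
    intro a b
    rw [dirDeriv_apply]
    change fderiv ℝ (fun z => fderiv ℝ (F.1 θ) z b) y a = _
    rw [fderiv_clm_apply hd (differentiableAt_const b)]
    simp
  rw [h, h]
  exact ((F.2 θ).contDiffAt.isSymmSndFDerivAt (by simpa using two_le_smooth)) v v'

end SmoothFamily
end
end FastSlow

namespace FastSlow

noncomputable section

/-! ### Smooth functions with bounded derivatives -/

section BoundedSmooth

variable {E : Type*} [NormedAddCommGroup E] [NormedSpace ℝ E] {s : Set E}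

/-- Smooth functions all of whose derivatives are bounded on `s`. -/
structure IsBoundedSmooth (s : Set E) (F : E → ℝ) : Prop where
  contDiff : ContDiff ℝ ((⊤ : ℕ∞) : WithTop ℕ∞) F
  bounded : ∀ k : ℕ, ∃ C : ℝ, ∀ z ∈ s, ‖iteratedFDeriv ℝ k F z‖ ≤ C

theorem IsBoundedSmooth.differentiable {F : E → ℝ} (hF : IsBoundedSmooth s F) :
    Differentiable ℝ F := hF.contDiff.differentiable (by simp)

theorem IsBoundedSmooth.exists_abs_le {F : E → ℝ} (hF : IsBoundedSmooth s F) :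
    ∃ C : ℝ, ∀ z ∈ s, |F z| ≤ C := by
  obtain ⟨C, hC⟩ := hF.bounded 0
  exact ⟨C, fun z hz => by simpa using hC z hz⟩

theorem IsBoundedSmooth.const (a : ℝ) : IsBoundedSmooth s (fun _ => a) where
  contDiff := contDiff_const
  bounded k := by
    rcases k with _ | k
    · exact ⟨|a|, fun z _ => by simp⟩
    · exact ⟨0, fun z _ => by rw [iteratedFDeriv_const_of_ne (by omega)]; simp⟩

theorem IsBoundedSmooth.mul {F G : E → ℝ} (hF : IsBoundedSmooth s F) (hG : IsBoundedSmooth s G) :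
    IsBoundedSmooth s (fun z => F z * G z) where
  contDiff := hF.contDiff.mul hG.contDiff
  bounded k := by
    choose CF hCF using hF.bounded
    choose CG hCG using hG.bounded
    refine ⟨∑ i ∈ Finset.range (k + 1), (k.choose i : ℝ) * CF i * CG (k - i), fun z hz => ?_⟩
    refine (norm_iteratedFDeriv_mul_le hF.contDiff hG.contDiff z
      (WithTop.coe_le_coe.2 le_top)).trans (Finset.sum_le_sum fun i _ => ?_)
    have h1 := hCF i z hz
    have h0 : 0 ≤ CF i := (norm_nonneg _).trans h1
    exact mul_le_mul (mul_le_mul_of_nonneg_left h1 (by positivity)) (hCG _ z hz) (norm_nonneg _)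
      (by positivity)

theorem IsBoundedSmooth.fderiv_apply {F : E → ℝ} (hF : IsBoundedSmooth s F) (v : E) :
    IsBoundedSmooth s (fun z => fderiv ℝ F z v) where
  contDiff := (hF.contDiff.fderiv_right (by simp)).clm_apply contDiff_const
  bounded k := by
    obtain ⟨C, hC⟩ := hF.bounded (k + 1)
    refine ⟨‖ContinuousLinearMap.apply ℝ ℝ v‖ * C, fun z hz => ?_⟩
    have hd : ContDiff ℝ ((⊤ : ℕ∞) : WithTop ℕ∞) (fderiv ℝ F) := hF.contDiff.fderiv_right (by simp)
    have h1 : (fun z => fderiv ℝ F z v) = (ContinuousLinearMap.apply ℝ ℝ v) ∘ fderiv ℝ F := rfl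
    rw [h1]
    refine ((ContinuousLinearMap.apply ℝ ℝ v).norm_iteratedFDeriv_comp_left (hd.contDiffAt) (n := k)
      (WithTop.coe_le_coe.2 le_top)).trans ?_
    refine mul_le_mul_of_nonneg_left ?_ (norm_nonneg _)
    rw [norm_iteratedFDeriv_fderiv]
    exact hC z hz

end BoundedSmooth

/-- Scaled frequencies `ω ≥ 1` together with nearby frequencies `ω'` such that every integer
relation of order at most `M` is either exact for `ω'` or bounded below by `γ` for `ω`. -/
structure ResonantApprox (n M : ℕ) (β γ : ℝ) where
  ω : Fin n → ℝ
  ω' : Fin n → ℝ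
  one_le : ∀ j, 1 ≤ ω j
  close : ∀ j, |ω' j - ω j| ≤ β
  nonres : ∀ ν : Fin n → ℤ, ∑ j, |(ν j : ℝ)| ≤ M → ∑ j, ω' j * ν j ≠ 0 → γ ≤ |∑ j, ω j * ν j|

/-- The arguments `(P, Q, u)` of the coupling. -/
abbrev CoupSpace (n d : ℕ) :=
  EuclideanSpace ℝ (Fin d) × EuclideanSpace ℝ (Fin d) × EuclideanSpace ℝ (Fin n)

/-- Phase space, with points `((P, Q, u), v)`. -/
abbrev PhaseSpace (n d : ℕ) := CoupSpace n d × EuclideanSpace ℝ (Fin n)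

/-! ### Monomials in the complex fast coordinates -/

section Monomials

variable {n d : ℕ} {Λ : Type*}

/-- A family of constants. -/
def constFam (c : Λ → ℂ) : SmoothFamily Λ (PhaseSpace n d) := ⟨fun θ _ => c θ, fun _ => contDiff_const⟩

/-- The coordinate `u j`. -/
def uFam (j : Fin n) : SmoothFamily Λ (PhaseSpace n d) :=
  ⟨fun _ y => ((y.1.2.2 j : ℝ) : ℂ), fun _ => Complex.ofRealCLM.contDiff.comp (by fun_prop)⟩

/-- The coordinate `v j`. -/
def vFam (j : Fin n) : SmoothFamily Λ (PhaseSpace n d) :=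
  ⟨fun _ y => ((y.2 j : ℝ) : ℂ), fun _ => Complex.ofRealCLM.contDiff.comp (by fun_prop)⟩

theorem fderiv_uFam (j : Fin n) (e y : PhaseSpace n d) (θ : Λ) :
    fderiv ℝ ((uFam j : SmoothFamily Λ (PhaseSpace n d)).1 θ) y e = ((e.1.2.2 j : ℝ) : ℂ) := by
  let l : PhaseSpace n d →L[ℝ] ℂ := Complex.ofRealCLM ∘L (EuclideanSpace.proj j) ∘L
    ContinuousLinearMap.snd ℝ _ _ ∘L ContinuousLinearMap.snd ℝ _ _ ∘L ContinuousLinearMap.fst ℝ _ _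
  change fderiv ℝ (l : PhaseSpace n d → ℂ) y e = _
  rw [l.fderiv]; rfl

theorem fderiv_vFam (j : Fin n) (e y : PhaseSpace n d) (θ : Λ) :
    fderiv ℝ ((vFam j : SmoothFamily Λ (PhaseSpace n d)).1 θ) y e = ((e.2 j : ℝ) : ℂ) := by
  let l : PhaseSpace n d →L[ℝ] ℂ := Complex.ofRealCLM ∘L (EuclideanSpace.proj j) ∘L
    ContinuousLinearMap.snd ℝ _ _
  change fderiv ℝ (l : PhaseSpace n d → ℂ) y e = _
  rw [l.fderiv]; rfl

theorem dirDeriv_uFam (e : PhaseSpace n d) (j : Fin n) :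
    dirDeriv e (uFam j : SmoothFamily Λ (PhaseSpace n d)) = constFam fun _ => (e.1.2.2 j : ℂ) := by
  ext θ y; exact fderiv_uFam j e y θ

theorem dirDeriv_vFam (e : PhaseSpace n d) (j : Fin n) :
    dirDeriv e (vFam j : SmoothFamily Λ (PhaseSpace n d)) = constFam fun _ => (e.2 j : ℂ) := by
  ext θ y; exact fderiv_vFam j e y θ

theorem dirDeriv_constFam (e : PhaseSpace n d) (c : Λ → ℂ) :
    dirDeriv e (constFam c : SmoothFamily Λ (PhaseSpace n d)) = 0 := by
  ext θ y
  change fderiv ℝ (fun _ : PhaseSpace n d => c θ) y e = 0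
  simp

theorem constFam_mul (c c' : Λ → ℂ) :
    (constFam c * constFam c' : SmoothFamily Λ (PhaseSpace n d)) = constFam (fun θ => c θ * c' θ) :=
  rfl

theorem constFam_zero : (constFam (fun _ => 0) : SmoothFamily Λ (PhaseSpace n d)) = 0 := rfl

theorem constFam_one : (constFam (fun _ => 1) : SmoothFamily Λ (PhaseSpace n d)) = 1 := rfl

theorem constFam_add (c c' : Λ → ℂ) :
    (constFam c + constFam c' : SmoothFamily Λ (PhaseSpace n d)) = constFam (fun θ => c θ + c' θ) :=
  rfl

/-- The family `c θ • F (P, Q, 0)`. -/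
def baseFam (c : Λ → ℂ) (F : CoupSpace n d → ℝ) (hF : ContDiff ℝ ((⊤ : ℕ∞) : WithTop ℕ∞) F) :
    SmoothFamily Λ (PhaseSpace n d) :=
  ⟨fun θ y => c θ * (F (y.1.1, y.1.2.1, 0) : ℝ), fun θ => contDiff_const.mul
    (Complex.ofRealCLM.contDiff.comp (hF.comp (by fun_prop)))⟩

theorem dirDeriv_baseFam (c : Λ → ℂ) (F : CoupSpace n d → ℝ)
    (hF : ContDiff ℝ ((⊤ : ℕ∞) : WithTop ℕ∞) F)
    (e : PhaseSpace n d) : dirDeriv e (baseFam c F hF) =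
      baseFam c (fun z => fderiv ℝ F z (e.1.1, e.1.2.1, 0))
        ((hF.fderiv_right (by simp)).clm_apply contDiff_const) := by
  ext θ y
  let l : PhaseSpace n d →L[ℝ] CoupSpace n d :=
    ((ContinuousLinearMap.fst ℝ _ _) ∘L ContinuousLinearMap.fst ℝ _ _).prod
      (((ContinuousLinearMap.fst ℝ _ _) ∘L (ContinuousLinearMap.snd ℝ _ _) ∘L
        ContinuousLinearMap.fst ℝ _ _).prod 0)
  have h1 : HasFDerivAt F (fderiv ℝ F (l y)) (l y) :=
    (hF.differentiable (by simp) (l y)).hasFDerivAt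
  have h2 := ((Complex.ofRealCLM.hasFDerivAt.comp y (h1.comp y l.hasFDerivAt)).const_mul (c θ)).fderiv
  change fderiv ℝ (fun y => c θ * (Complex.ofRealCLM ∘ F ∘ l) y) y e = _
  rw [h2]; rfl

theorem dirDeriv_baseFam_fast (c : Λ → ℂ) {F : CoupSpace n d → ℝ}
    (hF : ContDiff ℝ ((⊤ : ℕ∞) : WithTop ℕ∞) F) {e : PhaseSpace n d} (h1 : e.1.1 = 0)
    (h2 : e.1.2.1 = 0) : dirDeriv e (baseFam c F hF) = 0 := by
  rw [dirDeriv_baseFam]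
  ext θ y
  change c θ * ((fderiv ℝ F (y.1.1, y.1.2.1, 0) (e.1.1, e.1.2.1, 0) : ℝ) : ℂ) = 0
  rw [h1, h2, show ((0, 0, 0) : CoupSpace n d) = 0 from rfl, map_zero]
  simp

/-- The complex coordinate `u j + i v j`. -/
def wFam (j : Fin n) : SmoothFamily Λ (PhaseSpace n d) := uFam j + constFam (fun _ => Complex.I) * vFam j

/-- The complex coordinate `u j - i v j`. -/
def wbarFam (j : Fin n) : SmoothFamily Λ (PhaseSpace n d) :=
  uFam j - constFam (fun _ => Complex.I) * vFam j

theorem dirDeriv_wFam (e : PhaseSpace n d) (j : Fin n) :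
    dirDeriv e (wFam j : SmoothFamily Λ (PhaseSpace n d)) =
      constFam fun _ => (e.1.2.2 j : ℂ) + Complex.I * (e.2 j : ℂ) := by
  rw [wFam, map_add, Derivation.leibniz, dirDeriv_constFam, dirDeriv_uFam, dirDeriv_vFam, smul_zero,
    add_zero]
  rfl

theorem dirDeriv_wbarFam (e : PhaseSpace n d) (j : Fin n) :
    dirDeriv e (wbarFam j : SmoothFamily Λ (PhaseSpace n d)) =
      constFam fun _ => (e.1.2.2 j : ℂ) - Complex.I * (e.2 j : ℂ) := by
  rw [wbarFam, map_sub, Derivation.leibniz, dirDeriv_constFam, dirDeriv_uFam, dirDeriv_vFam,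
    smul_zero, add_zero]
  rfl

/-- The coordinate direction of `u j`. -/
def uDir (j : Fin n) : PhaseSpace n d := ((0, 0, EuclideanSpace.single j 1), 0)

/-- The coordinate direction of `v j`. -/
def vDir (j : Fin n) : PhaseSpace n d := (0, EuclideanSpace.single j 1)

/-- The coordinate direction of `P i`. -/
def pDir (i : Fin d) : PhaseSpace n d := ((EuclideanSpace.single i 1, 0, 0), 0)

/-- The coordinate direction of `Q i`. -/
def qDir (i : Fin d) : PhaseSpace n d := ((0, EuclideanSpace.single i 1, 0), 0)

/-- The rotation generator in the plane of `u j, v j`. -/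
def rotDeriv (j : Fin n) : Derivation ℂ (SmoothFamily Λ (PhaseSpace n d))
    (SmoothFamily Λ (PhaseSpace n d)) :=
  (uFam j : SmoothFamily Λ (PhaseSpace n d)) • dirDeriv (vDir j) -
    (vFam j : SmoothFamily Λ (PhaseSpace n d)) • dirDeriv (uDir j)

theorem rotDeriv_apply (j : Fin n) (F : SmoothFamily Λ (PhaseSpace n d)) :
    rotDeriv j F = uFam j * dirDeriv (vDir j) F - vFam j * dirDeriv (uDir j) F := rfl

/-- Monomials of degree `k` and Fourier index `ν` in the complex coordinates, with coefficients
bounded in the parameter and smooth in the slow variables. -/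
inductive IsMonomial (s : Set (CoupSpace n d)) :
    ℕ → (Fin n → ℤ) → SmoothFamily Λ (PhaseSpace n d) → Prop
  | base (c : Λ → ℂ) (hc : ∃ C : ℝ, ∀ θ, ‖c θ‖ ≤ C) (F : CoupSpace n d → ℝ)
      (hF : IsBoundedSmooth s F) : IsMonomial s 0 0 (baseFam c F hF.contDiff)
  | mul_w {k ν m} (j : Fin n) (hm : IsMonomial s k ν m) :
      IsMonomial s (k + 1) (ν + Pi.single j 1) (wFam j * m)
  | mul_wbar {k ν m} (j : Fin n) (hm : IsMonomial s k ν m) :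
      IsMonomial s (k + 1) (ν - Pi.single j 1) (wbarFam j * m)

variable {s : Set (CoupSpace n d)}

theorem IsMonomial.const_mul {k ν} {m : SmoothFamily Λ (PhaseSpace n d)} (hm : IsMonomial s k ν m)
    {c : Λ → ℂ} (hc : ∃ C : ℝ, ∀ θ, ‖c θ‖ ≤ C) : IsMonomial s k ν (constFam c * m) := by
  induction hm with
  | base c' hc' F hF =>
    obtain ⟨C, hC⟩ := hc
    obtain ⟨C', hC'⟩ := hc'
    have : (constFam c * baseFam c' F hF.contDiff : SmoothFamily Λ (PhaseSpace n d)) =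
        baseFam (fun θ => c θ * c' θ) F hF.contDiff := by
      ext θ y; exact (mul_assoc _ _ _).symm
    rw [this]
    refine IsMonomial.base _ ⟨C * C', fun θ => ?_⟩ F hF
    rw [norm_mul]
    exact mul_le_mul (hC θ) (hC' θ) (norm_nonneg _) ((norm_nonneg _).trans (hC θ))
  | mul_w j _ ih => rw [mul_left_comm]; exact ih.mul_w j
  | mul_wbar j _ ih => rw [mul_left_comm]; exact ih.mul_wbar j

theorem IsMonomial.base_mul {k ν} {m : SmoothFamily Λ (PhaseSpace n d)} (hm : IsMonomial s k ν m)
    {F : CoupSpace n d → ℝ} (hF : IsBoundedSmooth s F) :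
    IsMonomial s k ν (baseFam (fun _ => 1) F hF.contDiff * m) := by
  induction hm with
  | base c' hc' F' hF' =>
    have : (baseFam (fun _ => 1) F hF.contDiff * baseFam c' F' hF'.contDiff :
        SmoothFamily Λ (PhaseSpace n d)) =
        baseFam c' (fun z => F z * F' z) (hF.mul hF').contDiff := by
      ext θ y
      change ((1 : ℂ) * (F (y.1.1, y.1.2.1, 0) : ℝ)) * (c' θ * (F' (y.1.1, y.1.2.1, 0) : ℝ)) =
        c' θ * ((F (y.1.1, y.1.2.1, 0) * F' (y.1.1, y.1.2.1, 0) : ℝ) : ℂ)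
      push_cast; ring
    rw [this]
    exact IsMonomial.base _ hc' _ (hF.mul hF')
  | mul_w j _ ih => rw [mul_left_comm]; exact ih.mul_w j
  | mul_wbar j _ ih => rw [mul_left_comm]; exact ih.mul_wbar j

theorem IsMonomial.mul {k ν k' ν'} {m m' : SmoothFamily Λ (PhaseSpace n d)}
    (hm : IsMonomial s k ν m) (hm' : IsMonomial s k' ν' m') :
    IsMonomial s (k + k') (ν + ν') (m * m') := by
  induction hm with
  | base c hc F hF =>
    have : (baseFam c F hF.contDiff : SmoothFamily Λ (PhaseSpace n d)) =
        constFam c * baseFam (fun _ => 1) F hF.contDiff := by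
      ext θ y
      change c θ * _ = c θ * (1 * _)
      rw [one_mul]
    rw [this, mul_assoc, zero_add, zero_add]
    exact (hm'.base_mul hF).const_mul hc
  | mul_w j _ ih =>
    rw [mul_assoc, add_right_comm _ 1, add_right_comm _ (Pi.single (M := fun _ => ℤ) j 1)]
    exact ih.mul_w j
  | mul_wbar j _ ih =>
    rw [mul_assoc, add_right_comm _ 1, sub_add_eq_add_sub]
    exact ih.mul_wbar j

/-- Each `w_j` and its conjugate are eigenvectors of the rotation, with eigenvalues `I` and `-I`,
and the slow coefficient is invariant. The Leibniz rule adds the exponents. -/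
theorem IsMonomial.rotDeriv_eq {k ν} {m : SmoothFamily Λ (PhaseSpace n d)} (hm : IsMonomial s k ν m)
    (j : Fin n) : rotDeriv j m = constFam (fun _ => Complex.I * (ν j : ℂ)) * m := by
  have hI : (constFam (fun _ => Complex.I) * constFam (fun _ => Complex.I) :
      SmoothFamily Λ (PhaseSpace n d)) = -1 := by
    ext θ y; exact Complex.I_mul_I
  have hw : ∀ i : Fin n, rotDeriv j (wFam i : SmoothFamily Λ (PhaseSpace n d)) =
      constFam (fun _ => Complex.I * (Pi.single (M := fun _ => ℤ) i (1 : ℤ) j : ℂ)) * wFam i := by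
    intro i
    rw [rotDeriv_apply, dirDeriv_wFam, dirDeriv_wFam]
    by_cases h : i = j
    · subst h
      simp only [uDir, vDir, Prod.snd_zero, PiLp.zero_apply, Complex.ofReal_zero,
        PiLp.single_apply, if_true, Complex.ofReal_one, mul_one, zero_add, mul_zero,
        add_zero, Pi.single_eq_same, Int.cast_one, constFam_one, wFam]
      linear_combination -vFam i * hI
    · simp [uDir, vDir, h, Ne.symm h, constFam_zero]
  have hwb : ∀ i : Fin n, rotDeriv j (wbarFam i : SmoothFamily Λ (PhaseSpace n d)) =
      constFam (fun _ => Complex.I * (-Pi.single (M := fun _ => ℤ) i (1 : ℤ) j : ℂ)) * wbarFam i := by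
    intro i
    rw [rotDeriv_apply, dirDeriv_wbarFam, dirDeriv_wbarFam]
    have hneg : (constFam (fun _ => -Complex.I) : SmoothFamily Λ (PhaseSpace n d)) =
      -constFam (fun _ => Complex.I) := rfl
    by_cases h : i = j
    · subst h
      simp only [uDir, vDir, Prod.snd_zero, PiLp.zero_apply, Complex.ofReal_zero,
        PiLp.single_apply, if_true, Complex.ofReal_one, mul_one, zero_sub, mul_zero,
        sub_zero, Pi.single_eq_same, Int.cast_one, constFam_one, wbarFam, mul_neg, hneg]
      linear_combination -vFam i * hI
    · simp [uDir, vDir, h, Ne.symm h, constFam_zero]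
  induction hm with
  | base c hc F hF =>
    rw [rotDeriv_apply, dirDeriv_baseFam_fast c hF.contDiff rfl rfl,
      dirDeriv_baseFam_fast c hF.contDiff rfl rfl]
    simp [constFam_zero]
  | @mul_w k ν m i _ ih =>
    rw [Derivation.leibniz, ih, hw, smul_eq_mul, smul_eq_mul]
    have : (constFam (fun _ => Complex.I * (((ν + Pi.single i 1 : Fin n → ℤ) j : ℤ) : ℂ)) :
        SmoothFamily Λ (PhaseSpace n d)) = constFam (fun _ => Complex.I * (ν j : ℂ)) +
          constFam (fun _ => Complex.I * (Pi.single (M := fun _ => ℤ) i (1 : ℤ) j : ℂ)) := by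
      rw [constFam_add]; congr 1; ext θ; rw [Pi.add_apply]; push_cast; ring
    rw [this]; ring
  | @mul_wbar k ν m i _ ih =>
    rw [Derivation.leibniz, ih, hwb, smul_eq_mul, smul_eq_mul]
    have : (constFam (fun _ => Complex.I * (((ν - Pi.single i 1 : Fin n → ℤ) j : ℤ) : ℂ)) :
        SmoothFamily Λ (PhaseSpace n d)) = constFam (fun _ => Complex.I * (ν j : ℂ)) +
          constFam (fun _ => Complex.I * (-Pi.single (M := fun _ => ℤ) i (1 : ℤ) j : ℂ)) := by
      rw [constFam_add]; congr 1; ext θ; rw [Pi.sub_apply]; push_cast; ring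
    rw [this]; ring

/-- Each factor moves the Fourier index by one unit. Thus order `k` involves only integer relations
of length at most `k`, the kind controlled by `ResonantApprox`. -/
theorem IsMonomial.sum_abs_le {k ν} {m : SmoothFamily Λ (PhaseSpace n d)} (hm : IsMonomial s k ν m) :
    ∑ j, |(ν j : ℝ)| ≤ k := by
  have hs : ∀ i : Fin n, ∑ j, |((Pi.single (M := fun _ => ℤ) i (1 : ℤ) j : ℤ) : ℝ)| = 1 := by
    intro i
    rw [Finset.sum_eq_single i]
    · simp
    · intro j _ hj; simp [Pi.single_eq_of_ne hj]
    · simp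
  induction hm with
  | base => simp
  | @mul_w k ν m i _ ih =>
    push_cast
    refine (Finset.sum_le_sum fun j _ => ?_).trans
      ((Finset.sum_add_distrib).le.trans (add_le_add ih (hs i).le))
    rw [Pi.add_apply]; push_cast; exact abs_add_le _ _
  | @mul_wbar k ν m i _ ih =>
    push_cast
    refine (Finset.sum_le_sum fun j _ => ?_).trans
      ((Finset.sum_add_distrib).le.trans (add_le_add ih (hs i).le))
    rw [Pi.sub_apply]; push_cast; exact abs_sub _ _

/-- The bound is uniform in `θ`, since the parameter enters a monomial only through a bounded
constant. -/
theorem IsMonomial.exists_norm_le {k ν} {m : SmoothFamily Λ (PhaseSpace n d)}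
    (hm : IsMonomial s k ν m) (r : ℝ) : ∃ C : ℝ, ∀ (θ : Λ) (y : PhaseSpace n d),
      (y.1.1, y.1.2.1, 0) ∈ s → (∀ j, |y.1.2.2 j| ≤ r) → (∀ j, |y.2 j| ≤ r) → ‖m.1 θ y‖ ≤ C := by
  have hw : ∀ (j : Fin n) (y : PhaseSpace n d), |y.1.2.2 j| ≤ r → |y.2 j| ≤ r →
      ‖(y.1.2.2 j : ℂ)‖ + ‖Complex.I * (y.2 j : ℂ)‖ ≤ 2 * r := by
    intro j y h1 h2
    rw [norm_mul, Complex.norm_I, one_mul, Complex.norm_real, Complex.norm_real, Real.norm_eq_abs,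
      Real.norm_eq_abs]
    linarith
  induction hm with
  | base c hc F hF =>
    obtain ⟨C, hC⟩ := hc
    obtain ⟨C', hC'⟩ := hF.exists_abs_le
    refine ⟨C * C', fun θ y hy _ _ => ?_⟩
    change ‖c θ * ((F (y.1.1, y.1.2.1, 0) : ℝ) : ℂ)‖ ≤ _
    rw [norm_mul, Complex.norm_real]
    exact mul_le_mul (hC θ) (hC' _ hy) (norm_nonneg _) ((norm_nonneg _).trans (hC θ))
  | mul_w j _ ih =>
    obtain ⟨C, hC⟩ := ih
    refine ⟨2 * r * C, fun θ y hy h1 h2 => ?_⟩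
    have := (norm_add_le _ _).trans (hw j y (h1 j) (h2 j))
    change ‖((y.1.2.2 j : ℂ) + Complex.I * (y.2 j : ℂ)) * _‖ ≤ _
    rw [norm_mul]
    exact mul_le_mul this (hC θ y hy h1 h2) (norm_nonneg _) ((norm_nonneg _).trans this)
  | mul_wbar j _ ih =>
    obtain ⟨C, hC⟩ := ih
    refine ⟨2 * r * C, fun θ y hy h1 h2 => ?_⟩
    have := (norm_sub_le _ _).trans (hw j y (h1 j) (h2 j))
    change ‖((y.1.2.2 j : ℂ) - Complex.I * (y.2 j : ℂ)) * _‖ ≤ _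
    rw [norm_mul]
    exact mul_le_mul this (hC θ y hy h1 h2) (norm_nonneg _) ((norm_nonneg _).trans this)

end Monomials
end
end FastSlow

namespace FastSlow

noncomputable section

/-! ### Spans of monomials and rotations with given frequencies -/

section MonomialSpan

variable {n d : ℕ} {Λ : Type*} {s : Set (CoupSpace n d)}

/-- The span of the monomials of degree at most `k`. -/
def monomialSpan (Λ : Type*) (s : Set (CoupSpace n d)) (k : ℕ) :
    Submodule ℂ (SmoothFamily Λ (PhaseSpace n d)) :=
  Submodule.span ℂ {m | ∃ l ≤ k, ∃ ν, IsMonomial s l ν m}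

theorem IsMonomial.mem_span {k l : ℕ} {ν} {m : SmoothFamily Λ (PhaseSpace n d)}
    (hm : IsMonomial s l ν m) (h : l ≤ k) : m ∈ monomialSpan Λ s k :=
  Submodule.subset_span ⟨l, h, ν, hm⟩

theorem monomialSpan_mono {k l : ℕ} (h : k ≤ l) : monomialSpan Λ s k ≤ monomialSpan Λ s l :=
  Submodule.span_mono fun _ ⟨a, ha, ν, hm⟩ => ⟨a, ha.trans h, ν, hm⟩

theorem monomialSpan_mul {k l : ℕ} {F G : SmoothFamily Λ (PhaseSpace n d)}
    (hF : F ∈ monomialSpan Λ s k) (hG : G ∈ monomialSpan Λ s l) :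
    F * G ∈ monomialSpan Λ s (k + l) := by
  induction hF using Submodule.span_induction with
  | mem m hm =>
    obtain ⟨a, ha, ν, hm⟩ := hm
    induction hG using Submodule.span_induction with
    | mem m' hm' =>
      obtain ⟨a', ha', ν', hm'⟩ := hm'
      exact (hm.mul hm').mem_span (by omega)
    | zero => rw [mul_zero]; exact Submodule.zero_mem _
    | add _ _ _ _ h1 h2 => rw [mul_add]; exact Submodule.add_mem _ h1 h2
    | smul c _ _ h => rw [mul_smul_comm]; exact Submodule.smul_mem _ _ h
  | zero => rw [zero_mul]; exact Submodule.zero_mem _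
  | add _ _ _ _ h1 h2 => rw [add_mul]; exact Submodule.add_mem _ h1 h2
  | smul c _ _ h => rw [smul_mul_assoc]; exact Submodule.smul_mem _ _ h

theorem constFam_mul_mem {c : Λ → ℂ} (hc : ∃ C : ℝ, ∀ θ, ‖c θ‖ ≤ C) {k : ℕ}
    {F : SmoothFamily Λ (PhaseSpace n d)} (hF : F ∈ monomialSpan Λ s k) :
    constFam c * F ∈ monomialSpan Λ s k := by
  induction hF using Submodule.span_induction with
  | mem m hm =>
    obtain ⟨a, ha, ν, hm⟩ := hm
    exact (hm.const_mul hc).mem_span ha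
  | zero => rw [mul_zero]; exact Submodule.zero_mem _
  | add _ _ _ _ h1 h2 => rw [mul_add]; exact Submodule.add_mem _ h1 h2
  | smul c _ _ h => rw [mul_smul_comm]; exact Submodule.smul_mem _ _ h

/-- A derivative either hits the slow coefficient, which stays bounded smooth, or removes a fast
factor. Allowing all degrees up to `k` absorbs both cases. -/
theorem IsMonomial.dirDeriv_mem {k : ℕ} {ν} {m : SmoothFamily Λ (PhaseSpace n d)}
    (hm : IsMonomial s k ν m) (e : PhaseSpace n d) : dirDeriv e m ∈ monomialSpan Λ s k := by
  have hb : ∀ z : ℂ, ∃ C : ℝ, ∀ _ : Λ, ‖z‖ ≤ C := fun z => ⟨‖z‖, fun _ => le_rfl⟩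
  induction hm with
  | base c hc F hF =>
    rw [dirDeriv_baseFam]
    exact (IsMonomial.base c hc _ (hF.fderiv_apply _)).mem_span le_rfl
  | mul_w j hm ih =>
    rw [Derivation.leibniz, dirDeriv_wFam, smul_eq_mul, smul_eq_mul, mul_comm _ (constFam _)]
    refine Submodule.add_mem _ ?_ ((hm.const_mul (hb _)).mem_span (Nat.le_succ _))
    have h1 : (wFam j : SmoothFamily Λ (PhaseSpace n d)) ∈ monomialSpan Λ s 1 := by
      have := (IsMonomial.base (s := s) (Λ := Λ) (fun _ => 1) (hb 1) (fun _ => 1)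
        (IsBoundedSmooth.const 1)).mul_w j
      have h1 : (baseFam (fun _ => 1) (fun _ => 1) contDiff_const :
          SmoothFamily Λ (PhaseSpace n d)) = 1 := by
        ext θ y; change (1 : ℂ) * ((1 : ℝ) : ℂ) = 1; simp
      rw [h1, mul_one] at this
      exact this.mem_span le_rfl
    rw [add_comm _ 1]
    exact monomialSpan_mul h1 ih
  | mul_wbar j hm ih =>
    rw [Derivation.leibniz, dirDeriv_wbarFam, smul_eq_mul, smul_eq_mul, mul_comm _ (constFam _)]
    refine Submodule.add_mem _ ?_ ((hm.const_mul (hb _)).mem_span (Nat.le_succ _))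
    have h1 : (wbarFam j : SmoothFamily Λ (PhaseSpace n d)) ∈ monomialSpan Λ s 1 := by
      have := (IsMonomial.base (s := s) (Λ := Λ) (fun _ => 1) (hb 1) (fun _ => 1)
        (IsBoundedSmooth.const 1)).mul_wbar j
      have h1 : (baseFam (fun _ => 1) (fun _ => 1) contDiff_const :
          SmoothFamily Λ (PhaseSpace n d)) = 1 := by
        ext θ y; change (1 : ℂ) * ((1 : ℝ) : ℂ) = 1; simp
      rw [h1, mul_one] at this
      exact this.mem_span le_rfl
    rw [add_comm _ 1]
    exact monomialSpan_mul h1 ih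

theorem dirDeriv_mem_monomialSpan {k : ℕ} {F : SmoothFamily Λ (PhaseSpace n d)}
    (hF : F ∈ monomialSpan Λ s k) (e : PhaseSpace n d) : dirDeriv e F ∈ monomialSpan Λ s k := by
  induction hF using Submodule.span_induction with
  | mem m hm =>
    obtain ⟨a, ha, ν, hm⟩ := hm
    exact monomialSpan_mono ha (hm.dirDeriv_mem e)
  | zero => rw [map_zero]; exact Submodule.zero_mem _
  | add _ _ _ _ h1 h2 => rw [map_add]; exact Submodule.add_mem _ h1 h2
  | smul c _ _ h => rw [Derivation.map_smul]; exact Submodule.smul_mem _ _ h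

/-- Degree zero means that no fast variable occurs. This is why brackets with the order-zero part of
the coupling gain an order. -/
theorem dirDeriv_eq_zero_of_mem {F : SmoothFamily Λ (PhaseSpace n d)}
    (hF : F ∈ monomialSpan Λ s 0) {e : PhaseSpace n d} (h1 : e.1.1 = 0) (h2 : e.1.2.1 = 0) :
    dirDeriv e F = 0 := by
  induction hF using Submodule.span_induction with
  | mem m hm =>
    obtain ⟨a, ha, ν, hm⟩ := hm
    obtain rfl : a = 0 := by omega
    cases hm with
    | base c hc F hF => exact dirDeriv_baseFam_fast c hF.contDiff h1 h2
  | zero => rw [map_zero]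
  | add _ _ _ _ h1 h2 => rw [map_add, h1, h2, add_zero]
  | smul c _ _ h => rw [Derivation.map_smul, h, smul_zero]

theorem uFam_mul_mem {k : ℕ} {F : SmoothFamily Λ (PhaseSpace n d)}
    (hF : F ∈ monomialSpan Λ s k) (j : Fin n) : uFam j * F ∈ monomialSpan Λ s (k + 1) := by
  induction hF using Submodule.span_induction with
  | mem m hm =>
    obtain ⟨a, ha, ν, hm⟩ := hm
    have : (uFam j * m : SmoothFamily Λ (PhaseSpace n d)) =
        (2⁻¹ : ℂ) • (wFam j * m + wbarFam j * m) := by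
      rw [wFam, wbarFam, ← add_mul]
      have h2 : (uFam j + constFam (fun _ => Complex.I) * vFam j + (uFam j -
        constFam (fun _ => Complex.I) * vFam j) : SmoothFamily Λ (PhaseSpace n d)) =
          (2 : ℂ) • uFam j := by rw [two_smul]; ring
      rw [h2, smul_mul_assoc, smul_smul, inv_mul_cancel₀ two_ne_zero, one_smul]
    rw [this]
    exact Submodule.smul_mem _ _ (Submodule.add_mem _ ((hm.mul_w j).mem_span (by omega))
      ((hm.mul_wbar j).mem_span (by omega)))
  | zero => rw [mul_zero]; exact Submodule.zero_mem _
  | add _ _ _ _ h1 h2 => rw [mul_add]; exact Submodule.add_mem _ h1 h2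
  | smul c _ _ h => rw [mul_smul_comm]; exact Submodule.smul_mem _ _ h

theorem exists_norm_le_of_mem_monomialSpan {k : ℕ} {F : SmoothFamily Λ (PhaseSpace n d)}
    (hF : F ∈ monomialSpan Λ s k) (r : ℝ) : ∃ C : ℝ, ∀ (θ : Λ) (y : PhaseSpace n d),
      (y.1.1, y.1.2.1, 0) ∈ s → (∀ j, |y.1.2.2 j| ≤ r) → (∀ j, |y.2 j| ≤ r) → ‖F.1 θ y‖ ≤ C := by
  induction hF using Submodule.span_induction with
  | mem m hm =>
    obtain ⟨a, ha, ν, hm⟩ := hm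
    exact hm.exists_norm_le r
  | zero => exact ⟨0, fun θ y _ _ _ => by change ‖(0 : ℂ)‖ ≤ 0; simp⟩
  | add F G _ _ h1 h2 =>
    obtain ⟨C, hC⟩ := h1
    obtain ⟨C', hC'⟩ := h2
    exact ⟨C + C', fun θ y a b c => (norm_add_le _ _).trans (add_le_add (hC θ y a b c) (hC' θ y a b c))⟩
  | smul c F _ h =>
    obtain ⟨C, hC⟩ := h
    refine ⟨‖c‖ * C, fun θ y h1 h2 h3 => ?_⟩
    change ‖c * F.1 θ y‖ ≤ _
    rw [norm_mul]
    exact mul_le_mul_of_nonneg_left (hC θ y h1 h2 h3) (norm_nonneg _)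

/-- The generator `∑ j, ω j (u j ∂_{v j} - v j ∂_{u j})` of rotations with frequencies `ω`. -/
def rotation (ω : Λ → Fin n → ℝ) : Derivation ℂ (SmoothFamily Λ (PhaseSpace n d))
    (SmoothFamily Λ (PhaseSpace n d)) :=
  ∑ j, (constFam (fun θ => (ω θ j : ℂ)) : SmoothFamily Λ (PhaseSpace n d)) • rotDeriv j

theorem rotation_apply (ω : Λ → Fin n → ℝ) (F : SmoothFamily Λ (PhaseSpace n d)) :
    rotation ω F = ∑ j, constFam (fun θ => (ω θ j : ℂ)) * rotDeriv j F := by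
  have h := map_sum (Derivation.coeFnAddMonoidHom (R := ℂ) (A := SmoothFamily Λ (PhaseSpace n d))
    (M := SmoothFamily Λ (PhaseSpace n d)))
    (fun j => (constFam (fun θ => (ω θ j : ℂ)) : SmoothFamily Λ (PhaseSpace n d)) • rotDeriv j)
    Finset.univ
  exact (congrFun h F).trans (Finset.sum_apply F _ _)

theorem IsMonomial.rotation_eq {k : ℕ} {ν : Fin n → ℤ} {m : SmoothFamily Λ (PhaseSpace n d)}
    (hm : IsMonomial s k ν m) (ω : Λ → Fin n → ℝ) :
    rotation ω m = constFam (fun θ => Complex.I * ((∑ j, ω θ j * ν j : ℝ) : ℂ)) * m := by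
  rw [rotation_apply]
  simp only [hm.rotDeriv_eq, ← mul_assoc, ← Finset.sum_mul, constFam_mul]
  congr 1
  ext θ y
  have : SmoothFamily.eval Λ (PhaseSpace n d) θ y (∑ j, constFam fun θ => (ω θ j : ℂ) *
      Complex.I * (ν j : ℂ)) = Complex.I * ((∑ j, ω θ j * ν j : ℝ) : ℂ) := by
    rw [map_sum]
    change ∑ j, (ω θ j : ℂ) * Complex.I * (ν j : ℂ) = _
    push_cast
    rw [Finset.mul_sum]
    exact Finset.sum_congr rfl fun j _ => by ring
  exact this

theorem rotation_constFam_mul (ω : Λ → Fin n → ℝ) (c : Λ → ℂ) (F : SmoothFamily Λ (PhaseSpace n d)) :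
    rotation ω (constFam c * F) = constFam c * rotation ω F := by
  have h0 : rotation ω (constFam c : SmoothFamily Λ (PhaseSpace n d)) = 0 := by
    rw [rotation_apply]
    refine Finset.sum_eq_zero fun j _ => ?_
    rw [rotDeriv_apply, dirDeriv_constFam, dirDeriv_constFam]; ring
  rw [Derivation.leibniz, h0, smul_zero, add_zero, smul_eq_mul]

theorem rotation_eq_zero_of_mem (ω : Λ → Fin n → ℝ) {F : SmoothFamily Λ (PhaseSpace n d)}
    (hF : F ∈ monomialSpan Λ s 0) : rotation ω F = 0 := by
  rw [rotation_apply]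
  refine Finset.sum_eq_zero fun j _ => ?_
  rw [rotDeriv_apply, dirDeriv_eq_zero_of_mem hF rfl rfl, dirDeriv_eq_zero_of_mem hF rfl rfl]; ring

end MonomialSpan

/-! ### The homological equation without small divisors -/

section Homological

variable {n d M : ℕ} {β γ : ℝ} {s : Set (CoupSpace n d)}

/-- A monomial is an eigenvector of both rotations. If it is resonant for `ω'` it is kept; otherwise
it is divided by its `ω`-eigenvalue, of modulus at least `γ`. Since the frequencies are not bounded
above, boundedness of the two rotated solutions has to be proved as well. -/
theorem exists_homological_of_isMonomial (hγ : 0 < γ) (hβ : 0 ≤ β) {k : ℕ} (hk : k ≤ M)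
    {ν : Fin n → ℤ}
    {m : SmoothFamily (ResonantApprox n M β γ) (PhaseSpace n d)} (hm : IsMonomial s k ν m) :
    ∃ χ ∈ monomialSpan _ s k, rotation ResonantApprox.ω χ ∈ monomialSpan _ s k ∧
      rotation ResonantApprox.ω' χ ∈ monomialSpan _ s k ∧
      rotation ResonantApprox.ω' (m - rotation ResonantApprox.ω χ) = 0 := by
  classical
  have hν : ∑ j, |(ν j : ℝ)| ≤ M := hm.sum_abs_le.trans (by exact_mod_cast hk)
  let a : ResonantApprox n M β γ → ℝ := fun θ => ∑ j, θ.ω j * ν j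
  let a' : ResonantApprox n M β γ → ℝ := fun θ => ∑ j, θ.ω' j * ν j
  have ha : ∀ θ, a' θ ≠ 0 → γ ≤ |a θ| := fun θ h => θ.nonres ν hν h
  -- With no absolute bound on `a'` available, it is compared with the divisor `a`.
  have haa : ∀ θ, |a' θ| ≤ |a θ| + β * M := by
    intro θ
    have h1 : |a' θ - a θ| ≤ β * M := by
      calc |a' θ - a θ| = |∑ j, (θ.ω' j - θ.ω j) * ν j| := by
            rw [← Finset.sum_sub_distrib]; congr 1; exact Finset.sum_congr rfl fun j _ => by ring
        _ ≤ ∑ j, β * |(ν j : ℝ)| := (Finset.abs_sum_le_sum_abs _ _).trans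
            (Finset.sum_le_sum fun j _ => by
              rw [abs_mul]; exact mul_le_mul_of_nonneg_right (θ.close j) (abs_nonneg _))
        _ ≤ β * M := by rw [← Finset.mul_sum]; exact mul_le_mul_of_nonneg_left hν hβ
    linarith [abs_sub_abs_le_abs_sub (a' θ) (a θ)]
  -- The case distinction follows `ω'` although the divisor belongs to `ω`: where `a' θ ≠ 0`, the
  -- divisor is bounded below.
  let c : ResonantApprox n M β γ → ℂ := fun θ =>
    if a' θ = 0 then 0 else (Complex.I * (a θ : ℂ))⁻¹
  have hnorm : ∀ θ, ‖Complex.I * (a θ : ℂ)‖ = |a θ| := by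
    intro θ; rw [norm_mul, Complex.norm_I, one_mul, Complex.norm_real, Real.norm_eq_abs]
  have hc : ∃ C : ℝ, ∀ θ, ‖c θ‖ ≤ C := by
    refine ⟨γ⁻¹, fun θ => ?_⟩
    simp only [c]
    split_ifs with h
    · rw [norm_zero]; positivity
    · rw [norm_inv, hnorm]
      exact inv_anti₀ hγ (ha θ h)
  have hc1 : ∃ C : ℝ, ∀ θ, ‖c θ * (Complex.I * (a θ : ℂ))‖ ≤ C := by
    refine ⟨1, fun θ => ?_⟩
    simp only [c]
    split_ifs with h
    · simp
    · have : 0 < |a θ| := hγ.trans_le (ha θ h)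
      rw [norm_mul, norm_inv, hnorm, inv_mul_cancel₀ this.ne']
  have hc2 : ∃ C : ℝ, ∀ θ, ‖c θ * (Complex.I * (a' θ : ℂ))‖ ≤ C := by
    refine ⟨1 + β * M / γ, fun θ => ?_⟩
    simp only [c]
    split_ifs with h
    · simp; positivity
    · have h0 : 0 < |a θ| := hγ.trans_le (ha θ h)
      rw [norm_mul, norm_inv, hnorm, norm_mul, Complex.norm_I, one_mul, Complex.norm_real,
        Real.norm_eq_abs, inv_mul_eq_div, div_le_iff₀ h0]
      have h1 : β * M ≤ β * M / γ * |a θ| := by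
        rw [div_mul_eq_mul_div, le_div_iff₀ hγ]
        exact mul_le_mul_of_nonneg_left (ha θ h) (by positivity)
      linarith [haa θ]
  refine ⟨constFam c * m, (hm.const_mul hc).mem_span le_rfl, ?_, ?_, ?_⟩
  · rw [rotation_constFam_mul, hm.rotation_eq, ← mul_assoc, constFam_mul]
    exact (hm.const_mul hc1).mem_span le_rfl
  · rw [rotation_constFam_mul, hm.rotation_eq, ← mul_assoc, constFam_mul]
    exact (hm.const_mul hc2).mem_span le_rfl
  · rw [map_sub, rotation_constFam_mul, hm.rotation_eq, hm.rotation_eq, ← mul_assoc, constFam_mul,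
      rotation_constFam_mul, hm.rotation_eq, ← mul_assoc, constFam_mul, ← sub_mul]
    have : ∀ θ, Complex.I * (a' θ : ℂ) - c θ * (Complex.I * (a θ : ℂ)) * (Complex.I * (a' θ : ℂ)) = 0 := by
      intro θ
      simp only [c]
      split_ifs with h
      · simp [h]
      · have h0 : Complex.I * (a θ : ℂ) ≠ 0 := by
          rw [← norm_ne_zero_iff, hnorm]; exact (hγ.trans_le (ha θ h)).ne'
        rw [inv_mul_cancel₀ h0, one_mul, sub_self]
    have h2 : (constFam (fun θ => Complex.I * (a' θ : ℂ)) - constFam (fun θ =>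
        c θ * (Complex.I * (a θ : ℂ)) * (Complex.I * (a' θ : ℂ))) :
          SmoothFamily (ResonantApprox n M β γ) (PhaseSpace n d)) = 0 := by
      ext θ y; exact this θ
    exact (congrArg (· * m) h2).trans (zero_mul m)

theorem exists_homological (hγ : 0 < γ) (hβ : 0 ≤ β) {k : ℕ} (hk : k ≤ M)
    {F : SmoothFamily (ResonantApprox n M β γ) (PhaseSpace n d)} (hF : F ∈ monomialSpan _ s k) :
    ∃ χ ∈ monomialSpan _ s k, rotation ResonantApprox.ω χ ∈ monomialSpan _ s k ∧
      rotation ResonantApprox.ω' χ ∈ monomialSpan _ s k ∧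
      rotation ResonantApprox.ω' (F - rotation ResonantApprox.ω χ) = 0 := by
  induction hF using Submodule.span_induction with
  | mem m hm =>
    obtain ⟨a, ha, ν, hm⟩ := hm
    obtain ⟨χ, h1, h2, h3, h4⟩ := exists_homological_of_isMonomial hγ hβ (ha.trans hk) hm
    exact ⟨χ, monomialSpan_mono ha h1, monomialSpan_mono ha h2, monomialSpan_mono ha h3, h4⟩
  | zero => exact ⟨0, by simp⟩
  | add F G _ _ h h' =>
    obtain ⟨χ, h1, h2, h3, h4⟩ := h
    obtain ⟨χ', h1', h2', h3', h4'⟩ := h'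
    refine ⟨χ + χ', Submodule.add_mem _ h1 h1', ?_, ?_, ?_⟩
    · rw [map_add]; exact Submodule.add_mem _ h2 h2'
    · rw [map_add]; exact Submodule.add_mem _ h3 h3'
    · rw [map_add, add_sub_add_comm, map_add, h4, h4', add_zero]
  | smul c F _ h =>
    obtain ⟨χ, h1, h2, h3, h4⟩ := h
    refine ⟨c • χ, Submodule.smul_mem _ _ h1, ?_, ?_, ?_⟩
    · rw [Derivation.map_smul]; exact Submodule.smul_mem _ _ h2
    · rw [Derivation.map_smul]; exact Submodule.smul_mem _ _ h3
    · rw [Derivation.map_smul, ← smul_sub, Derivation.map_smul, h4, smul_zero]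

end Homological
end
end FastSlow

namespace FastSlow

noncomputable section

open Polynomial

/-! ### The formal integral as a polynomial in the small parameter -/

section FormalNormalForm

variable {n d M : ℕ} {β γ : ℝ} {s : Set (CoupSpace n d)}

/-- Families over the resonant approximations. -/
abbrev ObsFamily (n d M : ℕ) (β γ : ℝ) : Type :=
  SmoothFamily (ResonantApprox n M β γ) (PhaseSpace n d)

/-- The family `θ ↦ (ω θ j)⁻¹` of constants. -/
def invFreq (j : Fin n) : ObsFamily n d M β γ := constFam fun θ => ((θ.ω j)⁻¹ : ℝ)

/-- The weights of the formal bracket: `(ω j)⁻¹` for the fast pairs and `X` for the slow pairs. -/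
def pairWeight : Fin n ⊕ Fin d → (ObsFamily n d M β γ)[X] :=
  Sum.elim (fun j => C (invFreq j)) (fun _ => X)

/-- The first derivations of the conjugate pairs. -/
def pairFst : Fin n ⊕ Fin d → Derivation ℂ (ObsFamily n d M β γ)[X] (ObsFamily n d M β γ)[X] :=
  Sum.elim (fun j => coeffDerivation (dirDeriv (uDir j))) (fun i => coeffDerivation (dirDeriv (qDir i)))

/-- The second derivations of the conjugate pairs. -/
def pairSnd : Fin n ⊕ Fin d → Derivation ℂ (ObsFamily n d M β γ)[X] (ObsFamily n d M β γ)[X] :=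
  Sum.elim (fun j => coeffDerivation (dirDeriv (vDir j))) (fun i => coeffDerivation (dirDeriv (pDir i)))

/-- The formal Poisson bracket on polynomials in the small parameter. -/
def formalBracket (F G : (ObsFamily n d M β γ)[X]) : (ObsFamily n d M β γ)[X] :=
  poissonBracket pairWeight pairFst pairSnd F G

theorem formalBracket_eq (F G : (ObsFamily n d M β γ)[X]) : formalBracket F G =
    ∑ j, C (invFreq j) * (coeffDerivation (dirDeriv (uDir j)) F * coeffDerivation (dirDeriv (vDir j)) G
      - coeffDerivation (dirDeriv (vDir j)) F * coeffDerivation (dirDeriv (uDir j)) G) +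
    ∑ i, X * (coeffDerivation (dirDeriv (qDir i)) F * coeffDerivation (dirDeriv (pDir i)) G
      - coeffDerivation (dirDeriv (pDir i)) F * coeffDerivation (dirDeriv (qDir i)) G) := by
  rw [formalBracket, poissonBracket, Fintype.sum_sum_type]; rfl

/-- The Lie ring structure of the formal bracket. -/
abbrev formalLieRing : LieRing (ObsFamily n d M β γ)[X] :=
  poissonLieRing (R := ℂ) pairWeight pairFst pairSnd
    (by rintro (i | i) (j | j) F <;> exact coeffDerivation_comm (dirDeriv_comm _ _) F)
    (by rintro (i | i) (j | j) F <;> exact coeffDerivation_comm (dirDeriv_comm _ _) F)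
    (by rintro (i | i) (j | j) F <;> exact coeffDerivation_comm (dirDeriv_comm _ _) F)
    (by
      rintro (i | i) (j | j)
      · exact (coeffDerivation_C _ _).trans (by rw [invFreq, dirDeriv_constFam, C_0])
      · exact coeffDerivation_X _
      · exact (coeffDerivation_C _ _).trans (by rw [invFreq, dirDeriv_constFam, C_0])
      · exact coeffDerivation_X _)
    (by
      rintro (i | i) (j | j)
      · exact (coeffDerivation_C _ _).trans (by rw [invFreq, dirDeriv_constFam, C_0])
      · exact coeffDerivation_X _
      · exact (coeffDerivation_C _ _).trans (by rw [invFreq, dirDeriv_constFam, C_0])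
      · exact coeffDerivation_X _)

/-- Polynomials whose coefficient of order `k` has degree at most `k`. -/
def weightedPoly (n d M : ℕ) (β γ : ℝ) (s : Set (CoupSpace n d)) :
    Submodule ℂ (ObsFamily n d M β γ)[X] where
  carrier := {F | ∀ k, F.coeff k ∈ monomialSpan _ s k}
  add_mem' hF hG k := by rw [coeff_add]; exact Submodule.add_mem _ (hF k) (hG k)
  zero_mem' k := by rw [coeff_zero]; exact Submodule.zero_mem _
  smul_mem' c F hF k := by rw [coeff_smul]; exact Submodule.smul_mem _ _ (hF k)

theorem mul_mem_weightedPoly {F G : (ObsFamily n d M β γ)[X]} (hF : F ∈ weightedPoly n d M β γ s)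
    (hG : G ∈ weightedPoly n d M β γ s) : F * G ∈ weightedPoly n d M β γ s := by
  intro k
  rw [coeff_mul]
  refine Submodule.sum_mem _ fun a ha => ?_
  rw [← Finset.HasAntidiagonal.mem_antidiagonal.1 ha]
  exact monomialSpan_mul (hF _) (hG _)

theorem coeffDerivation_mem_weightedPoly {F : (ObsFamily n d M β γ)[X]}
    (hF : F ∈ weightedPoly n d M β γ s) (e : PhaseSpace n d) :
    coeffDerivation (dirDeriv e) F ∈ weightedPoly n d M β γ s := fun k =>
  dirDeriv_mem_monomialSpan (hF k) e

theorem exists_norm_invFreq_le (j : Fin n) :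
    ∃ C : ℝ, ∀ θ : ResonantApprox n M β γ, ‖(((θ.ω j)⁻¹ : ℝ) : ℂ)‖ ≤ C := by
  refine ⟨1, fun θ => ?_⟩
  rw [Complex.norm_real, Real.norm_eq_abs, abs_of_pos (inv_pos.2 (zero_lt_one.trans_le (θ.one_le j)))]
  exact inv_le_one_of_one_le₀ (θ.one_le j)

/-- The fast weights are bounded constants because `ω ≥ 1`, and the slow weight `X` shifts
coefficients to an order where a higher degree is allowed. -/
theorem formalBracket_mem_weightedPoly {F G : (ObsFamily n d M β γ)[X]}
    (hF : F ∈ weightedPoly n d M β γ s) (hG : G ∈ weightedPoly n d M β γ s) :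
    formalBracket F G ∈ weightedPoly n d M β γ s := by
  have hp : ∀ e e' : PhaseSpace n d, coeffDerivation (dirDeriv e) F * coeffDerivation (dirDeriv e') G
      - coeffDerivation (dirDeriv e') F * coeffDerivation (dirDeriv e) G ∈
      weightedPoly n d M β γ s := fun e e' => Submodule.sub_mem _
    (mul_mem_weightedPoly (coeffDerivation_mem_weightedPoly hF _) (coeffDerivation_mem_weightedPoly hG _))
    (mul_mem_weightedPoly (coeffDerivation_mem_weightedPoly hF _) (coeffDerivation_mem_weightedPoly hG _))
  rw [formalBracket_eq]
  refine Submodule.add_mem _ (Submodule.sum_mem _ fun j _ k => ?_) (Submodule.sum_mem _ fun i _ k => ?_)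
  · rw [coeff_C_mul]
    exact constFam_mul_mem (exists_norm_invFreq_le j) (hp _ _ k)
  · rcases k with _ | k
    · rw [coeff_X_mul_zero]; exact Submodule.zero_mem _
    · rw [coeff_X_mul]; exact monomialSpan_mono (Nat.le_succ k) (hp _ _ k)

theorem X_pow_dvd_coeffDerivation {k : ℕ} {F : (ObsFamily n d M β γ)[X]} (hF : X ^ k ∣ F)
    (e : PhaseSpace n d) : X ^ k ∣ coeffDerivation (dirDeriv e) F := by
  rw [X_pow_dvd_iff] at hF ⊢
  intro i hi
  rw [coeff_coeffDerivation, hF i hi, map_zero]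

theorem X_pow_dvd_formalBracket {k l : ℕ} {F G : (ObsFamily n d M β γ)[X]} (hF : X ^ k ∣ F)
    (hG : X ^ l ∣ G) : X ^ (k + l) ∣ formalBracket F G := by
  have hp : ∀ e e' : PhaseSpace n d, X ^ (k + l) ∣
      coeffDerivation (dirDeriv e) F * coeffDerivation (dirDeriv e') G
      - coeffDerivation (dirDeriv e') F * coeffDerivation (dirDeriv e) G := fun e e' => by
    rw [pow_add]
    exact dvd_sub
      (mul_dvd_mul (X_pow_dvd_coeffDerivation hF _) (X_pow_dvd_coeffDerivation hG _))
      (mul_dvd_mul (X_pow_dvd_coeffDerivation hF _) (X_pow_dvd_coeffDerivation hG _))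
  rw [formalBracket_eq]
  exact dvd_add (Finset.dvd_sum fun j _ => (hp _ _).mul_left _)
    (Finset.dvd_sum fun j _ => (hp _ _).mul_left _)

/-- The extra factor has two sources: on fast pairs, the order-zero part of `G` is independent of
the fast variables; on slow pairs, the weight is `X`. -/
theorem X_pow_succ_dvd_formalBracket {k : ℕ} {F G : (ObsFamily n d M β γ)[X]} (hF : X ^ k ∣ F)
    (hG : G ∈ weightedPoly n d M β γ s) : X ^ (k + 1) ∣ formalBracket F G := by
  have h0 : ∀ e : PhaseSpace n d, e.1.1 = 0 → e.1.2.1 = 0 →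
      X ∣ coeffDerivation (dirDeriv e) G := fun e h1 h2 => by
    rw [X_dvd_iff, coeff_coeffDerivation]
    exact dirDeriv_eq_zero_of_mem (hG 0) h1 h2
  rw [formalBracket_eq]
  refine dvd_add (Finset.dvd_sum fun j _ => Dvd.dvd.mul_left (dvd_sub ?_ ?_) _)
    (Finset.dvd_sum fun j _ => ?_)
  · rw [pow_succ]; exact mul_dvd_mul (X_pow_dvd_coeffDerivation hF _) (h0 _ rfl rfl)
  · rw [pow_succ]; exact mul_dvd_mul (X_pow_dvd_coeffDerivation hF _) (h0 _ rfl rfl)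
  · rw [pow_succ']
    exact mul_dvd_mul_left _ (dvd_sub ((X_pow_dvd_coeffDerivation hF _).mul_right _)
      ((X_pow_dvd_coeffDerivation hF _).mul_right _))

/-- The quadratic family `∑ j, ω j * ω₁ j * (u j ^ 2 + v j ^ 2) / 2`. -/
def quadFam (ω₁ : ResonantApprox n M β γ → Fin n → ℝ) : ObsFamily n d M β γ :=
  ∑ j, constFam (fun θ => ((θ.ω j * ω₁ θ j / 2 : ℝ) : ℂ)) * (uFam j * uFam j + vFam j * vFam j)

theorem dirDeriv_quadFam (ω₁ : ResonantApprox n M β γ → Fin n → ℝ) (e : PhaseSpace n d) :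
    dirDeriv e (quadFam ω₁ : ObsFamily n d M β γ) = ∑ j, constFam (fun θ => ((θ.ω j * ω₁ θ j : ℝ) : ℂ)) *
      (constFam (fun _ => (e.1.2.2 j : ℂ)) * uFam j + constFam (fun _ => (e.2 j : ℂ)) * vFam j) := by
  rw [quadFam, map_sum]
  refine Finset.sum_congr rfl fun j _ => ?_
  rw [Derivation.leibniz, dirDeriv_constFam, map_add, Derivation.leibniz, Derivation.leibniz,
    dirDeriv_uFam, dirDeriv_vFam, smul_zero, add_zero]
  simp only [smul_eq_mul]
  have : (constFam (fun θ => ((θ.ω j * ω₁ θ j : ℝ) : ℂ)) : ObsFamily n d M β γ) =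
      constFam (fun θ => ((θ.ω j * ω₁ θ j / 2 : ℝ) : ℂ)) +
      constFam (fun θ => ((θ.ω j * ω₁ θ j / 2 : ℝ) : ℂ)) := by
    rw [constFam_add]; congr 1; ext θ; push_cast; ring
  rw [this]; ring

theorem dirDeriv_uDir_quadFam (ω₁ : ResonantApprox n M β γ → Fin n → ℝ) (i : Fin n) :
    dirDeriv (uDir i) (quadFam ω₁ : ObsFamily n d M β γ) =
      constFam (fun θ => ((θ.ω i * ω₁ θ i : ℝ) : ℂ)) * uFam i := by
  rw [dirDeriv_quadFam, Finset.sum_eq_single i]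
  · simp [uDir, constFam_one, constFam_zero]
  · intro j _ hj; simp [uDir, hj, constFam_zero]
  · simp

theorem dirDeriv_vDir_quadFam (ω₁ : ResonantApprox n M β γ → Fin n → ℝ) (i : Fin n) :
    dirDeriv (vDir i) (quadFam ω₁ : ObsFamily n d M β γ) =
      constFam (fun θ => ((θ.ω i * ω₁ θ i : ℝ) : ℂ)) * vFam i := by
  rw [dirDeriv_quadFam, Finset.sum_eq_single i]
  · simp [vDir, constFam_one, constFam_zero]
  · intro j _ hj; simp [vDir, hj, constFam_zero]
  · simp

theorem dirDeriv_slow_quadFam (ω₁ : ResonantApprox n M β γ → Fin n → ℝ) (e : PhaseSpace n d)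
    (h1 : e.1.2.2 = 0) (h2 : e.2 = 0) : dirDeriv e (quadFam ω₁ : ObsFamily n d M β γ) = 0 := by
  rw [dirDeriv_quadFam]
  refine Finset.sum_eq_zero fun j _ => ?_
  simp [h1, h2, constFam_zero]

/-- The bracket weight `1/ω_j` cancels the factor `ω_j` in the coefficients of `quadFam ω₁`, so that
this form generates the rotation with frequencies `ω₁`. -/
theorem coeff_formalBracket_quadFam (ω₁ : ResonantApprox n M β γ → Fin n → ℝ)
    (F : (ObsFamily n d M β γ)[X]) (k : ℕ) :
    (formalBracket (C (quadFam ω₁)) F).coeff k = rotation ω₁ (F.coeff k) := by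
  rw [formalBracket_eq, coeff_add]
  have h2 : (∑ i, X * (coeffDerivation (dirDeriv (qDir i)) (C (quadFam ω₁)) *
      coeffDerivation (dirDeriv (pDir i)) F
      - coeffDerivation (dirDeriv (pDir i)) (C (quadFam ω₁)) * coeffDerivation (dirDeriv (qDir i)) F)
        : (ObsFamily n d M β γ)[X]) = 0 := by
    refine Finset.sum_eq_zero fun i _ => ?_
    rw [coeffDerivation_C, coeffDerivation_C, dirDeriv_slow_quadFam _ _ rfl rfl,
      dirDeriv_slow_quadFam _ _ rfl rfl]
    simp
  rw [h2, coeff_zero, add_zero, finsetSum_coeff, rotation_apply]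
  refine Finset.sum_congr rfl fun j _ => ?_
  rw [coeffDerivation_C, coeffDerivation_C, dirDeriv_uDir_quadFam, dirDeriv_vDir_quadFam, coeff_C_mul,
    coeff_sub, coeff_C_mul, coeff_C_mul, coeff_coeffDerivation, coeff_coeffDerivation, rotDeriv_apply]
  have : (constFam (fun θ => (ω₁ θ j : ℂ)) : ObsFamily n d M β γ) =
      invFreq j * constFam (fun θ => ((θ.ω j * ω₁ θ j : ℝ) : ℂ)) := by
    rw [invFreq, constFam_mul]
    congr 1; ext θ
    have : θ.ω j ≠ 0 := (zero_lt_one.trans_le (θ.one_le j)).ne'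
    rw [← Complex.ofReal_mul, inv_mul_cancel_left₀ this]
  rw [this]; ring

theorem rotation_quadFam (ω₁ ω₂ : ResonantApprox n M β γ → Fin n → ℝ) :
    rotation ω₁ (quadFam ω₂ : ObsFamily n d M β γ) = 0 := by
  rw [rotation_apply]
  refine Finset.sum_eq_zero fun j _ => ?_
  rw [rotDeriv_apply, dirDeriv_vDir_quadFam, dirDeriv_uDir_quadFam]
  ring

/-- Existence of the formal integral: modulo `X ^ M`, the Hamiltonian `h + F` commutes with some
`h' + j`, where `h` and `h'` are the fast energies with frequencies `ω` and `ω'`. -/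
theorem exists_formal_integral (hγ : 0 < γ) (hβ : 0 ≤ β) (hM : 1 ≤ M) {F : (ObsFamily n d M β γ)[X]}
    (hF : F ∈ weightedPoly n d M β γ s) :
    ∃ j ∈ weightedPoly n d M β γ s, j.coeff 0 = 0 ∧ X ^ M ∣
      formalBracket (C (quadFam ResonantApprox.ω) + F) (C (quadFam ResonantApprox.ω') + j) := by
  let _ : LieRing (ObsFamily n d M β γ)[X] := formalLieRing
  let _ : LieAlgebra ℚ (ObsFamily n d M β γ)[X] :=
    { lie_smul := fun r x y => by
        have h := poissonBracket_smul_right (R := ℂ) (pairWeight (n := n) (d := d) (M := M) (β := β) (γ := γ)) pairFst pairSnd (r : ℂ) x y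
        have h1 : ∀ z : (ObsFamily n d M β γ)[X], r • z = (r : ℂ) • z := fun z => by
          ext k : 1
          rw [coeff_smul, coeff_smul]
          rfl
        rw [h1, h1]; exact h }
  have hbr : ∀ x y : (ObsFamily n d M β γ)[X], ⁅x, y⁆ = formalBracket x y := fun _ _ => rfl
  -- The filtration by powers of the small parameter.
  let I : ℕ → LieIdeal ℚ (ObsFamily n d M β γ)[X] := fun k =>
    { carrier := {F | X ^ k ∣ F}
      add_mem' := fun h1 h2 => dvd_add h1 h2
      zero_mem' := dvd_zero _
      smul_mem' := fun r x hx => by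
        rw [Set.mem_ofPred_eq, X_pow_dvd_iff] at *
        intro i hi; rw [coeff_smul, hx i hi, smul_zero]
      lie_mem := fun {x m} hm => by
        have := X_pow_dvd_formalBracket (k := 0) (F := x) (by simp) hm
        rwa [zero_add] at this }
  have hI : ∀ k x, x ∈ I k ↔ X ^ k ∣ x := fun _ _ => Iff.rfl
  have hIrot : ∀ (k : ℕ) (x : (ObsFamily n d M β γ)[X]),
      ⁅(C (quadFam ResonantApprox.ω') : (ObsFamily n d M β γ)[X]), x⁆ ∈ I k ↔
      ∀ i < k, rotation ResonantApprox.ω' (x.coeff i) = 0 := by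
    intro k x
    rw [hI, X_pow_dvd_iff, hbr]
    simp only [coeff_formalBracket_quadFam]
  have key := exists_commuting_modulo (L := (ObsFamily n d M β γ)[X]) hM I ?_ ?_ ?_
    ((weightedPoly n d M β γ s).restrictScalars ℚ) ?_ ?_
    (C (quadFam ResonantApprox.ω)) (C (quadFam ResonantApprox.ω')) ?_ ?_ F hF ?_
  · obtain ⟨j, hj, hj1, hj2⟩ := key
    refine ⟨j, hj, ?_, hj2⟩
    rw [hI, pow_one, X_dvd_iff] at hj1
    exact hj1
  · rw [eq_top_iff]; intro x _; rw [hI]; simp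
  · exact fun a b hab x hx => (pow_dvd_pow _ hab).trans hx
  · exact fun a b x hx y hy => X_pow_dvd_formalBracket hx hy
  · exact fun x hx y hy => formalBracket_mem_weightedPoly hx hy
  · exact fun k _ χ _ hχ G hG => X_pow_succ_dvd_formalBracket (s := s) hχ hG
  · rw [hbr]; ext k : 1
    rw [coeff_formalBracket_quadFam, coeff_C, coeff_zero]
    split_ifs
    · exact rotation_quadFam _ _
    · exact map_zero _
  · intro k hk1 hkM G hG hGk
    rw [hIrot] at hGk
    -- Orders below `k` already commute with `h'`, so the generator is a single monomial of order
    -- `k`. The sign in `h4` matches `⁅χ, h⁆ = -rotation ω χ`.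
    obtain ⟨χ, h1, h2, h3, h4⟩ := exists_homological hγ hβ hkM.le (hG k)
    have hmono : ∀ f ∈ monomialSpan _ s k,
        (monomial k f : (ObsFamily n d M β γ)[X]) ∈ weightedPoly n d M β γ s := by
      intro f hf i
      rw [coeff_monomial]
      split_ifs with h
      · rw [← h]; exact hf
      · exact Submodule.zero_mem _
    have hlie : ∀ ω₁ : ResonantApprox n M β γ → Fin n → ℝ,
        ⁅(monomial k χ : (ObsFamily n d M β γ)[X]), C (quadFam ω₁)⁆ =
          -monomial k (rotation ω₁ χ) := by
      intro ω₁
      rw [← lie_skew, hbr]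
      congr 1
      ext i : 1
      rw [coeff_formalBracket_quadFam, coeff_monomial, coeff_monomial]
      split_ifs
      · rfl
      · exact map_zero _
    refine ⟨monomial k χ, hmono χ h1, ?_, ?_, ?_, ?_⟩
    · rw [hI, X_pow_dvd_iff]
      intro i hi; rw [coeff_monomial, if_neg (by omega)]
    · rw [hlie]; exact Submodule.neg_mem _ (hmono _ h2)
    · rw [hlie]; exact Submodule.neg_mem _ (hmono _ h3)
    · rw [hlie, hIrot]
      intro i hi
      rw [coeff_add, coeff_neg, coeff_monomial]
      rcases Nat.lt_succ_iff_lt_or_eq.1 hi with h | h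
      · rw [if_neg (by omega), neg_zero, add_zero]; exact hGk i h
      · rw [if_pos h.symm, h, ← sub_eq_add_neg]; exact h4
  · rw [hIrot]
    intro i hi
    obtain rfl : i = 0 := by omega
    exact rotation_eq_zero_of_mem _ (hF 0)

/-- Divisibility by `X ^ M` alone gives no uniform bound on the error, because brackets with `h` and
`h'` multiply by unbounded frequencies. Once `j` is truncated below order `M`, only the bracket of
`F` with the truncation survives from order `M` on, and it lies in `weightedPoly`. -/
theorem exists_formal_integral_remainder (hγ : 0 < γ) (hβ : 0 ≤ β) (hM : 1 ≤ M)
    {F : (ObsFamily n d M β γ)[X]} (hF : F ∈ weightedPoly n d M β γ s)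
    (hdeg : ∀ k, M ≤ k → F.coeff k = 0) :
    ∃ j ∈ weightedPoly n d M β γ s, j.coeff 0 = 0 ∧
      formalBracket (C (quadFam ResonantApprox.ω) + F) (C (quadFam ResonantApprox.ω') + j) ∈
        weightedPoly n d M β γ s ∧ X ^ M ∣
      formalBracket (C (quadFam ResonantApprox.ω) + F) (C (quadFam ResonantApprox.ω') + j) := by
  obtain ⟨j, hj, hj0, hjM⟩ := exists_formal_integral hγ hβ hM hF
  -- Truncation changes `j` only by multiples of `X ^ M`, hence preserves the congruence.
  set t : (ObsFamily n d M β γ)[X] := ∑ i ∈ Finset.range M, monomial i (j.coeff i) with ht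
  have htc : ∀ k, t.coeff k = if k < M then j.coeff k else 0 := by
    intro k
    rw [ht, finsetSum_coeff]
    simp only [coeff_monomial, Finset.sum_ite_eq', Finset.mem_range]
  have hadd : ∀ F G G' : (ObsFamily n d M β γ)[X], formalBracket F (G + G') =
    formalBracket F G + formalBracket F G' := poissonBracket_add_right _ _ _
  have hadd' : ∀ F F' G : (ObsFamily n d M β γ)[X], formalBracket (F + F') G =
    formalBracket F G + formalBracket F' G := poissonBracket_add_left _ _ _
  have htW : t ∈ weightedPoly n d M β γ s := by
    intro k; rw [htc]; split_ifs
    · exact hj k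
    · exact Submodule.zero_mem _
  have hdvd : X ^ M ∣ formalBracket (C (quadFam ResonantApprox.ω) + F)
      (C (quadFam ResonantApprox.ω') + t) := by
    have h1 : X ^ M ∣ j - t := by
      rw [X_pow_dvd_iff]
      intro k hk
      rw [coeff_sub, htc, if_pos hk, sub_self]
    have h2 := X_pow_dvd_formalBracket (k := 0) (F := C (quadFam ResonantApprox.ω) + F)
      (by simp) h1
    rw [zero_add] at h2
    have h3 : C (quadFam ResonantApprox.ω') + j = C (quadFam ResonantApprox.ω') + t + (j - t) := by
      ring
    rw [h3, hadd] at hjM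
    exact (dvd_add_left h2).1 hjM
  refine ⟨t, htW, by rw [htc, hj0, ite_self], fun k => ?_, hdvd⟩
  rcases lt_or_ge k M with hk | hk
  · rw [X_pow_dvd_iff.1 hdvd k hk]; exact Submodule.zero_mem _
  · rw [hadd', coeff_add, coeff_formalBracket_quadFam, coeff_add, coeff_C, if_neg (by omega), zero_add,
      htc, if_neg (by omega), map_zero, zero_add, hadd, coeff_add]
    refine Submodule.add_mem _ ?_ (formalBracket_mem_weightedPoly hF htW k)
    have : formalBracket F (C (quadFam ResonantApprox.ω')) =
        -formalBracket (C (quadFam ResonantApprox.ω')) F := poissonBracket_skew _ _ _ _ _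
    rw [this, coeff_neg, coeff_formalBracket_quadFam, hdeg k hk, map_zero, neg_zero]
    exact Submodule.zero_mem _

end FormalNormalForm
end
end FastSlow

namespace FastSlow

noncomputable section

/-! ### Dirichlet approximation of the frequencies -/

/-- Simultaneous Dirichlet approximation. -/
theorem exists_simultaneous_approx {n : ℕ} (Q : ℕ) (hQ : 0 < Q) (ω : Fin n → ℝ) :
    ∃ T : ℕ, 0 < T ∧ T ≤ Q ^ n ∧ ∃ k : Fin n → ℤ, ∀ j, |T * ω j - k j| ≤ 1 / Q := by
  have hQ' : (0 : ℝ) < Q := by exact_mod_cast hQ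
  -- Pigeonhole: the fractional parts of `Q ^ n + 1` multiples of `ω` fall into `Q ^ n` cubes of
  -- side `1 / Q`.
  let f : Fin (Q ^ n + 1) → Fin n → Fin Q := fun t j =>
    ⟨⌊(Q : ℝ) * Int.fract ((t : ℕ) * ω j)⌋₊, by
      rw [Nat.floor_lt (mul_nonneg hQ'.le (Int.fract_nonneg _))]
      exact mul_lt_of_lt_one_right hQ' (Int.fract_lt_one _)⟩
  obtain ⟨a, b, hab, hf⟩ := Fintype.exists_ne_map_eq_of_card_lt f (by simp)
  wlog hlt : a < b generalizing a b
  · exact this b a hab.symm hf.symm (lt_of_le_of_ne (not_lt.1 hlt) hab.symm)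
  have hlt' : (a : ℕ) < b := hlt
  refine ⟨b - a, by omega, by omega, fun j => ⌊(b : ℕ) * ω j⌋ - ⌊(a : ℕ) * ω j⌋, fun j => ?_⟩
  have h1 : ⌊(Q : ℝ) * Int.fract ((a : ℕ) * ω j)⌋₊ = ⌊(Q : ℝ) * Int.fract ((b : ℕ) * ω j)⌋₊ :=
    congrArg Fin.val (congrFun hf j)
  have ha := Nat.floor_le (mul_nonneg hQ'.le (Int.fract_nonneg ((a : ℕ) * ω j)))
  have ha' := Nat.lt_floor_add_one ((Q : ℝ) * Int.fract ((a : ℕ) * ω j))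
  have hb := Nat.floor_le (mul_nonneg hQ'.le (Int.fract_nonneg ((b : ℕ) * ω j)))
  have hb' := Nat.lt_floor_add_one ((Q : ℝ) * Int.fract ((b : ℕ) * ω j))
  rw [h1] at ha ha'
  have h2 : ((b - a : ℕ) : ℝ) * ω j - ((⌊(b : ℕ) * ω j⌋ - ⌊(a : ℕ) * ω j⌋ : ℤ) : ℝ) =
      Int.fract ((b : ℕ) * ω j) - Int.fract ((a : ℕ) * ω j) := by
    rw [Nat.cast_sub hlt'.le, ← Int.self_sub_floor, ← Int.self_sub_floor]
    push_cast; ring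
  rw [h2, le_div_iff₀ hQ', show |Int.fract ((b : ℕ) * ω j) - Int.fract ((a : ℕ) * ω j)| * (Q : ℝ) =
    |(Int.fract ((b : ℕ) * ω j) - Int.fract ((a : ℕ) * ω j)) * Q| by
      rw [abs_mul, abs_of_pos hQ'], abs_le]
  constructor <;> nlinarith

/-- Every vector of frequencies `≥ 1` has a resonant approximation, with a uniform threshold. -/
theorem exists_resonantApprox (n M : ℕ) {β : ℝ} (hβ : 0 < β) :
    ∃ γ : ℝ, 0 < γ ∧ ∀ ω : Fin n → ℝ, (∀ j, 1 ≤ ω j) → ∃ θ : ResonantApprox n M β γ, θ.ω = ω := by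
  -- `Q > 1 / β` gives closeness; `Q > 2M + 1` makes the error of an integer relation at most half
  -- of the gap `1 / T`.
  obtain ⟨Q, hQ⟩ := exists_nat_gt (max (2 * (M : ℝ) + 1) (1 / β))
  have hQM : 2 * (M : ℝ) + 1 < Q := (le_max_left _ _).trans_lt hQ
  have hQβ : 1 / β < Q := (le_max_right _ _).trans_lt hQ
  have hQ0 : (0 : ℝ) < Q := lt_trans (by positivity) hQM
  -- The threshold is half the smallest possible gap, as `T ≤ Q ^ n`; it does not depend on `ω`.
  refine ⟨1 / (2 * (Q : ℝ) ^ n), by positivity, fun ω hω => ?_⟩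
  obtain ⟨T, hT0, hTQ, k, hk⟩ := exists_simultaneous_approx Q (by exact_mod_cast hQ0) ω
  have hT : (1 : ℝ) ≤ T := by exact_mod_cast hT0
  have hT' : (T : ℝ) ≤ (Q : ℝ) ^ n := by exact_mod_cast hTQ
  have hTpos : (0 : ℝ) < T := by linarith
  have hQinv : 1 / (Q : ℝ) ≤ β := by
    rw [div_le_iff₀ hQ0]; rw [div_lt_iff₀ hβ] at hQβ; linarith
  have hdiff : ∀ j, |(k j : ℝ) / T - ω j| ≤ 1 / (Q * T) := by
    intro j
    have : (k j : ℝ) / T - ω j = -(T * ω j - k j) / T := by field_simp; ring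
    rw [this, abs_div, abs_neg, abs_of_pos hTpos, div_le_iff₀ hTpos]
    refine (hk j).trans (le_of_eq ?_)
    field_simp
  refine ⟨⟨ω, fun j => k j / T, hω, fun j => ?_, fun ν hν hne => ?_⟩, rfl⟩
  · refine (hdiff j).trans (le_trans ?_ hQinv)
    exact one_div_le_one_div_of_le hQ0 (le_mul_of_one_le_right hQ0.le hT)
  · have hsum : ∑ j, (k j : ℝ) / T * ν j = ((∑ j, k j * ν j : ℤ) : ℝ) / T := by
      push_cast; rw [Finset.sum_div]; exact Finset.sum_congr rfl fun j _ => by ring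
    -- A nonzero relation for the rational vector `k / T` is a nonzero integer over `T`.
    have h1 : 1 / (T : ℝ) ≤ |∑ j, (k j : ℝ) / T * ν j| := by
      rw [hsum, abs_div, abs_of_pos hTpos]
      refine div_le_div_of_nonneg_right ?_ hTpos.le
      have h0 : (∑ j, k j * ν j : ℤ) ≠ 0 := by
        intro h; rw [hsum, h] at hne; simp at hne
      exact_mod_cast Int.one_le_abs h0
    have h2 : |∑ j, (k j : ℝ) / T * ν j - ∑ j, ω j * ν j| ≤ M / (Q * T) := by
      rw [← Finset.sum_sub_distrib]
      calc |∑ j, ((k j : ℝ) / T * ν j - ω j * ν j)|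
          ≤ ∑ j, 1 / (Q * T) * |(ν j : ℝ)| := (Finset.abs_sum_le_sum_abs _ _).trans
            (Finset.sum_le_sum fun j _ => by
              rw [← sub_mul, abs_mul]
              exact mul_le_mul_of_nonneg_right (hdiff j) (abs_nonneg _))
        _ ≤ 1 / (Q * T) * M := by
              rw [← Finset.mul_sum]; exact mul_le_mul_of_nonneg_left hν (by positivity)
        _ = M / (Q * T) := by ring
    have h3 : (M : ℝ) / (Q * T) ≤ 1 / (2 * T) := by
      rw [div_le_div_iff₀ (by positivity) (by positivity)]; nlinarith
    have h4 : 1 / (2 * (Q : ℝ) ^ n) ≤ 1 / (2 * T) :=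
      one_div_le_one_div_of_le (by positivity) (by linarith)
    have h5 : 1 / (T : ℝ) = 1 / (2 * T) + 1 / (2 * T) := by field_simp; norm_num
    have h6 := abs_sub_abs_le_abs_sub (∑ j, (k j : ℝ) / T * ν j) (∑ j, ω j * ν j)
    linarith

/-! ### Taylor expansion of the coupling in the fast variable -/

section Taylor

variable {n d : ℕ}

/-- The coordinate direction of `u j` in the space of arguments of the coupling. -/
def fastDir (j : Fin n) : CoupSpace n d := (0, 0, EuclideanSpace.single j 1)

/-- The homogeneous term of degree `k` of the Taylor expansion in the fast variable. -/
def taylorTerm : ℕ → (CoupSpace n d → ℝ) → CoupSpace n d → ℝ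
  | 0, F => fun z => F (z.1, z.2.1, 0)
  | k + 1, F => fun z =>
      ((k : ℝ) + 1)⁻¹ * ∑ j, z.2.2 j * taylorTerm k (fun y => fderiv ℝ F y (fastDir j)) z

theorem contDiff_fderiv_dir {E : Type*} [NormedAddCommGroup E] [NormedSpace ℝ E] {F : E → ℝ}
    (hF : ContDiff ℝ ((⊤ : ℕ∞) : WithTop ℕ∞) F) (e : E) :
    ContDiff ℝ ((⊤ : ℕ∞) : WithTop ℕ∞) fun y => fderiv ℝ F y e :=
  (hF.fderiv_right (by simp)).clm_apply contDiff_const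

theorem fderiv_dir_comm {E : Type*} [NormedAddCommGroup E] [NormedSpace ℝ E] {F : E → ℝ}
    (hF : ContDiff ℝ ((⊤ : ℕ∞) : WithTop ℕ∞) F) (v v' : E) :
    (fun z => fderiv ℝ (fun y => fderiv ℝ F y v') z v) =
      fun z => fderiv ℝ (fun y => fderiv ℝ F y v) z v' := by
  ext z
  have hd : DifferentiableAt ℝ (fderiv ℝ F) z :=
    (hF.fderiv_right (m := 1) (by norm_cast)).differentiable (by simp) z
  rw [fderiv_clm_apply hd (differentiableAt_const _), fderiv_clm_apply hd (differentiableAt_const _)]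
  simpa using (hF.contDiffAt.isSymmSndFDerivAt (by simpa using two_le_smooth)) v v'

theorem contDiff_taylorTerm (k : ℕ) {F : CoupSpace n d → ℝ}
    (hF : ContDiff ℝ ((⊤ : ℕ∞) : WithTop ℕ∞) F) :
    ContDiff ℝ ((⊤ : ℕ∞) : WithTop ℕ∞) (taylorTerm k F) := by
  induction k generalizing F with
  | zero => exact hF.comp (by fun_prop)
  | succ k ih =>
    refine contDiff_const.mul (ContDiff.sum fun j _ => ?_)
    exact ContDiff.mul (by fun_prop) (ih (contDiff_fderiv_dir hF _))

theorem fderiv_fastCoord (j : Fin n) (z e : CoupSpace n d) :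
    fderiv ℝ (fun z : CoupSpace n d => z.2.2 j) z e = e.2.2 j := by
  let l : CoupSpace n d →L[ℝ] ℝ := (EuclideanSpace.proj j) ∘L
    ContinuousLinearMap.snd ℝ _ _ ∘L ContinuousLinearMap.snd ℝ _ _
  change fderiv ℝ (l : CoupSpace n d → ℝ) z e = _
  rw [l.fderiv]; rfl

theorem fderiv_taylorTerm_zero {F : CoupSpace n d → ℝ}
    (hF : ContDiff ℝ ((⊤ : ℕ∞) : WithTop ℕ∞) F) (z e : CoupSpace n d) :
    fderiv ℝ (taylorTerm 0 F) z e = fderiv ℝ F (z.1, z.2.1, 0) (e.1, e.2.1, 0) := by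
  let l : CoupSpace n d →L[ℝ] CoupSpace n d :=
    (ContinuousLinearMap.fst ℝ _ _).prod
      (((ContinuousLinearMap.fst ℝ _ _) ∘L (ContinuousLinearMap.snd ℝ _ _)).prod 0)
  have h1 : HasFDerivAt F (fderiv ℝ F (l z)) (l z) :=
    (hF.differentiable (by simp) (l z)).hasFDerivAt
  change fderiv ℝ (F ∘ l) z e = _
  rw [(h1.comp z l.hasFDerivAt).fderiv]; rfl

theorem fderiv_taylorTerm_succ (k : ℕ) {F : CoupSpace n d → ℝ}
    (hF : ContDiff ℝ ((⊤ : ℕ∞) : WithTop ℕ∞) F) (z e : CoupSpace n d) :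
    fderiv ℝ (taylorTerm (k + 1) F) z e = ((k : ℝ) + 1)⁻¹ * ∑ j,
      (z.2.2 j * fderiv ℝ (taylorTerm k (fun y => fderiv ℝ F y (fastDir j))) z e +
        taylorTerm k (fun y => fderiv ℝ F y (fastDir j)) z * e.2.2 j) := by
  have hc : ∀ j : Fin n, DifferentiableAt ℝ (fun z : CoupSpace n d => z.2.2 j) z := by
    intro j; fun_prop
  have ht : ∀ j : Fin n, DifferentiableAt ℝ
      (taylorTerm k (fun y => fderiv ℝ F y (fastDir j))) z := fun j =>
    (contDiff_taylorTerm k (contDiff_fderiv_dir hF _)).differentiable (by simp) z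
  have hm : ∀ j ∈ Finset.univ, DifferentiableAt ℝ (fun z : CoupSpace n d =>
      z.2.2 j * taylorTerm k (fun y => fderiv ℝ F y (fastDir j)) z) z := fun j _ =>
    (hc j).mul (ht j)
  change fderiv ℝ (fun z : CoupSpace n d => ((k : ℝ) + 1)⁻¹ * ∑ j, z.2.2 j *
    taylorTerm k (fun y => fderiv ℝ F y (fastDir j)) z) z e = _
  rw [fderiv_const_mul (DifferentiableAt.fun_sum hm), fderiv_fun_sum hm]
  simp only [smul_apply, sum_apply, smul_eq_mul]
  congr 1
  refine Finset.sum_congr rfl fun j _ => ?_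
  rw [fderiv_fun_mul (hc j) (ht j)]
  simp only [add_apply, smul_apply, smul_eq_mul,
    fderiv_fastCoord]

/-- Slow derivatives pass through the recursion because partial derivatives commute. -/
theorem fderiv_taylorTerm_slow (k : ℕ) {F : CoupSpace n d → ℝ}
    (hF : ContDiff ℝ ((⊤ : ℕ∞) : WithTop ℕ∞) F) (z : CoupSpace n d) {e : CoupSpace n d}
    (he : e.2.2 = 0) :
    fderiv ℝ (taylorTerm k F) z e = taylorTerm k (fun y => fderiv ℝ F y e) z := by
  induction k generalizing F with
  | zero =>
    rw [fderiv_taylorTerm_zero hF]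
    obtain ⟨e1, e2, e3⟩ := e
    obtain rfl : e3 = 0 := he
    rfl
  | succ k ih =>
    rw [fderiv_taylorTerm_succ k hF]
    change _ = ((k : ℝ) + 1)⁻¹ * ∑ j, z.2.2 j * _
    congr 1
    refine Finset.sum_congr rfl fun j _ => ?_
    rw [ih (contDiff_fderiv_dir hF _), he, fderiv_dir_comm hF]
    simp

theorem fderiv_taylorTerm_fast_zero {F : CoupSpace n d → ℝ}
    (hF : ContDiff ℝ ((⊤ : ℕ∞) : WithTop ℕ∞) F) (z : CoupSpace n d) (j : Fin n) :
    fderiv ℝ (taylorTerm 0 F) z (fastDir j) = 0 := by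
  rw [fderiv_taylorTerm_zero hF]
  exact (fderiv ℝ F _).map_zero

/-- The recursion defining `taylorTerm` is Euler's identity for homogeneous functions.
Differentiating it gives `k + 1` copies of the claim from the inductive hypothesis and one from the
product rule. -/
theorem fderiv_taylorTerm_fast_succ (k : ℕ) {F : CoupSpace n d → ℝ}
    (hF : ContDiff ℝ ((⊤ : ℕ∞) : WithTop ℕ∞) F) (z : CoupSpace n d) (j : Fin n) :
    fderiv ℝ (taylorTerm (k + 1) F) z (fastDir j) =
      taylorTerm k (fun y => fderiv ℝ F y (fastDir j)) z := by
  have hs : ∀ (k : ℕ) (F : CoupSpace n d → ℝ), ∑ i, taylorTerm k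
      (fun y => fderiv ℝ F y (fastDir i)) z * (fastDir j : CoupSpace n d).2.2 i =
      taylorTerm k (fun y => fderiv ℝ F y (fastDir j)) z := by
    intro k F
    rw [Finset.sum_eq_single j]
    · simp [fastDir]
    · intro i _ hi; simp [fastDir, hi]
    · simp
  induction k generalizing F with
  | zero =>
    rw [fderiv_taylorTerm_succ 0 hF, Finset.sum_add_distrib, hs]
    simp [fderiv_taylorTerm_fast_zero (contDiff_fderiv_dir hF _)]
  | succ k ih =>
    rw [fderiv_taylorTerm_succ (k + 1) hF, Finset.sum_add_distrib, hs]
    simp only [ih (contDiff_fderiv_dir hF _)]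
    have h1 : ∑ i, z.2.2 i * taylorTerm k
        (fun y => fderiv ℝ (fun y => fderiv ℝ F y (fastDir i)) y (fastDir j)) z =
        ((k : ℝ) + 1) * taylorTerm (k + 1) (fun y => fderiv ℝ F y (fastDir j)) z := by
      have : (k : ℝ) + 1 ≠ 0 := by positivity
      rw [taylorTerm, mul_inv_cancel_left₀ this]
      exact Finset.sum_congr rfl fun i _ => by rw [fderiv_dir_comm hF]
    rw [h1]
    push_cast
    have : (k : ℝ) + 1 + 1 ≠ 0 := by positivity
    field_simp

theorem taylorTerm_smul (k : ℕ) (F : CoupSpace n d → ℝ) (z : CoupSpace n d) (a : ℝ) :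
    taylorTerm k F (z.1, z.2.1, a • z.2.2) = a ^ k * taylorTerm k F z := by
  induction k generalizing F with
  | zero => simp [taylorTerm]
  | succ k ih =>
    simp only [taylorTerm, ih]
    rw [mul_left_comm]
    congr 1
    rw [Finset.mul_sum]
    exact Finset.sum_congr rfl fun j _ => by simp; ring

/-- The remainder of order `K` of the Taylor expansion in the fast variable. -/
def taylorRemainder (K : ℕ) (F : CoupSpace n d → ℝ) (z : CoupSpace n d) : ℝ :=
  F z - ∑ k ∈ Finset.range K, taylorTerm k F z

theorem contDiff_taylorRemainder (K : ℕ) {F : CoupSpace n d → ℝ}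
    (hF : ContDiff ℝ ((⊤ : ℕ∞) : WithTop ℕ∞) F) :
    ContDiff ℝ ((⊤ : ℕ∞) : WithTop ℕ∞) (taylorRemainder K F) :=
  hF.sub (ContDiff.sum fun k _ => contDiff_taylorTerm k hF)

theorem fderiv_taylorRemainder (K : ℕ) {F : CoupSpace n d → ℝ}
    (hF : ContDiff ℝ ((⊤ : ℕ∞) : WithTop ℕ∞) F) (z e : CoupSpace n d) :
    fderiv ℝ (taylorRemainder K F) z e =
      fderiv ℝ F z e - ∑ k ∈ Finset.range K, fderiv ℝ (taylorTerm k F) z e := by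
  have h1 : ∀ k ∈ Finset.range K, DifferentiableAt ℝ (taylorTerm k F) z := fun k _ =>
    (contDiff_taylorTerm k hF).differentiable (by simp) z
  change fderiv ℝ (fun z => F z - ∑ k ∈ Finset.range K, taylorTerm k F z) z e = _
  rw [fderiv_fun_sub (hF.differentiable (by simp) z) (DifferentiableAt.fun_sum h1),
    fderiv_fun_sum h1]
  simp

theorem fderiv_taylorRemainder_slow (K : ℕ) {F : CoupSpace n d → ℝ}
    (hF : ContDiff ℝ ((⊤ : ℕ∞) : WithTop ℕ∞) F) (z : CoupSpace n d) {e : CoupSpace n d}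
    (he : e.2.2 = 0) : fderiv ℝ (taylorRemainder K F) z e =
      taylorRemainder K (fun y => fderiv ℝ F y e) z := by
  rw [fderiv_taylorRemainder K hF]
  simp only [fderiv_taylorTerm_slow _ hF _ he]; rfl

theorem fderiv_taylorRemainder_fast (K : ℕ) {F : CoupSpace n d → ℝ}
    (hF : ContDiff ℝ ((⊤ : ℕ∞) : WithTop ℕ∞) F) (z : CoupSpace n d) (j : Fin n) :
    fderiv ℝ (taylorRemainder (K + 1) F) z (fastDir j) =
      taylorRemainder K (fun y => fderiv ℝ F y (fastDir j)) z := by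
  rw [fderiv_taylorRemainder _ hF, Finset.sum_range_succ', fderiv_taylorTerm_fast_zero hF, add_zero]
  simp only [fderiv_taylorTerm_fast_succ _ hF]; rfl

theorem taylorRemainder_succ_zero (K : ℕ) (F : CoupSpace n d → ℝ) (z : CoupSpace n d)
    (hz : z.2.2 = 0) : taylorRemainder (K + 1) F z = 0 := by
  have h1 : ∀ k, taylorTerm (k + 1) F z = 0 := fun k => by simp [taylorTerm, hz]
  have h2 : taylorTerm 0 F z = F z := by
    rw [taylorTerm, ← hz]
  rw [taylorRemainder, Finset.sum_range_succ']
  simp [h1, h2]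

theorem sum_smul_fastDir (q : EuclideanSpace ℝ (Fin n)) :
    ∑ j, q j • (fastDir j : CoupSpace n d) = (0, 0, q) := by
  have h1 : ∑ j, (q j • (fastDir j : CoupSpace n d)).2.2 = q := by
    ext i
    simp [fastDir, Pi.single_apply]
  refine Prod.ext ?_ (Prod.ext ?_ ?_)
  · rw [Prod.fst_sum]; simp [fastDir]
  · rw [Prod.snd_sum, Prod.fst_sum]; simp [fastDir]
  · rw [Prod.snd_sum, Prod.snd_sum]; exact h1

/-- Induction on the order: along the segment from `(P, Q, 0)` the derivative of the remainder is a
combination of lower-order remainders of `∂_j F`, and the remainder vanishes at the starting point.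
The set `s` must contain these segments. -/
theorem exists_taylorRemainder_le (K : ℕ) {s : Set (CoupSpace n d)}
    (hs : ∀ z ∈ s, ∀ t ∈ Set.Icc (0 : ℝ) 1, (z.1, z.2.1, t • z.2.2) ∈ s) {F : CoupSpace n d → ℝ}
    (hF : IsBoundedSmooth s F) :
    ∃ C, 0 ≤ C ∧ ∀ z ∈ s, |taylorRemainder K F z| ≤ C * ‖z.2.2‖ ^ K := by
  induction K generalizing F with
  | zero =>
    obtain ⟨C, hC⟩ := hF.exists_abs_le
    refine ⟨max C 0, le_max_right _ _, fun z hz => ?_⟩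
    simpa [taylorRemainder] using Or.inl (hC z hz)
  | succ K ih =>
    choose C hC0 hC using fun j => ih (hF.fderiv_apply (fastDir j))
    refine ⟨∑ j, C j, Finset.sum_nonneg fun j _ => hC0 j, fun z hz => ?_⟩
    let g : ℝ → ℝ := fun t => taylorRemainder (K + 1) F (z.1, z.2.1, t • z.2.2)
    have hg : ∀ t, HasDerivAt g (∑ j, z.2.2 j *
        taylorRemainder K (fun y => fderiv ℝ F y (fastDir j)) (z.1, z.2.1, t • z.2.2)) t := by
      intro t
      have h1 : HasDerivAt (fun t : ℝ => ((z.1, z.2.1, t • z.2.2) : CoupSpace n d)) (0, 0, z.2.2) t := by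
        refine (hasDerivAt_const t z.1).prodMk ((hasDerivAt_const t z.2.1).prodMk ?_)
        simpa using (hasDerivAt_id t).smul_const z.2.2
      have h2 := ((contDiff_taylorRemainder (K + 1) hF.contDiff).differentiable (by simp)
        (z.1, z.2.1, t • z.2.2)).hasFDerivAt.comp_hasDerivAt t h1
      refine h2.congr_deriv ?_
      rw [← sum_smul_fastDir, map_sum]
      simp only [map_smul, smul_eq_mul, fderiv_taylorRemainder_fast _ hF.contDiff]
    have hb : ∀ t ∈ Set.Ico (0 : ℝ) 1, ‖∑ j, z.2.2 j * taylorRemainder K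
        (fun y => fderiv ℝ F y (fastDir j)) (z.1, z.2.1, t • z.2.2)‖ ≤
        (∑ j, C j) * ‖z.2.2‖ ^ (K + 1) := by
      intro t ht
      refine (norm_sum_le _ _).trans ?_
      rw [Finset.sum_mul]
      refine Finset.sum_le_sum fun j _ => ?_
      rw [norm_mul, pow_succ, ← mul_assoc, mul_comm]
      refine mul_le_mul ?_ (PiLp.norm_apply_le _ _) (norm_nonneg _)
        (mul_nonneg (hC0 j) (by positivity))
      refine (hC j _ (hs z hz t ⟨ht.1, ht.2.le⟩)).trans (mul_le_mul_of_nonneg_left ?_ (hC0 j))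
      refine pow_le_pow_left₀ (norm_nonneg _) ?_ _
      rw [norm_smul, Real.norm_eq_abs, abs_of_nonneg ht.1]
      exact mul_le_of_le_one_left (norm_nonneg _) ht.2.le
    have := norm_image_sub_le_of_norm_deriv_le_segment_01' (f := g)
      (fun t _ => (hg t).hasDerivWithinAt) hb
    have h0 : g 0 = 0 := taylorRemainder_succ_zero K F _ (by simp)
    have h1 : g 1 = taylorRemainder (K + 1) F z := by simp [g]
    rwa [h0, h1, sub_zero] at this

/-- The family, constant in the parameter, of the Taylor term of degree `k`. -/
def taylorFam (Λ : Type*) (k : ℕ) (F : CoupSpace n d → ℝ)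
    (hF : ContDiff ℝ ((⊤ : ℕ∞) : WithTop ℕ∞) F) : SmoothFamily Λ (PhaseSpace n d) :=
  ⟨fun _ y => (taylorTerm k F y.1 : ℂ), fun _ => Complex.ofRealCLM.contDiff.comp
    ((contDiff_taylorTerm k hF).comp contDiff_fst)⟩

/-- Each step of the recursion multiplies by one coordinate `u j`, so the Taylor order bounds the
degree in the fast variables. -/
theorem taylorFam_mem_monomialSpan {Λ : Type*} {s : Set (CoupSpace n d)} (k : ℕ)
    {F : CoupSpace n d → ℝ} (hF : IsBoundedSmooth s F) :
    taylorFam Λ k F hF.contDiff ∈ monomialSpan Λ s k := by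
  induction k generalizing F with
  | zero =>
    have : taylorFam Λ 0 F hF.contDiff = baseFam (fun _ => 1) F hF.contDiff := by
      ext θ y
      change ((F (y.1.1, y.1.2.1, 0) : ℝ) : ℂ) = 1 * ((F (y.1.1, y.1.2.1, 0) : ℝ) : ℂ)
      rw [one_mul]
    rw [this]
    exact (IsMonomial.base _ ⟨1, fun _ => by simp⟩ F hF).mem_span le_rfl
  | succ k ih =>
    have : taylorFam Λ (k + 1) F hF.contDiff = ((k : ℂ) + 1)⁻¹ • ∑ j, uFam j *
        taylorFam Λ k (fun y => fderiv ℝ F y (fastDir j)) (hF.fderiv_apply _).contDiff := by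
      ext θ y
      have h : SmoothFamily.eval Λ (PhaseSpace n d) θ y (∑ j, uFam j *
        taylorFam Λ k (fun y => fderiv ℝ F y (fastDir j)) (hF.fderiv_apply _).contDiff) =
        ∑ j, (y.1.2.2 j : ℂ) * (taylorTerm k (fun y => fderiv ℝ F y (fastDir j)) y.1 : ℂ) := by
        rw [map_sum]; rfl
      change ((((k : ℝ) + 1)⁻¹ * ∑ j, y.1.2.2 j *
        taylorTerm k (fun y => fderiv ℝ F y (fastDir j)) y.1 : ℝ) : ℂ) = ((k : ℂ) + 1)⁻¹ *
          SmoothFamily.eval Λ (PhaseSpace n d) θ y (∑ j, uFam j *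
        taylorFam Λ k (fun y => fderiv ℝ F y (fastDir j)) (hF.fderiv_apply _).contDiff)
      rw [h]; push_cast; rfl
    rw [this]
    exact Submodule.smul_mem _ _ (Submodule.sum_mem _ fun j _ => uFam_mul_mem (ih (hF.fderiv_apply _)) j)

end Taylor
end
end FastSlow

namespace FastSlow

noncomputable section

open Polynomial

/-! ### Evaluating formal polynomials -/

section Evaluation

variable {Λ Y : Type*} [NormedAddCommGroup Y] [NormedSpace ℝ Y]

/-- Evaluation of a formal polynomial at a parameter, a value of the small parameter, and a point. -/
def polyEval (θ : Λ) (ε : ℝ) (y : Y) : (SmoothFamily Λ Y)[X] →+* ℂ :=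
  eval₂RingHom (SmoothFamily.eval Λ Y θ y) (ε : ℂ)

theorem polyEval_C (θ : Λ) (ε : ℝ) (y : Y) (f : SmoothFamily Λ Y) :
    polyEval θ ε y (C f) = f.1 θ y := by
  simp [polyEval]; rfl

theorem polyEval_X (θ : Λ) (ε : ℝ) (y : Y) :
    polyEval θ ε y (X : (SmoothFamily Λ Y)[X]) = ε := by
  simp [polyEval]

theorem polyEval_monomial (θ : Λ) (ε : ℝ) (y : Y) (k : ℕ) (f : SmoothFamily Λ Y) :
    polyEval θ ε y (monomial k f) = f.1 θ y * (ε : ℂ) ^ k := by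
  simp [polyEval, eval₂_monomial]; left; rfl

theorem differentiable_polyEval (θ : Λ) (ε : ℝ) (F : (SmoothFamily Λ Y)[X]) :
    Differentiable ℝ fun y => polyEval θ ε y F := by
  induction F using Polynomial.induction_on' with
  | add F G hF hG => simp only [map_add]; exact hF.add hG
  | monomial k f =>
    simp only [polyEval_monomial]
    exact (smoothFamily_differentiable f θ).mul_const _

theorem fderiv_polyEval (θ : Λ) (ε : ℝ) (F : (SmoothFamily Λ Y)[X]) (y e : Y) :
    fderiv ℝ (fun y => polyEval θ ε y F) y e = polyEval θ ε y (coeffDerivation (dirDeriv e) F) := by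
  induction F using Polynomial.induction_on' with
  | add F G hF hG =>
    simp only [map_add]
    rw [fderiv_fun_add (differentiable_polyEval θ ε F y) (differentiable_polyEval θ ε G y),
      add_apply, hF, hG]
  | monomial k f =>
    have : coeffDerivation (dirDeriv e) (monomial k f) = monomial k (dirDeriv e f) := by
      ext i : 1
      rw [coeff_coeffDerivation, coeff_monomial, coeff_monomial]
      split_ifs
      · rfl
      · exact map_zero _
    rw [this]
    simp only [polyEval_monomial]
    rw [fderiv_mul_const (smoothFamily_differentiable f θ y), dirDeriv_apply, smul_apply, smul_eq_mul,
      mul_comm]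

end Evaluation

/-! ### From the formal bracket to the true vector field -/

section ApproximateIntegral

variable {n d M : ℕ} {β γ : ℝ} {s : Set (CoupSpace n d)}

/-- Divisibility by `X ^ k` becomes smallness `ε ^ k`, with a constant uniform in the frequencies.
-/
theorem exists_norm_polyEval_le {F : (ObsFamily n d M β γ)[X]} (hF : F ∈ weightedPoly n d M β γ s)
    {k : ℕ} (hk : X ^ k ∣ F) (r : ℝ) :
    ∃ C : ℝ, 0 ≤ C ∧ ∀ (θ : ResonantApprox n M β γ) (ε : ℝ) (y : PhaseSpace n d), 0 < ε → ε ≤ 1 →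
      (y.1.1, y.1.2.1, 0) ∈ s → (∀ j, |y.1.2.2 j| ≤ r) → (∀ j, |y.2 j| ≤ r) →
        ‖polyEval θ ε y F‖ ≤ C * ε ^ k := by
  choose C hC using fun i => exists_norm_le_of_mem_monomialSpan (hF i) r
  refine ⟨∑ i ∈ Finset.range (F.natDegree + 1), max (C i) 0,
    Finset.sum_nonneg fun i _ => le_max_right _ _, fun θ ε y h0 h1 hy hu hv => ?_⟩
  rw [polyEval, coe_eval₂RingHom, eval₂_eq_sum_range, Finset.sum_mul]
  refine (norm_sum_le _ _).trans (Finset.sum_le_sum fun i _ => ?_)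
  rcases lt_or_ge i k with hi | hi
  · rw [X_pow_dvd_iff.1 hk i hi, map_zero, zero_mul, norm_zero]
    exact mul_nonneg (le_max_right _ _) (by positivity)
  · rw [norm_mul, norm_pow, Complex.norm_real, Real.norm_eq_abs, abs_of_pos h0]
    exact mul_le_mul ((hC i θ y hy hu hv).trans (le_max_left _ _))
      (pow_le_pow_of_le_one h0.le h1 hi) (by positivity) (le_max_right _ _)

/-- The coordinate direction of `P i` in the space of arguments of the coupling. -/
def slowDirP (i : Fin d) : CoupSpace n d := (EuclideanSpace.single i 1, 0, 0)

/-- The coordinate direction of `Q i` in the space of arguments of the coupling. -/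
def slowDirQ (i : Fin d) : CoupSpace n d := (0, EuclideanSpace.single i 1, 0)

/-- The vector field of Hamilton's equations of `h_Ω + F` at `((P, Q, q), p)`. -/
def hamField (Ω : Fin n → ℝ) (F : CoupSpace n d → ℝ) (y : PhaseSpace n d) : PhaseSpace n d :=
  ((WithLp.toLp 2 fun i => -fderiv ℝ F y.1 (slowDirQ i),
    WithLp.toLp 2 fun i => fderiv ℝ F y.1 (slowDirP i), y.2),
    WithLp.toLp 2 fun j => -(Ω j ^ 2 * y.1.2.2 j + fderiv ℝ F y.1 (fastDir j)))

/-- The scaling `u = q / ε`, `v j = p j / ω j` of phase space. -/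
def scaling (n d : ℕ) (ε : ℝ) (ω : Fin n → ℝ) : PhaseSpace n d →L[ℝ] PhaseSpace n d :=
  (((ContinuousLinearMap.fst ℝ _ _) ∘L ContinuousLinearMap.fst ℝ _ _).prod
    (((ContinuousLinearMap.fst ℝ _ _) ∘L (ContinuousLinearMap.snd ℝ _ _) ∘L
        ContinuousLinearMap.fst ℝ _ _).prod
      (ε⁻¹ • ((ContinuousLinearMap.snd ℝ _ _) ∘L (ContinuousLinearMap.snd ℝ _ _) ∘L
        ContinuousLinearMap.fst ℝ _ _)))).prod
    (((EuclideanSpace.equiv (Fin n) ℝ).symm : (Fin n → ℝ) →L[ℝ] EuclideanSpace ℝ (Fin n)) ∘L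
      (ContinuousLinearMap.pi fun j => (ω j)⁻¹ • (EuclideanSpace.proj j)) ∘L
        ContinuousLinearMap.snd ℝ _ _)

theorem scaling_apply (ε : ℝ) (ω : Fin n → ℝ) (y : PhaseSpace n d) : scaling n d ε ω y =
    ((y.1.1, y.1.2.1, ε⁻¹ • y.1.2.2), WithLp.toLp 2 fun j => (ω j)⁻¹ * y.2 j) := rfl

theorem phaseSpace_eq_sum (y : PhaseSpace n d) :
    y = ∑ i, y.1.1 i • pDir i + ∑ i, y.1.2.1 i • qDir i + ∑ j, y.1.2.2 j • uDir j +
      ∑ j, y.2 j • vDir j := by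
  have h : ∀ (m : ℕ) (x : EuclideanSpace ℝ (Fin m)), ∑ i, x i • EuclideanSpace.single i (1 : ℝ) = x := by
    intro m x; ext i; simp [Pi.single_apply]
  refine Prod.ext (Prod.ext ?_ (Prod.ext ?_ ?_)) ?_
  · simp [Prod.fst_sum, pDir, qDir, uDir, vDir]; rw [h]
  · simp [Prod.fst_sum, Prod.snd_sum, pDir, qDir, uDir, vDir]; rw [h]
  · simp [Prod.fst_sum, Prod.snd_sum, pDir, qDir, uDir, vDir]; rw [h]
  · simp [Prod.snd_sum, pDir, qDir, uDir, vDir]; rw [h]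

/-- The formal Taylor expansion of the coupling in the small parameter. -/
def taylorPoly (n d M : ℕ) (β γ : ℝ) (F : CoupSpace n d → ℝ)
    (hF : ContDiff ℝ ((⊤ : ℕ∞) : WithTop ℕ∞) F) : (ObsFamily n d M β γ)[X] :=
  ∑ k ∈ Finset.range M, monomial k (taylorFam _ k F hF)

theorem coeff_taylorPoly (F : CoupSpace n d → ℝ) (hF : ContDiff ℝ ((⊤ : ℕ∞) : WithTop ℕ∞) F) (k : ℕ) :
    (taylorPoly n d M β γ F hF).coeff k = if k < M then taylorFam _ k F hF else 0 := by
  rw [taylorPoly, finsetSum_coeff]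
  simp only [coeff_monomial, Finset.sum_ite_eq', Finset.mem_range]

theorem taylorPoly_mem_weightedPoly {F : CoupSpace n d → ℝ} (hF : IsBoundedSmooth s F) :
    taylorPoly n d M β γ F hF.contDiff ∈ weightedPoly n d M β γ s := by
  intro k
  rw [coeff_taylorPoly]
  split_ifs
  · exact taylorFam_mem_monomialSpan k hF
  · exact Submodule.zero_mem _

theorem polyEval_taylorPoly (θ : ResonantApprox n M β γ) (ε : ℝ) (y : PhaseSpace n d)
    {F : CoupSpace n d → ℝ} (hF : ContDiff ℝ ((⊤ : ℕ∞) : WithTop ℕ∞) F) :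
    polyEval θ ε y (taylorPoly n d M β γ F hF) =
      ((F (y.1.1, y.1.2.1, ε • y.1.2.2) - taylorRemainder M F (y.1.1, y.1.2.1, ε • y.1.2.2) : ℝ) : ℂ) := by
  rw [taylorPoly, map_sum, taylorRemainder, sub_sub_cancel]
  push_cast
  refine Finset.sum_congr rfl fun k _ => ?_
  rw [polyEval_monomial, taylorTerm_smul k F y.1 ε]
  change (taylorTerm k F y.1 : ℂ) * _ = _
  push_cast; ring

theorem polyEval_coeffDerivation_taylorPoly (θ : ResonantApprox n M β γ) (ε : ℝ) (y e : PhaseSpace n d)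
    {F : CoupSpace n d → ℝ} (hF : ContDiff ℝ ((⊤ : ℕ∞) : WithTop ℕ∞) F) :
    polyEval θ ε y (coeffDerivation (dirDeriv e) (taylorPoly n d M β γ F hF)) =
      ((fderiv ℝ F (y.1.1, y.1.2.1, ε • y.1.2.2) (e.1.1, e.1.2.1, ε • e.1.2.2) -
        fderiv ℝ (taylorRemainder M F) (y.1.1, y.1.2.1, ε • y.1.2.2) (e.1.1, e.1.2.1, ε • e.1.2.2) : ℝ) :
          ℂ) := by
  rw [← fderiv_polyEval]
  simp only [polyEval_taylorPoly]
  let l : PhaseSpace n d →L[ℝ] CoupSpace n d :=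
    ((ContinuousLinearMap.fst ℝ _ _) ∘L ContinuousLinearMap.fst ℝ _ _).prod
      (((ContinuousLinearMap.fst ℝ _ _) ∘L (ContinuousLinearMap.snd ℝ _ _) ∘L
        ContinuousLinearMap.fst ℝ _ _).prod (ε • ((ContinuousLinearMap.snd ℝ _ _) ∘L
          (ContinuousLinearMap.snd ℝ _ _) ∘L ContinuousLinearMap.fst ℝ _ _)))
  have h1 : HasFDerivAt F (fderiv ℝ F (l y)) (l y) := (hF.differentiable (by simp) (l y)).hasFDerivAt
  have h2 : HasFDerivAt (taylorRemainder M F) (fderiv ℝ (taylorRemainder M F) (l y)) (l y) :=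
    ((contDiff_taylorRemainder M hF).differentiable (by simp) (l y)).hasFDerivAt
  have h3 := (Complex.ofRealCLM.hasFDerivAt.comp y ((h1.sub h2).comp y l.hasFDerivAt)).fderiv
  change fderiv ℝ (Complex.ofRealCLM ∘ (F - taylorRemainder M F) ∘ l) y e = _
  rw [h3]; rfl

/-- At the scaled point `ε u = q`, so derivatives of the Taylor polynomial are those of `F` minus
those of its remainder. A derivative in `u` carries a factor `ε`, since the coupling sees only `ε
u`. -/
theorem polyEval_formalBracket_scaling (θ : ResonantApprox n M β γ) {ε : ℝ} (hε : 0 < ε)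
    (y : PhaseSpace n d) {F : CoupSpace n d → ℝ}
    (hF : ContDiff ℝ ((⊤ : ℕ∞) : WithTop ℕ∞) F) (J : (ObsFamily n d M β γ)[X]) :
    polyEval θ ε (scaling n d ε θ.ω y) (formalBracket
        (C (quadFam ResonantApprox.ω) + taylorPoly n d M β γ F hF) J) =
      ∑ j, ((θ.ω j)⁻¹ : ℝ) * ((((θ.ω j * θ.ω j * (ε⁻¹ * y.1.2.2 j) : ℝ) : ℂ) + ε *
          ((fderiv ℝ F y.1 (fastDir j) - fderiv ℝ (taylorRemainder M F) y.1 (fastDir j) : ℝ) : ℂ)) *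
          polyEval θ ε (scaling n d ε θ.ω y) (coeffDerivation (dirDeriv (vDir j)) J) -
        ((θ.ω j * θ.ω j * ((θ.ω j)⁻¹ * y.2 j) : ℝ) : ℂ) *
          polyEval θ ε (scaling n d ε θ.ω y) (coeffDerivation (dirDeriv (uDir j)) J)) +
      ∑ i, ε * (((fderiv ℝ F y.1 (slowDirQ i) -
          fderiv ℝ (taylorRemainder M F) y.1 (slowDirQ i) : ℝ) : ℂ) *
          polyEval θ ε (scaling n d ε θ.ω y) (coeffDerivation (dirDeriv (pDir i)) J) -
        ((fderiv ℝ F y.1 (slowDirP i) - fderiv ℝ (taylorRemainder M F) y.1 (slowDirP i) : ℝ) : ℂ) *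
          polyEval θ ε (scaling n d ε θ.ω y) (coeffDerivation (dirDeriv (qDir i)) J)) := by
  set y' := scaling n d ε θ.ω y with hy'
  have hz : (y'.1.1, y'.1.2.1, ε • y'.1.2.2) = y.1 := by
    rw [hy', scaling_apply]
    refine Prod.ext rfl (Prod.ext rfl ?_)
    exact smul_inv_smul₀ hε.ne' _
  have hT : ∀ e : PhaseSpace n d,
      polyEval θ ε y' (coeffDerivation (dirDeriv e) (taylorPoly n d M β γ F hF)) =
      ((fderiv ℝ F y.1 (e.1.1, e.1.2.1, ε • e.1.2.2) -
        fderiv ℝ (taylorRemainder M F) y.1 (e.1.1, e.1.2.1, ε • e.1.2.2) : ℝ) : ℂ) := by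
    intro e
    rw [polyEval_coeffDerivation_taylorPoly θ ε y' e hF, hz]
  have hωpos : ∀ j, θ.ω j ≠ 0 := fun j => (zero_lt_one.trans_le (θ.one_le j)).ne'
  have hTu : ∀ j, polyEval θ ε y' (coeffDerivation (dirDeriv (uDir j)) (taylorPoly n d M β γ F hF)) =
      ε * ((fderiv ℝ F y.1 (fastDir j) - fderiv ℝ (taylorRemainder M F) y.1 (fastDir j) : ℝ) : ℂ) := by
    intro j
    have : (((uDir j : PhaseSpace n d).1.1, (uDir j : PhaseSpace n d).1.2.1,
        ε • (uDir j : PhaseSpace n d).1.2.2) : CoupSpace n d) = ε • fastDir j := by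
      simp [uDir, fastDir]
    rw [hT, this, map_smul, map_smul, ← smul_sub, smul_eq_mul]
    push_cast; ring
  have hTv : ∀ j, polyEval θ ε y' (coeffDerivation (dirDeriv (vDir j)) (taylorPoly n d M β γ F hF)) =
      0 := by
    intro j
    have : (((vDir j : PhaseSpace n d).1.1, (vDir j : PhaseSpace n d).1.2.1,
        ε • (vDir j : PhaseSpace n d).1.2.2) : CoupSpace n d) = 0 := by
      simp [vDir]
    rw [hT, this, map_zero, map_zero]; simp
  have hTp : ∀ i, polyEval θ ε y' (coeffDerivation (dirDeriv (pDir i)) (taylorPoly n d M β γ F hF)) =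
      ((fderiv ℝ F y.1 (slowDirP i) - fderiv ℝ (taylorRemainder M F) y.1 (slowDirP i) : ℝ) : ℂ) := by
    intro i
    have : (((pDir i : PhaseSpace n d).1.1, (pDir i : PhaseSpace n d).1.2.1,
        ε • (pDir i : PhaseSpace n d).1.2.2) : CoupSpace n d) = slowDirP i := by
      simp [pDir, slowDirP]
    rw [hT, this]
  have hTq : ∀ i, polyEval θ ε y' (coeffDerivation (dirDeriv (qDir i)) (taylorPoly n d M β γ F hF)) =
      ((fderiv ℝ F y.1 (slowDirQ i) - fderiv ℝ (taylorRemainder M F) y.1 (slowDirQ i) : ℝ) : ℂ) := by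
    intro i
    have : (((qDir i : PhaseSpace n d).1.1, (qDir i : PhaseSpace n d).1.2.1,
        ε • (qDir i : PhaseSpace n d).1.2.2) : CoupSpace n d) = slowDirQ i := by
      simp [qDir, slowDirQ]
    rw [hT, this]
  have hhu : ∀ j, polyEval θ ε y' (coeffDerivation (dirDeriv (uDir j))
      (C (quadFam ResonantApprox.ω) : (ObsFamily n d M β γ)[X])) =
      ((θ.ω j * θ.ω j * (ε⁻¹ * y.1.2.2 j) : ℝ) : ℂ) := by
    intro j
    rw [coeffDerivation_C, polyEval_C, dirDeriv_uDir_quadFam]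
    change ((θ.ω j * θ.ω j : ℝ) : ℂ) * ((ε⁻¹ * y.1.2.2 j : ℝ) : ℂ) = _
    rw [← Complex.ofReal_mul]
  have hhv : ∀ j, polyEval θ ε y' (coeffDerivation (dirDeriv (vDir j))
      (C (quadFam ResonantApprox.ω) : (ObsFamily n d M β γ)[X])) =
      ((θ.ω j * θ.ω j * ((θ.ω j)⁻¹ * y.2 j) : ℝ) : ℂ) := by
    intro j
    rw [coeffDerivation_C, polyEval_C, dirDeriv_vDir_quadFam]
    change ((θ.ω j * θ.ω j : ℝ) : ℂ) * (((θ.ω j)⁻¹ * y.2 j : ℝ) : ℂ) = _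
    rw [← Complex.ofReal_mul]
  have hhs : ∀ e : PhaseSpace n d, e.1.2.2 = 0 → e.2 = 0 → polyEval θ ε y' (coeffDerivation (dirDeriv e)
      (C (quadFam ResonantApprox.ω) : (ObsFamily n d M β γ)[X])) = 0 := by
    intro e h1 h2
    rw [coeffDerivation_C, dirDeriv_slow_quadFam _ _ h1 h2, C_0, map_zero]
  rw [formalBracket_eq, map_add, map_sum, map_sum]
  refine congrArg₂ (· + ·) (Finset.sum_congr rfl fun j _ => ?_) (Finset.sum_congr rfl fun i _ => ?_)
  · rw [map_mul, polyEval_C, map_sub, map_mul, map_mul, map_add, map_add, map_add, map_add, hhu, hhv,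
      hTu, hTv, add_zero]
    rfl
  · rw [map_mul, polyEval_X, map_sub, map_mul, map_mul, map_add, map_add, map_add, map_add,
      hhs _ rfl rfl, hhs _ rfl rfl, hTq, hTp, zero_add, zero_add]

/-- The derivative of an observable along the scaled Hamiltonian field, in terms of the formal
bracket and of the Taylor remainder of the coupling. -/
theorem polyEval_hamField (θ : ResonantApprox n M β γ) {ε : ℝ} (hε : 0 < ε) {Ω : Fin n → ℝ}
    (hΩ : ∀ j, θ.ω j = ε * Ω j) (y : PhaseSpace n d) {F : CoupSpace n d → ℝ}
    (hF : ContDiff ℝ ((⊤ : ℕ∞) : WithTop ℕ∞) F) (J : (ObsFamily n d M β γ)[X]) :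
    fderiv ℝ (fun y => polyEval θ ε y J) (scaling n d ε θ.ω y) (scaling n d ε θ.ω (hamField Ω F y)) =
      -((ε : ℂ)⁻¹ * polyEval θ ε (scaling n d ε θ.ω y) (formalBracket
        (C (quadFam ResonantApprox.ω) + taylorPoly n d M β γ F hF) J)) +
      (∑ i, ((fderiv ℝ (taylorRemainder M F) y.1 (slowDirP i) : ℝ) *
          polyEval θ ε (scaling n d ε θ.ω y) (coeffDerivation (dirDeriv (qDir i)) J) -
        (fderiv ℝ (taylorRemainder M F) y.1 (slowDirQ i) : ℝ) *
          polyEval θ ε (scaling n d ε θ.ω y) (coeffDerivation (dirDeriv (pDir i)) J)) -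
      ∑ j, ((θ.ω j)⁻¹ * fderiv ℝ (taylorRemainder M F) y.1 (fastDir j) : ℝ) *
        polyEval θ ε (scaling n d ε θ.ω y) (coeffDerivation (dirDeriv (vDir j)) J)) := by
  have hbr := polyEval_formalBracket_scaling θ hε y hF J
  set y' := scaling n d ε θ.ω y with hy'
  have hωpos : ∀ j, θ.ω j ≠ 0 := fun j => (zero_lt_one.trans_le (θ.one_le j)).ne'
  have hεc : (ε : ℂ) ≠ 0 := by exact_mod_cast hε.ne'
  have hexp : fderiv ℝ (fun y => polyEval θ ε y J) y' (scaling n d ε θ.ω (hamField Ω F y)) =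
      ∑ i, (((-fderiv ℝ F y.1 (slowDirQ i) : ℝ) : ℂ) *
          polyEval θ ε y' (coeffDerivation (dirDeriv (pDir i)) J) +
        ((fderiv ℝ F y.1 (slowDirP i) : ℝ) : ℂ) *
          polyEval θ ε y' (coeffDerivation (dirDeriv (qDir i)) J)) +
      ∑ j, (((ε⁻¹ * y.2 j : ℝ) : ℂ) * polyEval θ ε y' (coeffDerivation (dirDeriv (uDir j)) J) +
        (((θ.ω j)⁻¹ * -(Ω j ^ 2 * y.1.2.2 j + fderiv ℝ F y.1 (fastDir j)) : ℝ) : ℂ) *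
          polyEval θ ε y' (coeffDerivation (dirDeriv (vDir j)) J)) := by
    conv_lhs => rw [phaseSpace_eq_sum (scaling n d ε θ.ω (hamField Ω F y))]
    simp only [map_add, map_sum, map_smul, fderiv_polyEval]
    rw [scaling_apply]
    simp only [hamField, PiLp.smul_apply, smul_eq_mul, Complex.real_smul]
    rw [Finset.sum_add_distrib, Finset.sum_add_distrib, ← add_assoc]
  -- With `ω = εΩ` the scaled field and `-ε⁻¹` times the bracket agree, except that the bracket sees
  -- the truncated coupling; the discrepancy is the remainder term.
  have hfast : ∀ j, ((ε⁻¹ * y.2 j : ℝ) : ℂ) * polyEval θ ε y' (coeffDerivation (dirDeriv (uDir j)) J) +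
        (((θ.ω j)⁻¹ * -(Ω j ^ 2 * y.1.2.2 j + fderiv ℝ F y.1 (fastDir j)) : ℝ) : ℂ) *
          polyEval θ ε y' (coeffDerivation (dirDeriv (vDir j)) J) =
      -((ε : ℂ)⁻¹ * (((θ.ω j)⁻¹ : ℝ) * ((((θ.ω j * θ.ω j * (ε⁻¹ * y.1.2.2 j) : ℝ) : ℂ) + ε *
          ((fderiv ℝ F y.1 (fastDir j) - fderiv ℝ (taylorRemainder M F) y.1 (fastDir j) : ℝ) : ℂ)) *
          polyEval θ ε y' (coeffDerivation (dirDeriv (vDir j)) J) -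
        ((θ.ω j * θ.ω j * ((θ.ω j)⁻¹ * y.2 j) : ℝ) : ℂ) *
          polyEval θ ε y' (coeffDerivation (dirDeriv (uDir j)) J)))) -
      ((θ.ω j)⁻¹ * fderiv ℝ (taylorRemainder M F) y.1 (fastDir j) : ℝ) *
        polyEval θ ε y' (coeffDerivation (dirDeriv (vDir j)) J) := by
    intro j
    have h1 : (θ.ω j : ℂ) ≠ 0 := by exact_mod_cast hωpos j
    have h2 : (θ.ω j : ℂ) = ε * Ω j := by rw [hΩ]; push_cast; rfl
    have h3 : (Ω j : ℂ) ≠ 0 := fun h => h1 (by rw [h2, h, mul_zero])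
    push_cast
    rw [h2]
    field_simp
    ring
  have hslow : ∀ i, ((-fderiv ℝ F y.1 (slowDirQ i) : ℝ) : ℂ) *
          polyEval θ ε y' (coeffDerivation (dirDeriv (pDir i)) J) +
        ((fderiv ℝ F y.1 (slowDirP i) : ℝ) : ℂ) *
          polyEval θ ε y' (coeffDerivation (dirDeriv (qDir i)) J) =
      -((ε : ℂ)⁻¹ * (ε * (((fderiv ℝ F y.1 (slowDirQ i) -
          fderiv ℝ (taylorRemainder M F) y.1 (slowDirQ i) : ℝ) : ℂ) *
          polyEval θ ε y' (coeffDerivation (dirDeriv (pDir i)) J) -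
        ((fderiv ℝ F y.1 (slowDirP i) - fderiv ℝ (taylorRemainder M F) y.1 (slowDirP i) : ℝ) : ℂ) *
          polyEval θ ε y' (coeffDerivation (dirDeriv (qDir i)) J)))) +
      ((fderiv ℝ (taylorRemainder M F) y.1 (slowDirP i) : ℝ) *
          polyEval θ ε y' (coeffDerivation (dirDeriv (qDir i)) J) -
        (fderiv ℝ (taylorRemainder M F) y.1 (slowDirQ i) : ℝ) *
          polyEval θ ε y' (coeffDerivation (dirDeriv (pDir i)) J)) := by
    intro i
    rw [inv_mul_cancel_left₀ hεc]
    push_cast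
    ring
  have hfast' := Finset.sum_congr (rfl : (Finset.univ : Finset (Fin n)) = _) fun j _ => hfast j
  have hslow' := Finset.sum_congr (rfl : (Finset.univ : Finset (Fin d)) = _) fun i _ => hslow i
  rw [Finset.sum_sub_distrib, Finset.sum_neg_distrib, ← Finset.mul_sum] at hfast'
  rw [Finset.sum_add_distrib (f := fun i => -((ε : ℂ)⁻¹ * _)), Finset.sum_neg_distrib,
    ← Finset.mul_sum] at hslow'
  rw [hexp, hbr, hslow', hfast']
  ring

end ApproximateIntegral
end
end FastSlow

namespace FastSlow

noncomputable section

open Polynomial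

/-! ### Construction and estimate of the approximate integral -/

section ApproximateIntegral

variable {n d M : ℕ} {β γ : ℝ} {s : Set (CoupSpace n d)}

/-- Under the scaling, `ω_j ω'_j (u_j² + v_j²)` equals `(ω'_j/ω_j)(p_j² + Ω_j² q_j²)`. Only the
ratio of frequencies, which is close to 1, survives. -/
theorem polyEval_quadFam_scaling (θ : ResonantApprox n M β γ) {ε : ℝ} (hε : 0 < ε) {Ω : Fin n → ℝ}
    (hΩ : ∀ j, θ.ω j = ε * Ω j) (y : PhaseSpace n d) :
    polyEval θ ε (scaling n d ε θ.ω y) (C (quadFam ResonantApprox.ω')) =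
      ((∑ j, θ.ω' j / θ.ω j * ((y.2 j ^ 2 + Ω j ^ 2 * y.1.2.2 j ^ 2) / 2) : ℝ) : ℂ) := by
  have hωpos : ∀ j, θ.ω j ≠ 0 := fun j => (zero_lt_one.trans_le (θ.one_le j)).ne'
  rw [polyEval_C]
  change SmoothFamily.eval _ _ θ (scaling n d ε θ.ω y) (quadFam ResonantApprox.ω') = _
  rw [quadFam, map_sum, Complex.ofReal_sum]
  refine Finset.sum_congr rfl fun j _ => ?_
  change ((θ.ω j * θ.ω' j / 2 : ℝ) : ℂ) * (((ε⁻¹ * y.1.2.2 j : ℝ) : ℂ) * ((ε⁻¹ * y.1.2.2 j : ℝ) : ℂ) +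
    (((θ.ω j)⁻¹ * y.2 j : ℝ) : ℂ) * (((θ.ω j)⁻¹ * y.2 j : ℝ) : ℂ)) = _
  have h1 : θ.ω j * θ.ω' j / 2 * ((ε⁻¹ * y.1.2.2 j) * (ε⁻¹ * y.1.2.2 j) +
      ((θ.ω j)⁻¹ * y.2 j) * ((θ.ω j)⁻¹ * y.2 j)) =
      θ.ω' j / θ.ω j * ((y.2 j ^ 2 + Ω j ^ 2 * y.1.2.2 j ^ 2) / 2) := by
    have h2 : Ω j = ε⁻¹ * θ.ω j := by rw [hΩ, inv_mul_cancel_left₀ hε.ne']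
    rw [h2]
    have := hωpos j
    field_simp
    ring
  rw [← h1]
  push_cast
  ring

/-- For every vector of frequencies bounded below by `ε⁻¹` there is an observable that is close to
a quadratic form with nearly the coefficients of the fast energy, and whose derivative along the
Hamiltonian field is of order `ε ^ m`. -/
theorem exists_approximate_integral
    (hs : ∀ z ∈ s, ∀ t ∈ Set.Icc (0 : ℝ) 1, (z.1, z.2.1, t • z.2.2) ∈ s) {F : CoupSpace n d → ℝ}
    (hF : IsBoundedSmooth s F) (m : ℕ) (hβ : 0 < β) (hβ1 : β ≤ 1) {r : ℝ} (hr : 0 ≤ r) :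
    ∃ K : ℝ, 0 ≤ K ∧ ∀ (Ω : Fin n → ℝ) (ε : ℝ), 0 < ε → ε ≤ 1 → (∀ j, 1 ≤ ε * Ω j) →
      ∃ ρ : Fin n → ℝ, (∀ j, |ρ j - 1| ≤ β) ∧ ∃ J : PhaseSpace n d → ℂ, Differentiable ℝ J ∧
        ∀ y : PhaseSpace n d, y.1 ∈ s → (∀ j, |y.2 j| ≤ r) → (∀ j, |Ω j * y.1.2.2 j| ≤ r) →
          ‖J y - ((∑ j, ρ j * ((y.2 j ^ 2 + Ω j ^ 2 * y.1.2.2 j ^ 2) / 2) : ℝ) : ℂ)‖ ≤ K * ε ∧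
          ‖fderiv ℝ J y (hamField Ω F y)‖ ≤ K * ε ^ m := by
  obtain ⟨γ, hγ, hres⟩ := exists_resonantApprox n (m + 1) hβ
  -- Order `m + 1` is needed because the true derivative is the formal bracket divided by `ε`.
  obtain ⟨j, hj, hj0, hW, hdvd⟩ := exists_formal_integral_remainder (M := m + 1) (n := n) (d := d)
    hγ hβ.le (Nat.le_add_left 1 m) (taylorPoly_mem_weightedPoly (M := m + 1) (β := β) (γ := γ) hF)
    (fun k hk => by rw [coeff_taylorPoly, if_neg (by omega)])
  obtain ⟨C₁, hC₁, hb₁⟩ := exists_norm_polyEval_le hj (k := 1) (by rw [pow_one, X_dvd_iff]; exact hj0) r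
  obtain ⟨C₂, hC₂, hb₂⟩ := exists_norm_polyEval_le hW hdvd r
  choose Cd hCd hbd using fun e => exists_norm_polyEval_le
    (coeffDerivation_mem_weightedPoly hj e) (k := 0) (by simp) r
  choose Ds hDs hds using fun e => exists_taylorRemainder_le (m + 1) hs (hF.fderiv_apply e)
  choose Df hDf hdf using fun j => exists_taylorRemainder_le m hs
    (hF.fderiv_apply (fastDir j))
  -- `A * ε` will bound `‖q‖`, since each `|q j| ≤ r * ε`.
  set A : ℝ := n * r with hA
  have hA0 : 0 ≤ A := by positivity
  set K₂ : ℝ := C₂ + ((∑ i, (Ds (slowDirP i) * A ^ (m + 1) * Cd (qDir i) +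
      Ds (slowDirQ i) * A ^ (m + 1) * Cd (pDir i))) +
    ∑ j, Df j * A ^ m * (2 * r + Cd (vDir j))) with hK₂
  have hK₂0 : 0 ≤ K₂ := by
    refine add_nonneg hC₂ (add_nonneg (Finset.sum_nonneg fun i _ => ?_) (Finset.sum_nonneg fun j _ => ?_))
    · have := hDs (slowDirP i); have := hDs (slowDirQ i); have := hCd (qDir i); have := hCd (pDir i)
      positivity
    · have := hDf j; have := hCd (vDir j); positivity
  refine ⟨C₁ + K₂, by positivity, fun Ω ε hε hε1 hΩ => ?_⟩
  obtain ⟨θ, hθ⟩ := hres (fun j => ε * Ω j) hΩ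
  have hθΩ : ∀ j, θ.ω j = ε * Ω j := fun j => congrFun hθ j
  have hωpos : ∀ j, 0 < θ.ω j := fun j => zero_lt_one.trans_le (θ.one_le j)
  have hΩpos : ∀ j, 0 < Ω j := fun j => by
    have := hωpos j; rw [hθΩ] at this; exact (pos_iff_pos_of_mul_pos this).1 hε
  set Sc := scaling n d ε θ.ω with hSc
  set Jp : (ObsFamily n d (m + 1) β γ)[X] := C (quadFam ResonantApprox.ω') + j with hJp
  have hJdiff : Differentiable ℝ fun y => polyEval θ ε y Jp := differentiable_polyEval θ ε Jp
  refine ⟨fun j => θ.ω' j / θ.ω j, fun j => ?_, fun y => polyEval θ ε (Sc y) Jp,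
    hJdiff.comp Sc.differentiable, fun y hy hp hq => ?_⟩
  · rw [div_sub_one (hωpos j).ne', abs_div, abs_of_pos (hωpos j), div_le_iff₀ (hωpos j)]
    exact (θ.close j).trans (le_mul_of_one_le_right hβ.le (θ.one_le j))
  have hqε : ∀ j, |y.1.2.2 j| ≤ r * ε := by
    intro j
    have h1 := hq j
    rw [abs_mul, abs_of_pos (hΩpos j)] at h1
    have h2 : |y.1.2.2 j| ≤ ε * Ω j * |y.1.2.2 j| := le_mul_of_one_le_left (abs_nonneg _) (hΩ j)
    nlinarith
  have hqnorm : ‖y.1.2.2‖ ≤ A * ε := by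
    have h1 : ‖y.1.2.2‖ ≤ ∑ j, |y.1.2.2 j| := by
      conv_lhs => rw [show y.1.2.2 = ∑ j, y.1.2.2 j • EuclideanSpace.single j (1 : ℝ) by
        ext i; simp [Pi.single_apply]]
      refine (norm_sum_le _ _).trans (Finset.sum_le_sum fun j _ => ?_)
      rw [norm_smul]; simp
    refine h1.trans ((Finset.sum_le_sum fun j _ => hqε j).trans (le_of_eq ?_))
    rw [Finset.sum_const, Finset.card_univ, Fintype.card_fin, nsmul_eq_mul, hA]; ring
  have hpow : ∀ k, ‖y.1.2.2‖ ^ k ≤ A ^ k * ε ^ k := fun k => by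
    rw [← mul_pow]; exact pow_le_pow_left₀ (norm_nonneg _) hqnorm k
  have hε_le : ε ^ (m + 1) ≤ ε ^ m := pow_le_pow_of_le_one hε.le hε1 (Nat.le_succ m)
  have hs0 : ((Sc y).1.1, (Sc y).1.2.1, (0 : EuclideanSpace ℝ (Fin n))) ∈ s := by
    have := hs y.1 hy 0 ⟨le_rfl, zero_le_one⟩
    rwa [zero_smul] at this
  have hu : ∀ j, |(Sc y).1.2.2 j| ≤ r := by
    intro j
    change |ε⁻¹ * y.1.2.2 j| ≤ r
    rw [abs_mul, abs_inv, abs_of_pos hε, inv_mul_eq_div, div_le_iff₀ hε]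
    exact hqε j
  have hv : ∀ j, |(Sc y).2 j| ≤ r := by
    intro j
    change |(θ.ω j)⁻¹ * y.2 j| ≤ r
    rw [abs_mul, abs_inv, abs_of_pos (hωpos j)]
    exact (mul_le_of_le_one_left (abs_nonneg _) (inv_le_one_of_one_le₀ (θ.one_le j))).trans (hp j)
  constructor
  · beta_reduce
    rw [hJp, map_add, hSc, polyEval_quadFam_scaling θ hε hθΩ, add_sub_cancel_left]
    refine (hb₁ θ ε _ hε hε1 hs0 hu hv).trans ?_
    rw [pow_one]
    exact mul_le_mul_of_nonneg_right (le_add_of_nonneg_right hK₂0) hε.le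
  · have hchain : fderiv ℝ (fun y => polyEval θ ε (Sc y) Jp) y (hamField Ω F y) =
        fderiv ℝ (fun y => polyEval θ ε y Jp) (Sc y) (Sc (hamField Ω F y)) := by
      have := ((hJdiff (Sc y)).hasFDerivAt.comp y Sc.hasFDerivAt).fderiv
      exact congrArg (fun l => l (hamField Ω F y)) this
    rw [hchain, hSc, polyEval_hamField θ hε hθΩ y hF.contDiff Jp]
    have hslow : ∀ e : PhaseSpace n d, e.1.2.2 = 0 → e.2 = 0 →
        ‖polyEval θ ε (Sc y) (coeffDerivation (dirDeriv e) Jp)‖ ≤ Cd e := by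
      intro e h1 h2
      rw [hJp, map_add, coeffDerivation_C, dirDeriv_slow_quadFam _ _ h1 h2, C_0, zero_add]
      have := hbd e θ ε _ hε hε1 hs0 hu hv
      rwa [pow_zero, mul_one] at this
    -- The `v_j`-derivative of `h'` is `ω_j ω'_j v_j = ω'_j p_j`, unbounded in the frequencies. The
    -- factor `1/ω_j` in front of the remainder turns it into `(ω'_j/ω_j) p_j`, at most `2r` because
    -- `|ω'_j/ω_j| ≤ 2`.
    have hfast : ∀ j, |(θ.ω j)⁻¹| * ‖polyEval θ ε (Sc y) (coeffDerivation (dirDeriv (vDir j)) Jp)‖ ≤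
        2 * r + Cd (vDir j) := by
      intro j
      rw [hJp, map_add, map_add, coeffDerivation_C, polyEval_C, dirDeriv_vDir_quadFam]
      change |(θ.ω j)⁻¹| * ‖((θ.ω j * θ.ω' j : ℝ) : ℂ) * (((θ.ω j)⁻¹ * y.2 j : ℝ) : ℂ) + _‖ ≤ _
      have h1 := hbd (vDir j) θ ε _ hε hε1 hs0 hu hv
      rw [pow_zero, mul_one] at h1
      have hκ : |(θ.ω j)⁻¹| ≤ 1 := by
        rw [abs_inv, abs_of_pos (hωpos j)]; exact inv_le_one_of_one_le₀ (θ.one_le j)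
      refine (mul_le_mul_of_nonneg_left (norm_add_le _ _) (abs_nonneg _)).trans ?_
      rw [mul_add]
      refine add_le_add ?_ ((mul_le_of_le_one_left (norm_nonneg _) hκ).trans h1)
      rw [← Complex.ofReal_mul, Complex.norm_real, Real.norm_eq_abs, ← abs_mul]
      have h2 : (θ.ω j)⁻¹ * (θ.ω j * θ.ω' j * ((θ.ω j)⁻¹ * y.2 j)) = θ.ω' j / θ.ω j * y.2 j := by
        have := (hωpos j).ne'
        field_simp
      have h3 : |θ.ω' j / θ.ω j| ≤ 2 := by
        rw [abs_div, abs_of_pos (hωpos j), div_le_iff₀ (hωpos j)]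
        have h4 := abs_le.1 (θ.close j)
        have h5 := θ.one_le j
        rw [abs_le]; constructor <;> linarith
      rw [h2, abs_mul]
      exact mul_le_mul h3 (hp j) (abs_nonneg _) zero_le_two
    have hrs : ∀ e : CoupSpace n d, e.2.2 = 0 →
        |fderiv ℝ (taylorRemainder (m + 1) F) y.1 e| ≤ Ds e * A ^ (m + 1) * ε ^ m := by
      intro e he
      rw [fderiv_taylorRemainder_slow _ hF.contDiff _ he, mul_assoc]
      refine (hds e y.1 hy).trans (mul_le_mul_of_nonneg_left ?_ (hDs e))
      exact (hpow _).trans (mul_le_mul_of_nonneg_left hε_le (by positivity))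
    -- A fast derivative lowers the order of the remainder to `m`, which still gives `ε ^ m`.
    have hrf : ∀ j, |fderiv ℝ (taylorRemainder (m + 1) F) y.1 (fastDir j)| ≤ Df j * A ^ m * ε ^ m := by
      intro j
      rw [fderiv_taylorRemainder_fast _ hF.contDiff, mul_assoc]
      exact (hdf j y.1 hy).trans (mul_le_mul_of_nonneg_left (hpow _) (hDf j))
    have hT₁ : ‖-((ε : ℂ)⁻¹ * polyEval θ ε (Sc y) (formalBracket
        (C (quadFam ResonantApprox.ω) + taylorPoly n d (m + 1) β γ F hF.contDiff) Jp))‖ ≤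
        C₂ * ε ^ m := by
      rw [norm_neg, norm_mul, norm_inv, Complex.norm_real, Real.norm_eq_abs, abs_of_pos hε,
        inv_mul_eq_div, div_le_iff₀ hε]
      refine (hb₂ θ ε _ hε hε1 hs0 hu hv).trans (le_of_eq ?_)
      rw [pow_succ]; ring
    refine (norm_add_le _ _).trans ?_
    have hT₂ : ‖∑ i, ((fderiv ℝ (taylorRemainder (m + 1) F) y.1 (slowDirP i) : ℝ) *
          polyEval θ ε (Sc y) (coeffDerivation (dirDeriv (qDir i)) Jp) -
        (fderiv ℝ (taylorRemainder (m + 1) F) y.1 (slowDirQ i) : ℝ) *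
          polyEval θ ε (Sc y) (coeffDerivation (dirDeriv (pDir i)) Jp))‖ ≤
        (∑ i, (Ds (slowDirP i) * A ^ (m + 1) * Cd (qDir i) +
          Ds (slowDirQ i) * A ^ (m + 1) * Cd (pDir i))) * ε ^ m := by
      refine (norm_sum_le _ _).trans ?_
      rw [Finset.sum_mul]
      refine Finset.sum_le_sum fun i _ => (norm_sub_le _ _).trans ?_
      rw [norm_mul, norm_mul, Complex.norm_real, Complex.norm_real, Real.norm_eq_abs, Real.norm_eq_abs,
        add_mul]
      have hD1 := hDs (slowDirP i)
      have hD2 := hDs (slowDirQ i)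
      refine add_le_add ?_ ?_
      · rw [mul_right_comm]
        exact mul_le_mul (hrs _ rfl) (hslow _ rfl rfl) (norm_nonneg _) (by positivity)
      · rw [mul_right_comm]
        exact mul_le_mul (hrs _ rfl) (hslow _ rfl rfl) (norm_nonneg _) (by positivity)
    have hT₃ : ‖∑ j, ((θ.ω j)⁻¹ * fderiv ℝ (taylorRemainder (m + 1) F) y.1 (fastDir j) : ℝ) *
        polyEval θ ε (Sc y) (coeffDerivation (dirDeriv (vDir j)) Jp)‖ ≤
        (∑ j, Df j * A ^ m * (2 * r + Cd (vDir j))) * ε ^ m := by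
      refine (norm_sum_le _ _).trans ?_
      rw [Finset.sum_mul]
      refine Finset.sum_le_sum fun i _ => ?_
      rw [norm_mul, Complex.norm_real, Real.norm_eq_abs, abs_mul, mul_comm |(θ.ω i)⁻¹|, mul_assoc]
      have hD1 := hDf i
      calc _ ≤ (Df i * A ^ m * ε ^ m) * (2 * r + Cd (vDir i)) :=
            mul_le_mul (hrf i) (hfast i) (by positivity) (by positivity)
        _ = _ := by ring
    have := norm_sub_le (∑ i, ((fderiv ℝ (taylorRemainder (m + 1) F) y.1 (slowDirP i) : ℝ) *
          polyEval θ ε (Sc y) (coeffDerivation (dirDeriv (qDir i)) Jp) -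
        (fderiv ℝ (taylorRemainder (m + 1) F) y.1 (slowDirQ i) : ℝ) *
          polyEval θ ε (Sc y) (coeffDerivation (dirDeriv (pDir i)) Jp)))
      (∑ j, ((θ.ω j)⁻¹ * fderiv ℝ (taylorRemainder (m + 1) F) y.1 (fastDir j) : ℝ) *
        polyEval θ ε (Sc y) (coeffDerivation (dirDeriv (vDir j)) Jp))
    have hfin : C₂ * ε ^ m + ((∑ i, (Ds (slowDirP i) * A ^ (m + 1) * Cd (qDir i) +
          Ds (slowDirQ i) * A ^ (m + 1) * Cd (pDir i))) * ε ^ m +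
        (∑ j, Df j * A ^ m * (2 * r + Cd (vDir j))) * ε ^ m) ≤ (C₁ + K₂) * ε ^ m := by
      have : 0 ≤ C₁ * ε ^ m := by positivity
      rw [hK₂]; linarith
    exact (add_le_add hT₁ (this.trans (add_le_add hT₂ hT₃))).trans hfin

end ApproximateIntegral
end
end FastSlow

namespace FastSlow

noncomputable section

/-! ### Extension of functions, cut-off flows and continuation -/

section Cutoff

open scoped Manifold Topology

variable {E : Type*} [NormedAddCommGroup E] [NormedSpace ℝ E] [FiniteDimensional ℝ E]

/-- A function that is smooth near a closed set agrees near that set with a smooth function on the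
whole space. -/
theorem exists_contDiff_eventuallyEq {D s : Set E} (hD : IsOpen D) (hs : IsClosed s) (hsD : s ⊆ D)
    {H : E → ℝ} (hH : ContDiffOn ℝ ((⊤ : ℕ∞) : WithTop ℕ∞) H D) :
    ∃ F : E → ℝ, ContDiff ℝ ((⊤ : ℕ∞) : WithTop ℕ∞) F ∧ ∀ z ∈ s, F =ᶠ[𝓝 z] H := by
  obtain ⟨f, hf0, hf1, -⟩ := exists_contMDiffMap_zero_one_nhds_of_isClosed (n := (⊤ : ℕ∞))
    𝓘(ℝ, E) hD.isClosed_compl hs (Set.disjoint_left.2 fun z hz hz' => hz (hsD hz'))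
  have hf : ContDiff ℝ ((⊤ : ℕ∞) : WithTop ℕ∞) (f : E → ℝ) := f.contMDiff.contDiff
  refine ⟨fun z => f z * H z, contDiff_iff_contDiffAt.2 fun z => ?_, fun z hz => ?_⟩
  · by_cases hz : z ∈ D
    · exact hf.contDiffAt.mul (hH.contDiffAt (hD.mem_nhds hz))
    · have h0 : ∀ᶠ x in 𝓝 z, f x = 0 := (eventually_nhdsSet_iff_forall.1 hf0) z hz
      refine (contDiffAt_const (c := (0 : ℝ))).congr_of_eventuallyEq ?_
      filter_upwards [h0] with x hx
      rw [hx, zero_mul]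
  · filter_upwards [(eventually_nhdsSet_iff_forall.1 hf1) z hz] with x hx
    rw [hx, one_mul]

/-- A smooth vector field has solutions on a given time interval if it is cut off outside a ball. -/
theorem exists_solution_of_ball (V : E → E) (hV : ContDiff ℝ 1 V) (y₀ : E) {R T : ℝ} (hR : 0 < R)
    (hT : 0 ≤ T) : ∃ α : ℝ → E, α 0 = y₀ ∧ ContinuousOn α (Set.Icc (-T) T) ∧
      ∀ t ∈ Set.Icc (-T) T, ‖α t - y₀‖ ≤ R → HasDerivWithinAt α (V (α t)) (Set.Icc (-T) T) t := by
  let ζ : ContDiffBump y₀ := ⟨R, R + 1, hR, lt_add_one R⟩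
  let W : E → E := fun y => ζ y • V y
  have hW : ContDiff ℝ 1 W := ζ.contDiff.smul hV
  have hWc : HasCompactSupport W := HasCompactSupport.smul_right (f := (ζ : E → ℝ)) ζ.hasCompactSupport
  obtain ⟨K, hK⟩ := hW.lipschitzWith_of_hasCompactSupport hWc one_ne_zero
  obtain ⟨C, hC⟩ := hWc.exists_bound_of_continuous hW.continuous
  -- The cut-off field is bounded and globally Lipschitz, so radius `C * T` serves for any `T`
  -- without a smallness condition.
  have hpl : IsPicardLindelof (fun _ => W) (tmin := -T) (tmax := T) ⟨0, by simpa using hT, hT⟩ y₀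
      (C.toNNReal * T.toNNReal) 0 C.toNNReal K :=
    { lipschitzOnWith := fun t _ => hK.lipschitzOnWith
      continuousOn := fun x _ => continuousOn_const
      norm_le := fun t _ x _ => (hC x).trans (Real.le_coe_toNNReal C)
      mul_max_le := by simp [hT] }
  obtain ⟨α, h0, hα⟩ := hpl.exists_eq_forall_mem_Icc_hasDerivWithinAt₀
  refine ⟨α, h0, fun t ht => (hα t ht).continuousWithinAt, fun t ht hR' => ?_⟩
  have : W (α t) = V (α t) := by
    change ζ (α t) • V (α t) = _
    rw [ζ.one_of_mem_closedBall (by rwa [mem_closedBall_iff_norm]), one_smul]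
  exact this ▸ hα t ht

/-- A path that starts in a closed set and can be continued into its interior never leaves it. -/
theorem forall_mem_of_forall_mem_interior {X : Type*} [TopologicalSpace X] {γ : ℝ → X} {S : Set X}
    (hS : IsClosed S) (hγ : ContinuousOn γ (Set.Icc 0 1)) (h0 : γ 0 ∈ S)
    (h : ∀ t ∈ Set.Icc (0 : ℝ) 1, (∀ u ∈ Set.Icc 0 t, γ u ∈ S) → γ t ∈ interior S) :
    ∀ t ∈ Set.Icc (0 : ℝ) 1, γ t ∈ S := by
  have hcl : IsClosed (γ ⁻¹' S ∩ Set.Icc 0 1) := by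
    rw [Set.inter_comm]; exact hγ.preimage_isClosed_of_isClosed isClosed_Icc hS
  refine hcl.Icc_subset_of_forall_mem_nhdsGT_of_Icc_subset h0 fun t ht hsub => ?_
  have h1 := h t ⟨ht.1, ht.2.le⟩ hsub
  have h2 : γ ⁻¹' S ∈ 𝓝[Set.Icc 0 1] t :=
    (hγ t ⟨ht.1, ht.2.le⟩).preimage_mem_nhdsWithin (mem_interior_iff_mem_nhds.1 h1)
  refine nhdsWithin_le_of_mem ?_ h2
  exact Filter.mem_of_superset (Ioc_mem_nhdsGT ht.2) fun u hu => ⟨ht.1.trans hu.1.le, hu.2⟩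

end Cutoff

section Gradient

theorem gradient_eq_of_hasFDerivAt {m : ℕ} {f : EuclideanSpace ℝ (Fin m) → ℝ}
    {f' : EuclideanSpace ℝ (Fin m) →L[ℝ] ℝ} {x : EuclideanSpace ℝ (Fin m)} (h : HasFDerivAt f f' x) :
    gradient f x = WithLp.toLp 2 fun i => f' (EuclideanSpace.single i 1) := by
  ext i
  rw [gradient, h.fderiv]
  have := InnerProductSpace.toDual_symm_apply (𝕜 := ℝ) (x := EuclideanSpace.single i (1 : ℝ)) (y := f')
  rw [EuclideanSpace.inner_single_right] at this
  simpa using this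

end Gradient
end
end FastSlow

namespace FastSlow

noncomputable section

/-! ### The Hamiltonian vector field and conservation of energy -/

section HamiltonianField

variable {n d : ℕ}

theorem coupSpace_eq_sum (z : CoupSpace n d) :
    z = ∑ i, z.1 i • slowDirP i + ∑ i, z.2.1 i • slowDirQ i + ∑ j, z.2.2 j • fastDir j := by
  have h : ∀ (m : ℕ) (x : EuclideanSpace ℝ (Fin m)), ∑ i, x i • EuclideanSpace.single i (1 : ℝ) = x := by
    intro m x; ext i; simp [Pi.single_apply]
  rw [sum_smul_fastDir]
  refine Prod.ext ?_ (Prod.ext ?_ ?_)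
  · simp [Prod.fst_sum, slowDirP, slowDirQ]; rw [h]
  · simp [Prod.fst_sum, Prod.snd_sum, slowDirP, slowDirQ]; rw [h]
  · simp [Prod.snd_sum, slowDirP, slowDirQ]

theorem fastEnergy_nonneg (Ω : Fin n → ℝ) (p q : EuclideanSpace ℝ (Fin n)) : 0 ≤ fastEnergy Ω p q :=
  Finset.sum_nonneg fun j _ => by positivity

theorem hasFDerivAt_fastEnergy (Ω : Fin n → ℝ) (y : PhaseSpace n d) :
    HasFDerivAt (fun y : PhaseSpace n d => fastEnergy Ω y.2 y.1.2.2)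
      (∑ j, (y.2 j • (EuclideanSpace.proj j ∘L ContinuousLinearMap.snd ℝ _ _) +
        (Ω j ^ 2 * y.1.2.2 j) • (EuclideanSpace.proj j ∘L ContinuousLinearMap.snd ℝ _ _ ∘L
          ContinuousLinearMap.snd ℝ _ _ ∘L ContinuousLinearMap.fst ℝ _ _)) :
        PhaseSpace n d →L[ℝ] ℝ) y := by
  simp only [fastEnergy, div_eq_mul_inv]
  refine HasFDerivAt.fun_sum fun j _ => ?_
  have h1 : HasFDerivAt (fun y : PhaseSpace n d => y.2 j)
      (EuclideanSpace.proj j ∘L ContinuousLinearMap.snd ℝ _ _ : PhaseSpace n d →L[ℝ] ℝ) y :=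
    (EuclideanSpace.proj j ∘L ContinuousLinearMap.snd ℝ _ _ : PhaseSpace n d →L[ℝ] ℝ).hasFDerivAt
  have h2 : HasFDerivAt (fun y : PhaseSpace n d => y.1.2.2 j)
      (EuclideanSpace.proj j ∘L ContinuousLinearMap.snd ℝ _ _ ∘L ContinuousLinearMap.snd ℝ _ _ ∘L
        ContinuousLinearMap.fst ℝ _ _ : PhaseSpace n d →L[ℝ] ℝ) y :=
    (EuclideanSpace.proj j ∘L ContinuousLinearMap.snd ℝ _ _ ∘L ContinuousLinearMap.snd ℝ _ _ ∘L
        ContinuousLinearMap.fst ℝ _ _ : PhaseSpace n d →L[ℝ] ℝ).hasFDerivAt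
  refine (((h1.pow 2).add ((h2.pow 2).const_mul (Ω j ^ 2))).mul_const (2⁻¹ : ℝ)).congr_fderiv ?_
  ext v <;> simp <;> ring

theorem differentiable_fastEnergy (Ω : Fin n → ℝ) :
    Differentiable ℝ fun y : PhaseSpace n d => fastEnergy Ω y.2 y.1.2.2 :=
  fun y => (hasFDerivAt_fastEnergy Ω y).differentiableAt

/-- The energy is conserved by the Hamiltonian field. -/
theorem fderiv_energy_hamField (Ω : Fin n → ℝ) {F : CoupSpace n d → ℝ} (hF : Differentiable ℝ F)
    (y : PhaseSpace n d) :
    fderiv ℝ (fun y : PhaseSpace n d => fastEnergy Ω y.2 y.1.2.2 + F y.1) y (hamField Ω F y) = 0 := by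
  have h : HasFDerivAt (fun y : PhaseSpace n d => F y.1)
      (fderiv ℝ F y.1 ∘L ContinuousLinearMap.fst ℝ _ _) y :=
    (hF y.1).hasFDerivAt.comp y hasFDerivAt_fst
  rw [((hasFDerivAt_fastEnergy Ω y).fun_add h).fderiv, add_apply, ContinuousLinearMap.comp_apply,
    ContinuousLinearMap.coe_fst']
  conv_lhs => rw [coupSpace_eq_sum (hamField Ω F y).1]
  simp only [map_add, map_sum, map_smul, sum_apply, add_apply, smul_apply, smul_eq_mul]
  simp only [hamField, ContinuousLinearMap.comp_apply, ContinuousLinearMap.coe_fst',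
    ContinuousLinearMap.coe_snd', PiLp.proj_apply]
  have h2 : ∀ (a b c e : ℝ), e + (a + b + c) = (a + b) + (e + c) := fun a b c e => by ring
  rw [h2, ← Finset.sum_add_distrib, ← Finset.sum_add_distrib,
    Finset.sum_eq_zero fun i _ => by ring, Finset.sum_eq_zero fun i _ => by ring, add_zero]

theorem contDiff_hamField (Ω : Fin n → ℝ) {F : CoupSpace n d → ℝ}
    (hF : ContDiff ℝ ((⊤ : ℕ∞) : WithTop ℕ∞) F) : ContDiff ℝ 1 (hamField Ω F) := by
  have h : ∀ e : CoupSpace n d, ContDiff ℝ 1 fun y : PhaseSpace n d => fderiv ℝ F y.1 e := fun e =>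
    ((contDiff_fderiv_dir hF e).of_le (by norm_cast)).comp contDiff_fst
  have hlp : ∀ (m : ℕ) (f : Fin m → PhaseSpace n d → ℝ), (∀ i, ContDiff ℝ 1 (f i)) →
      ContDiff ℝ 1 fun y => WithLp.toLp 2 fun i => f i y := fun m f hf =>
    contDiff_euclidean.2 hf
  unfold hamField
  refine ContDiff.prodMk (ContDiff.prodMk (hlp _ _ fun i => (h _).neg)
    (ContDiff.prodMk (hlp _ _ fun i => h _) contDiff_snd)) (hlp _ _ fun j => ContDiff.neg ?_)
  exact ContDiff.add (by fun_prop) (h _)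

variable {s : Set (CoupSpace n d)}

/-- This bound may depend on `Ω`: it only fixes the radius of the cut-off ball and does not enter
the final constants. -/
theorem exists_norm_hamField_le (Ω : Fin n → ℝ) {F : CoupSpace n d → ℝ} (hF : IsBoundedSmooth s F)
    (r : ℝ) : ∃ L, 0 ≤ L ∧ ∀ y : PhaseSpace n d, y.1 ∈ s → (∀ j, |y.2 j| ≤ r) →
      (∀ j, |y.1.2.2 j| ≤ r) → ‖hamField Ω F y‖ ≤ L := by
  choose C hC using fun e => (hF.fderiv_apply e).exists_abs_le
  have hlp : ∀ (m : ℕ) (x : EuclideanSpace ℝ (Fin m)), ‖x‖ ≤ ∑ i, |x i| := by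
    intro m x
    conv_lhs => rw [show x = ∑ j, x j • EuclideanSpace.single j (1 : ℝ) by
      ext i; simp [Pi.single_apply]]
    refine (norm_sum_le _ _).trans (Finset.sum_le_sum fun j _ => ?_)
    rw [norm_smul]; simp
  refine ⟨∑ i : Fin d, |C (slowDirQ i)| + ∑ i : Fin d, |C (slowDirP i)| + ∑ j : Fin n, |r| +
    ∑ j : Fin n, (Ω j ^ 2 * |r| + |C (fastDir j)|), by positivity, fun y hy hp hq => ?_⟩
  have h1 : ‖(hamField Ω F y).1.1‖ ≤ ∑ i : Fin d, |C (slowDirQ i)| :=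
    (hlp _ _).trans (Finset.sum_le_sum fun i _ => by
      rw [hamField, abs_neg]; exact (hC _ _ hy).trans (le_abs_self _))
  have h2 : ‖(hamField Ω F y).1.2.1‖ ≤ ∑ i : Fin d, |C (slowDirP i)| :=
    (hlp _ _).trans (Finset.sum_le_sum fun i _ => (hC _ _ hy).trans (le_abs_self _))
  have h3 : ‖(hamField Ω F y).1.2.2‖ ≤ ∑ j : Fin n, |r| :=
    (hlp _ _).trans (Finset.sum_le_sum fun i _ => (hp i).trans (le_abs_self _))
  have h4 : ‖(hamField Ω F y).2‖ ≤ ∑ j : Fin n, (Ω j ^ 2 * |r| + |C (fastDir j)|) :=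
    (hlp _ _).trans (Finset.sum_le_sum fun i _ => by
      rw [hamField, abs_neg]
      refine (abs_add_le _ _).trans (add_le_add ?_ ((hC _ _ hy).trans (le_abs_self _)))
      rw [abs_mul, abs_of_nonneg (sq_nonneg (Ω i))]
      exact mul_le_mul_of_nonneg_left ((hq i).trans (le_abs_self _)) (sq_nonneg _))
  have p1 : 0 ≤ ∑ i : Fin d, |C (slowDirQ i)| := by positivity
  have p2 : 0 ≤ ∑ i : Fin d, |C (slowDirP i)| := by positivity
  have p3 : 0 ≤ ∑ j : Fin n, |r| := by positivity
  have p4 : 0 ≤ ∑ j : Fin n, (Ω j ^ 2 * |r| + |C (fastDir j)|) := by positivity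
  rw [Prod.norm_def, Prod.norm_def, Prod.norm_def]
  refine max_le (max_le ?_ (max_le ?_ ?_)) ?_ <;> linarith

/-- Gradients depend only on germs, so Hamilton's equations of `H` and of its extension `F` coincide
where the two agree nearby. -/
theorem gradient_fastEnergy_add (Ω : Fin n → ℝ) {H F : CoupSpace n d → ℝ} {y : PhaseSpace n d}
    (hF : Differentiable ℝ F) (h : F =ᶠ[nhds y.1] H) :
    ((-gradient (fun Y => hamiltonian Ω H y.2 y.1.2.2 y.1.1 Y) y.1.2.1,
      gradient (fun X => hamiltonian Ω H y.2 y.1.2.2 X y.1.2.1) y.1.1,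
      gradient (fun x => hamiltonian Ω H x y.1.2.2 y.1.1 y.1.2.1) y.2),
      -gradient (fun x => hamiltonian Ω H y.2 x y.1.1 y.1.2.1) y.1.2.2) = hamField Ω F y := by
  have hH : HasFDerivAt H (fderiv ℝ F y.1) y.1 :=
    (hF y.1).hasFDerivAt.congr_of_eventuallyEq h.symm
  have hy : HasFDerivAt (fun y : PhaseSpace n d => fastEnergy Ω y.2 y.1.2.2 + H y.1) _ y :=
    (hasFDerivAt_fastEnergy Ω y).add
      (HasFDerivAt.comp (g := H) y hH hasFDerivAt_fst)
  have e1 : HasFDerivAt (fun Y : EuclideanSpace ℝ (Fin d) => (((y.1.1, Y, y.1.2.2), y.2) : PhaseSpace n d))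
      (((0 : EuclideanSpace ℝ (Fin d) →L[ℝ] EuclideanSpace ℝ (Fin d)).prod ((ContinuousLinearMap.id ℝ _).prod 0)).prod 0) y.1.2.1 :=
    ((hasFDerivAt_const _ _).prodMk ((hasFDerivAt_id _).prodMk (hasFDerivAt_const _ _))).prodMk
      (hasFDerivAt_const _ _)
  have e2 : HasFDerivAt (fun X : EuclideanSpace ℝ (Fin d) => (((X, y.1.2.1, y.1.2.2), y.2) : PhaseSpace n d))
      (((ContinuousLinearMap.id ℝ _).prod ((0 : EuclideanSpace ℝ (Fin d) →L[ℝ] EuclideanSpace ℝ (Fin d)).prod 0)).prod 0) y.1.1 :=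
    ((hasFDerivAt_id _).prodMk ((hasFDerivAt_const _ _).prodMk (hasFDerivAt_const _ _))).prodMk
      (hasFDerivAt_const _ _)
  have e3 : HasFDerivAt (fun x : EuclideanSpace ℝ (Fin n) => ((y.1, x) : PhaseSpace n d))
      ((0 : EuclideanSpace ℝ (Fin n) →L[ℝ] CoupSpace n d).prod (ContinuousLinearMap.id ℝ _)) y.2 :=
    (hasFDerivAt_const _ _).prodMk (hasFDerivAt_id _)
  have e4 : HasFDerivAt (fun x : EuclideanSpace ℝ (Fin n) => (((y.1.1, y.1.2.1, x), y.2) : PhaseSpace n d))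
      (((0 : EuclideanSpace ℝ (Fin n) →L[ℝ] EuclideanSpace ℝ (Fin d)).prod
        ((0 : EuclideanSpace ℝ (Fin n) →L[ℝ] EuclideanSpace ℝ (Fin d)).prod (ContinuousLinearMap.id ℝ _))).prod 0) y.1.2.2 :=
    ((hasFDerivAt_const _ _).prodMk ((hasFDerivAt_const _ _).prodMk (hasFDerivAt_id _))).prodMk
      (hasFDerivAt_const _ _)
  have g1 := gradient_eq_of_hasFDerivAt (HasFDerivAt.comp (g := fun y : PhaseSpace n d => fastEnergy Ω y.2 y.1.2.2 + H y.1) y.1.2.1 hy e1)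
  have g2 := gradient_eq_of_hasFDerivAt (HasFDerivAt.comp (g := fun y : PhaseSpace n d => fastEnergy Ω y.2 y.1.2.2 + H y.1) y.1.1 hy e2)
  have g3 := gradient_eq_of_hasFDerivAt (HasFDerivAt.comp (g := fun y : PhaseSpace n d => fastEnergy Ω y.2 y.1.2.2 + H y.1) y.2 hy e3)
  have g4 := gradient_eq_of_hasFDerivAt (HasFDerivAt.comp (g := fun y : PhaseSpace n d => fastEnergy Ω y.2 y.1.2.2 + H y.1) y.1.2.2 hy e4)
  refine Prod.ext (Prod.ext ?_ (Prod.ext ?_ ?_)) ?_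
  · refine (congrArg Neg.neg g1).trans ?_
    ext i
    simp [hamField, slowDirQ]
  · refine g2.trans ?_
    ext i
    simp [hamField, slowDirP]
  · refine g3.trans ?_
    ext i
    simp [hamField]
  · refine (congrArg Neg.neg g4).trans ?_
    ext i
    simp [hamField, fastDir]

end HamiltonianField
end
end FastSlow

namespace FastSlow

noncomputable section

open scoped Topology

/-! ### The regions of phase space -/

section Regions

variable {n d : ℕ} {D : Set (CoupSpace n d)} {H₀ : CoupSpace n d → ℝ} {E E₀ : ℝ}

/-- The points `(P, Q, q)` with slow energy at most `2 * E₀` and moderate `q`. -/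
def couplingRegion (D : Set (CoupSpace n d)) (H₀ : CoupSpace n d → ℝ) (E E₀ : ℝ) :
    Set (CoupSpace n d) :=
  {z | (z.1, z.2.1) ∈ slowSublevel D H₀ (2 * E₀) ∧ ‖z.2.2‖ ^ 2 ≤ 18 * E}

/-- The part of phase space with fast energy at most `2 * E` and slow energy at most `2 * E₀`. -/
def energyRegion (D : Set (CoupSpace n d)) (H₀ : CoupSpace n d → ℝ) (E E₀ : ℝ) (Ω : Fin n → ℝ) :
    Set (PhaseSpace n d) :=
  {y | fastEnergy Ω y.2 y.1.2.2 ≤ 2 * E ∧ (y.1.1, y.1.2.1) ∈ slowSublevel D H₀ (2 * E₀)}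

theorem slowSublevel_mono {e e' : ℝ} (h : e ≤ e') : slowSublevel D H₀ e ⊆ slowSublevel D H₀ e' :=
  fun _ hx => ⟨hx.1, hx.2.trans h⟩

/-- Closedness at level `3 * E₀` is inherited by lower levels, as `H₀` is continuous on that closed
set. -/
theorem IsAdmissible.isClosed_slowSublevel (h : IsAdmissible D H₀ E E₀) {e : ℝ} (he : e ≤ 3 * E₀) :
    IsClosed (slowSublevel D H₀ e) := by
  have hc : ContinuousOn (fun x : EuclideanSpace ℝ (Fin d) × EuclideanSpace ℝ (Fin d) =>
      H₀ (x.1, x.2, 0)) (slowSublevel D H₀ (3 * E₀)) :=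
    h.smooth.continuousOn.comp (by fun_prop) fun x hx => hx.1
  have := hc.preimage_isClosed_of_isClosed h.isClosed_sublevel (isClosed_Iic (a := e))
  convert this using 1
  ext x
  exact ⟨fun hx => ⟨⟨hx.1, hx.2.trans he⟩, hx.2⟩, fun hx => ⟨hx.1.1, hx.2⟩⟩

theorem IsAdmissible.isClosed_couplingRegion (h : IsAdmissible D H₀ E E₀) (hE₀ : 0 ≤ E₀) :
    IsClosed (couplingRegion D H₀ E E₀) :=
  ((h.isClosed_slowSublevel (by linarith)).preimage
    (f := fun z : CoupSpace n d => (z.1, z.2.1)) (by fun_prop)).inter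
    (isClosed_le (f := fun z : CoupSpace n d => ‖z.2.2‖ ^ 2) (by fun_prop) continuous_const)

/-- The constant is `18 = 2 * 3 ^ 2`: with `p = 0` the ball of radius `3 * √E` reads `‖q‖ ^ 2 / 2 ≤
9 * E`. -/
theorem mem_fastBall_of_norm_le (hE : 0 ≤ E) {q : EuclideanSpace ℝ (Fin n)} (hq : ‖q‖ ^ 2 ≤ 18 * E) :
    ((0, q) : EuclideanSpace ℝ (Fin n) × EuclideanSpace ℝ (Fin n)) ∈ fastBall n (3 * √E) := by
  change ∑ j, ((0 : ℝ) ^ 2 + q j ^ 2) / 2 ≤ _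
  rw [EuclideanSpace.norm_sq_eq] at hq
  simp only [Real.norm_eq_abs, sq_abs] at hq
  rw [mul_pow, Real.sq_sqrt hE, ← Finset.sum_div]
  simp only [ne_eq, OfNat.ofNat_ne_zero, not_false_eq_true, zero_pow, zero_add]
  linarith

theorem IsAdmissible.couplingRegion_subset (h : IsAdmissible D H₀ E E₀) (hE : 0 ≤ E) (hE₀ : 0 ≤ E₀) :
    couplingRegion D H₀ E E₀ ⊆ D := fun z hz =>
  h.subset_domain _ (mem_fastBall_of_norm_le hE hz.2) _ (slowSublevel_mono (by linarith) hz.1)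

/-- The slow Hamiltonian extends from the region of interest to a smooth function with bounded
derivatives there. -/
theorem IsAdmissible.exists_extension (h : IsAdmissible D H₀ E E₀) (hE : 0 ≤ E) (hE₀ : 0 ≤ E₀) :
    ∃ F : CoupSpace n d → ℝ, IsBoundedSmooth (couplingRegion D H₀ E E₀) F ∧
      ∀ z ∈ couplingRegion D H₀ E E₀, F =ᶠ[𝓝 z] H₀ := by
  obtain ⟨F, hF, hFH⟩ := exists_contDiff_eventuallyEq h.isOpen_domain
    (h.isClosed_couplingRegion hE₀) (h.couplingRegion_subset hE hE₀) h.smooth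
  refine ⟨F, ⟨hF, fun k => ?_⟩, hFH⟩
  obtain ⟨C, hC⟩ := h.bounded_derivatives k
  refine ⟨C, fun z hz => ?_⟩
  have h1 := hC _ (mem_fastBall_of_norm_le hE hz.2) _ (slowSublevel_mono (by linarith) hz.1)
  have h2 : iteratedFDeriv ℝ k F z = iteratedFDeriv ℝ k H₀ z :=
    ((hFH z hz).iteratedFDeriv ℝ k).eq_of_nhds
  exact (congrArg norm h2).trans_le h1

theorem couplingRegion_star (z : CoupSpace n d) (hz : z ∈ couplingRegion D H₀ E E₀) (t : ℝ)
    (ht : t ∈ Set.Icc (0 : ℝ) 1) : (z.1, z.2.1, t • z.2.2) ∈ couplingRegion D H₀ E E₀ := by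
  refine ⟨hz.1, le_trans ?_ hz.2⟩
  refine pow_le_pow_left₀ (norm_nonneg _) ?_ 2
  rw [norm_smul, Real.norm_eq_abs, abs_of_nonneg ht.1]
  exact mul_le_of_le_one_left (norm_nonneg _) ht.2

theorem IsAdmissible.isClosed_energyRegion (h : IsAdmissible D H₀ E E₀) (hE₀ : 0 ≤ E₀)
    (Ω : Fin n → ℝ) : IsClosed (energyRegion D H₀ E E₀ Ω) :=
  (isClosed_le (differentiable_fastEnergy Ω).continuous continuous_const).inter
    ((h.isClosed_slowSublevel (by linarith)).preimage
      (f := fun y : PhaseSpace n d => (y.1.1, y.1.2.1)) (by fun_prop))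

theorem IsAdmissible.mem_interior_energyRegion (h : IsAdmissible D H₀ E E₀) {Ω : Fin n → ℝ}
    {y : PhaseSpace n d} (h1 : fastEnergy Ω y.2 y.1.2.2 < 2 * E) (h2 : (y.1.1, y.1.2.1, 0) ∈ D)
    (h3 : H₀ (y.1.1, y.1.2.1, 0) < 2 * E₀) : y ∈ interior (energyRegion D H₀ E E₀ Ω) := by
  rw [mem_interior_iff_mem_nhds]
  have c0 : Continuous fun y : PhaseSpace n d =>
      ((y.1.1, y.1.2.1, 0) : CoupSpace n d) := by fun_prop
  have c1 : ContinuousAt (fun y : PhaseSpace n d => H₀ (y.1.1, y.1.2.1, 0)) y :=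
    ContinuousAt.comp (g := H₀) (h.smooth.continuousOn.continuousAt (h.isOpen_domain.mem_nhds h2))
      c0.continuousAt
  filter_upwards [(differentiable_fastEnergy Ω).continuous.continuousAt.eventually_lt_const h1,
    c0.continuousAt.eventually (h.isOpen_domain.mem_nhds h2), c1.eventually_lt_const h3] with x e1 e2 e3
  exact ⟨e1.le, e2, e3.le⟩

theorem sq_le_of_fastEnergy_le {Ω : Fin n → ℝ} {p q : EuclideanSpace ℝ (Fin n)}
    (h : fastEnergy Ω p q ≤ 2 * E) (j : Fin n) : p j ^ 2 ≤ 4 * E ∧ (Ω j * q j) ^ 2 ≤ 4 * E := by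
  have h1 : (p j ^ 2 + Ω j ^ 2 * q j ^ 2) / 2 ≤ fastEnergy Ω p q :=
    Finset.single_le_sum (f := fun j => (p j ^ 2 + Ω j ^ 2 * q j ^ 2) / 2)
      (fun i _ => by positivity) (Finset.mem_univ j)
  have h2 := sq_nonneg (p j)
  have h3 : 0 ≤ Ω j ^ 2 * q j ^ 2 := by positivity
  rw [mul_pow]
  constructor <;> linarith

theorem abs_le_of_fastEnergy_le (hE : 0 ≤ E) {Ω : Fin n → ℝ} {p q : EuclideanSpace ℝ (Fin n)}
    (h : fastEnergy Ω p q ≤ 2 * E) (j : Fin n) : |p j| ≤ 2 * √E ∧ |Ω j * q j| ≤ 2 * √E := by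
  obtain ⟨h1, h2⟩ := sq_le_of_fastEnergy_le h j
  have h3 : (2 * √E) ^ 2 = 4 * E := by rw [mul_pow, Real.sq_sqrt hE]; norm_num
  exact ⟨abs_le_of_sq_le_sq (h1.trans h3.ge) (by positivity),
    abs_le_of_sq_le_sq (h2.trans h3.ge) (by positivity)⟩

/-- Since `1 ≤ ε * Ω j`, bounded fast energy forces `q` to be of size `ε`. -/
theorem norm_sq_le_of_fastEnergy_le {Ω : Fin n → ℝ} {ε : ℝ} (hΩ : ∀ j, 1 ≤ ε * Ω j)
    {p q : EuclideanSpace ℝ (Fin n)} (h : fastEnergy Ω p q ≤ 2 * E) :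
    ‖q‖ ^ 2 ≤ 4 * E * ε ^ 2 := by
  have h1 : ‖q‖ ^ 2 ≤ 2 * ε ^ 2 * fastEnergy Ω p q := by
    rw [EuclideanSpace.norm_sq_eq, fastEnergy, Finset.mul_sum]
    refine Finset.sum_le_sum fun j _ => ?_
    rw [Real.norm_eq_abs, sq_abs]
    have h1 : 1 ≤ (ε * Ω j) ^ 2 := one_le_pow₀ (hΩ j)
    have h2 := mul_le_mul_of_nonneg_right h1 (sq_nonneg (q j))
    have h3 : 0 ≤ ε ^ 2 * p j ^ 2 := by positivity
    nlinarith
  have h2 := mul_le_mul_of_nonneg_left h (by positivity : 0 ≤ 2 * ε ^ 2)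
  linarith

theorem mem_couplingRegion_of_mem_energyRegion (hE : 0 ≤ E) {Ω : Fin n → ℝ} {ε : ℝ} (hε : 0 ≤ ε)
    (hε1 : ε ≤ 1) (hΩ : ∀ j, 1 ≤ ε * Ω j) {y : PhaseSpace n d} (hy : y ∈ energyRegion D H₀ E E₀ Ω) :
    y.1 ∈ couplingRegion D H₀ E E₀ := by
  refine ⟨hy.2, (norm_sq_le_of_fastEnergy_le hΩ hy.1).trans ?_⟩
  have : ε ^ 2 ≤ 1 := pow_le_one₀ hε hε1
  nlinarith

end Regions

/-! ### The continuity argument -/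

section Bootstrap

variable {n d : ℕ} {D : Set (CoupSpace n d)} {H₀ F : CoupSpace n d → ℝ} {E E₀ : ℝ}

/-- Along pieces of trajectories inside the energy region the fast energy is almost conserved, and
the trajectory stays away from the boundary of the region. -/
theorem exists_fastEnergy_bound (hE : 0 < E) (hE₀ : 0 < E₀)
    (hF : IsBoundedSmooth (couplingRegion D H₀ E E₀) F)
    (hFH : ∀ z ∈ couplingRegion D H₀ E E₀, F z = H₀ z) {b : ℝ} (hb : 0 < b) (hb1 : b ≤ 1)
    (hbE : 4 * E * b ≤ E₀) (N : ℝ) :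
    ∃ εstar > 0, ∃ K > 0, εstar ≤ 1 ∧ ∀ (Ω : Fin n → ℝ) (ε : ℝ), 0 < ε → ε < εstar →
      (∀ j, 1 ≤ ε * Ω j) → ∀ (γ : ℝ → PhaseSpace n d) (τ : ℝ), |τ| ≤ ε ^ (-N) →
      fastEnergy Ω (γ 0).2 (γ 0).1.2.2 < E → H₀ ((γ 0).1.1, (γ 0).1.2.1, 0) < E₀ →
      ∀ t ∈ Set.Icc (0 : ℝ) 1, (∀ u ∈ Set.Icc 0 t, γ u ∈ energyRegion D H₀ E E₀ Ω ∧
        HasDerivWithinAt γ (τ • hamField Ω F (γ u)) (Set.Icc 0 t) u) →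
      |fastEnergy Ω (γ t).2 (γ t).1.2.2 - fastEnergy Ω (γ 0).2 (γ 0).1.2.2| ≤
        max (fastEnergy Ω (γ 0).2 (γ 0).1.2.2) (K * ε) * b ∧
      fastEnergy Ω (γ t).2 (γ t).1.2.2 < 2 * E ∧ H₀ ((γ t).1.1, (γ t).1.2.1, 0) < 2 * E₀ := by
  -- Since `ε ^ (-N) * ε ^ m ≤ ε`, the drift of `J` over the whole time is `O(ε)`, like its distance
  -- from the quadratic form.
  set m : ℕ := ⌈N⌉₊ + 1 with hm
  obtain ⟨K₁, hK₁, hJ⟩ := exists_approximate_integral (β := b / 8) couplingRegion_star hF m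
    (by positivity) (by linarith) (r := 2 * √E) (by positivity)
  obtain ⟨C, hC, hR⟩ := exists_taylorRemainder_le 1 couplingRegion_star hF
  set K : ℝ := 12 * K₁ / b + 1 with hK
  have hKpos : 0 < K := by positivity
  -- `E / K` ensures `K * ε < E`. The other bound makes the variation of `H₀` between `q` and `0`
  -- small compared with `E₀`; its `+ 1` covers `C = 0`.
  refine ⟨min 1 (min (E / K) (E₀ / (16 * C * √E + 1))), by positivity, K, hKpos, min_le_left _ _,
    fun Ω ε hε hεs hΩ γ τ hτ h0 hH0 t ht hγ => ?_⟩
  have hε1 : ε ≤ 1 := (hεs.trans_le (min_le_left _ _)).le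
  have hεK : K * ε < E := by
    have := hεs.trans_le ((min_le_right _ _).trans (min_le_left _ _))
    rwa [lt_div_iff₀ hKpos, mul_comm] at this
  have hεC : 16 * C * √E * ε < E₀ := by
    have := hεs.trans_le ((min_le_right _ _).trans (min_le_right _ _))
    rw [lt_div_iff₀ (by positivity)] at this
    nlinarith
  obtain ⟨ρ, hρ, J, hJd, hJ⟩ := hJ Ω ε hε hε1 hΩ
  have hreg : ∀ u ∈ Set.Icc 0 t, (γ u).1 ∈ couplingRegion D H₀ E E₀ := fun u hu =>
    mem_couplingRegion_of_mem_energyRegion hE.le hε.le hε1 hΩ (hγ u hu).1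
  have hJ' : ∀ u ∈ Set.Icc 0 t, _ := fun u hu => hJ (γ u) (hreg u hu)
    (fun j => (abs_le_of_fastEnergy_le hE.le (hγ u hu).1.1 j).1)
    (fun j => (abs_le_of_fastEnergy_le hE.le (hγ u hu).1.1 j).2)
  have h0t : (0 : ℝ) ∈ Set.Icc 0 t := ⟨le_rfl, ht.1⟩
  have htt : t ∈ Set.Icc 0 t := ⟨ht.1, le_rfl⟩
  have hpow : |τ| * (K₁ * ε ^ m) ≤ K₁ * ε := by
    have h1 : ε ^ (-N) * ε ^ m ≤ ε := by
      rw [← Real.rpow_natCast ε m, ← Real.rpow_add hε]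
      conv_rhs => rw [← Real.rpow_one ε]
      refine Real.rpow_le_rpow_of_exponent_ge hε hε1 ?_
      rw [hm]; push_cast
      linarith [Nat.le_ceil N]
    calc |τ| * (K₁ * ε ^ m) ≤ ε ^ (-N) * (K₁ * ε ^ m) :=
          mul_le_mul_of_nonneg_right hτ (by positivity)
      _ = K₁ * (ε ^ (-N) * ε ^ m) := by ring
      _ ≤ K₁ * ε := mul_le_mul_of_nonneg_left h1 hK₁
  have hJt : ‖J (γ t) - J (γ 0)‖ ≤ K₁ * ε := by
    have := (convex_Icc (0 : ℝ) t).norm_image_sub_le_of_norm_hasDerivWithin_le (f := J ∘ γ)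
      (f' := fun u => fderiv ℝ J (γ u) (τ • hamField Ω F (γ u))) (C := K₁ * ε)
      (fun u hu => (hJd (γ u)).hasFDerivAt.comp_hasDerivWithinAt u (hγ u hu).2)
      (fun u hu => by
        rw [map_smul, norm_smul, Real.norm_eq_abs]
        exact (mul_le_mul_of_nonneg_left (hJ' u hu).2 (abs_nonneg _)).trans hpow) h0t htt
    refine this.trans (mul_le_of_le_one_right (by positivity) ?_)
    rw [sub_zero, Real.norm_eq_abs, abs_of_nonneg ht.1]; exact ht.2
  have hcons : fastEnergy Ω (γ t).2 (γ t).1.2.2 + F (γ t).1 =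
      fastEnergy Ω (γ 0).2 (γ 0).1.2.2 + F (γ 0).1 := by
    have hdiff : Differentiable ℝ fun y : PhaseSpace n d => fastEnergy Ω y.2 y.1.2.2 + F y.1 :=
      (differentiable_fastEnergy Ω).add (hF.differentiable.comp differentiable_fst)
    have := (convex_Icc (0 : ℝ) t).norm_image_sub_le_of_norm_hasDerivWithin_le
      (f := (fun y : PhaseSpace n d => fastEnergy Ω y.2 y.1.2.2 + F y.1) ∘ γ) (C := 0)
      (fun u hu => (hdiff (γ u)).hasFDerivAt.comp_hasDerivWithinAt u (hγ u hu).2)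
      (fun u hu => by rw [map_smul, fderiv_energy_hamField Ω hF.differentiable, smul_zero, norm_zero])
      h0t htt
    rw [zero_mul, norm_le_zero_iff, sub_eq_zero] at this
    exact this
  have hquad : ∀ u, |(∑ j, ρ j * (((γ u).2 j ^ 2 + Ω j ^ 2 * (γ u).1.2.2 j ^ 2) / 2)) -
      fastEnergy Ω (γ u).2 (γ u).1.2.2| ≤ b / 8 * fastEnergy Ω (γ u).2 (γ u).1.2.2 := by
    intro u
    rw [fastEnergy, ← Finset.sum_sub_distrib, Finset.mul_sum]
    refine (Finset.abs_sum_le_sum_abs _ _).trans (Finset.sum_le_sum fun j _ => ?_)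
    rw [← sub_one_mul, abs_mul, abs_of_nonneg (a := (_ + _) / 2) (by positivity)]
    exact mul_le_mul_of_nonneg_right (hρ j) (by positivity)
  have hqJ : ∀ u ∈ Set.Icc 0 t, |(J (γ u)).re -
      ∑ j, ρ j * (((γ u).2 j ^ 2 + Ω j ^ 2 * (γ u).1.2.2 j ^ 2) / 2)| ≤ K₁ * ε := by
    intro u hu
    have := (Complex.abs_re_le_norm _).trans (hJ' u hu).1
    rwa [Complex.sub_re, Complex.ofReal_re] at this
  have hJre : |(J (γ t)).re - (J (γ 0)).re| ≤ K₁ * ε := by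
    have := (Complex.abs_re_le_norm _).trans hJt
    rwa [Complex.sub_re] at this
  -- The chain of errors gives `|x - x₀| ≤ 3 K₁ ε + (b/8)(x + x₀)`. Absorbing `x ≤ x₀ + |x - x₀|`
  -- costs a factor below 2, because `b ≤ 1`.
  have hmain : |fastEnergy Ω (γ t).2 (γ t).1.2.2 - fastEnergy Ω (γ 0).2 (γ 0).1.2.2| ≤
      b / 2 * fastEnergy Ω (γ 0).2 (γ 0).1.2.2 + 6 * (K₁ * ε) := by
    have a1 := abs_le.1 (hquad t)
    have a2 := abs_le.1 (hquad 0)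
    have a3 := abs_le.1 (hqJ t htt)
    have a4 := abs_le.1 (hqJ 0 h0t)
    have a5 := abs_le.1 hJre
    have hn0 := fastEnergy_nonneg Ω (γ 0).2 (γ 0).1.2.2
    have hnt := fastEnergy_nonneg Ω (γ t).2 (γ t).1.2.2
    generalize fastEnergy Ω (γ t).2 (γ t).1.2.2 = x at *
    generalize fastEnergy Ω (γ 0).2 (γ 0).1.2.2 = x₀ at *
    have hK0 : 0 ≤ K₁ * ε := by positivity
    rw [abs_le]
    constructor <;> nlinarith
  have hmax : |fastEnergy Ω (γ t).2 (γ t).1.2.2 - fastEnergy Ω (γ 0).2 (γ 0).1.2.2| ≤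
      max (fastEnergy Ω (γ 0).2 (γ 0).1.2.2) (K * ε) * b := by
    refine hmain.trans ?_
    have h1 := mul_le_mul_of_nonneg_right
      (le_max_left (fastEnergy Ω (γ 0).2 (γ 0).1.2.2) (K * ε)) (half_pos hb).le
    have h2 := mul_le_mul_of_nonneg_right
      (le_max_right (fastEnergy Ω (γ 0).2 (γ 0).1.2.2) (K * ε)) (half_pos hb).le
    -- The choice `K = 12 K₁ / b + 1` is made for this inequality; each of the two error terms takes
    -- half of `b`.
    have h3 : 6 * (K₁ * ε) ≤ K * ε * (b / 2) := by
      have : K * ε * (b / 2) = 6 * (K₁ * ε) + ε * b / 2 := by rw [hK]; field_simp; ring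
      rw [this]; have : 0 ≤ ε * b / 2 := by positivity
      linarith
    linarith
  have hmaxE : max (fastEnergy Ω (γ 0).2 (γ 0).1.2.2) (K * ε) * b < E * b :=
    mul_lt_mul_of_pos_right (max_lt h0 hεK) hb
  have hEb : E * b ≤ E := mul_le_of_le_one_right hE.le hb1
  have habs := abs_le.1 hmax
  refine ⟨hmax, by linarith, ?_⟩
  have hslow : ∀ u ∈ Set.Icc 0 t, |F (γ u).1 - H₀ ((γ u).1.1, (γ u).1.2.1, 0)| ≤
      C * (2 * √E * ε) := by
    intro u hu
    have hz : ((γ u).1.1, (γ u).1.2.1, (0 : EuclideanSpace ℝ (Fin n))) ∈ couplingRegion D H₀ E E₀ := by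
      have := couplingRegion_star _ (hreg u hu) 0 ⟨le_rfl, zero_le_one⟩
      rwa [zero_smul] at this
    have h1 : F (γ u).1 - H₀ ((γ u).1.1, (γ u).1.2.1, 0) = taylorRemainder 1 F (γ u).1 := by
      rw [taylorRemainder, Finset.sum_range_one, ← hFH _ hz]; rfl
    have h2 : ‖(γ u).1.2.2‖ ≤ 2 * √E * ε := by
      have h3 := norm_sq_le_of_fastEnergy_le hΩ (hγ u hu).1.1
      have h4 : (2 * √E * ε) ^ 2 = 4 * E * ε ^ 2 := by
        rw [mul_pow, mul_pow, Real.sq_sqrt hE.le]; norm_num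
      exact le_of_sq_le_sq (h3.trans h4.ge) (by positivity)
    rw [h1]
    refine (hR _ (hreg u hu)).trans ?_
    rw [pow_one]
    exact mul_le_mul_of_nonneg_left h2 hC
  -- By conservation of energy `F` changes by less than `E * b ≤ E₀ / 4`; replacing `q` by `0` at
  -- both ends adds less than another `E₀ / 4`.
  have s1 := abs_le.1 (hslow t htt)
  have s2 := abs_le.1 (hslow 0 h0t)
  nlinarith

/-- Trajectories that start with low energy stay in the energy region and almost conserve the fast
energy for long times. -/
theorem exists_fastEnergy_almost_conserved (h : IsAdmissible D H₀ E E₀) (hE : 0 < E) (hE₀ : 0 < E₀)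
    (hF : IsBoundedSmooth (couplingRegion D H₀ E E₀) F)
    (hFH : ∀ z ∈ couplingRegion D H₀ E E₀, F z = H₀ z) {b : ℝ} (hb : 0 < b) (hb1 : b ≤ 1)
    (hbE : 4 * E * b ≤ E₀) (N : ℝ) :
    ∃ εstar > 0, ∃ K > 0, εstar ≤ 1 ∧ ∀ (Ω : Fin n → ℝ) (ε : ℝ), 0 < ε → ε < εstar →
      (∀ j, 1 ≤ ε * Ω j) → ∃ R > 0, ∀ y₀ : PhaseSpace n d,
      fastEnergy Ω y₀.2 y₀.1.2.2 < E → (y₀.1.1, y₀.1.2.1, 0) ∈ D → H₀ (y₀.1.1, y₀.1.2.1, 0) < E₀ →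
      ∀ (γ : ℝ → PhaseSpace n d) (τ : ℝ), |τ| ≤ ε ^ (-N) → γ 0 = y₀ →
      ContinuousOn γ (Set.Icc 0 1) → (∀ u ∈ Set.Icc (0 : ℝ) 1, γ u ∈ energyRegion D H₀ E E₀ Ω →
        ‖γ u - y₀‖ ≤ R → HasDerivWithinAt γ (τ • hamField Ω F (γ u)) (Set.Icc 0 1) u) →
      ∀ t ∈ Set.Icc (0 : ℝ) 1, γ t ∈ energyRegion D H₀ E E₀ Ω ∧ ‖γ t - y₀‖ ≤ R ∧
        |fastEnergy Ω (γ t).2 (γ t).1.2.2 - fastEnergy Ω y₀.2 y₀.1.2.2| ≤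
          max (fastEnergy Ω y₀.2 y₀.1.2.2) (K * ε) * b := by
  obtain ⟨εstar, hεstar, K, hK, hε1, hmain⟩ := exists_fastEnergy_bound hE hE₀ hF hFH hb hb1 hbE N
  refine ⟨εstar, hεstar, K, hK, hε1, fun Ω ε hε hεs hΩ => ?_⟩
  have hle1 : ε ≤ 1 := (hεs.trans_le hε1).le
  obtain ⟨L, hL, hbound⟩ := exists_norm_hamField_le Ω hF (2 * √E)
  have hLreg : ∀ y ∈ energyRegion D H₀ E E₀ Ω, ‖hamField Ω F y‖ ≤ L := fun y hy =>
    hbound y (mem_couplingRegion_of_mem_energyRegion hE.le hε.le hle1 hΩ hy)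
      (fun j => (abs_le_of_fastEnergy_le hE.le hy.1 j).1) fun j => by
        refine le_trans ?_ (abs_le_of_fastEnergy_le hE.le hy.1 j).2
        rw [abs_mul]
        have h1 := hΩ j
        have h2 : 1 ≤ |Ω j| := by
          have h3 : 0 < Ω j := (pos_iff_pos_of_mul_pos (by linarith)).1 hε
          rw [abs_of_pos h3]; nlinarith
        exact le_mul_of_one_le_left (abs_nonneg _) h2
  have hT : 0 < ε ^ (-N) := Real.rpow_pos_of_pos hε _
  -- Speed at most `L` for time at most `ε ^ (-N)`; the `+ 1` keeps the trajectory strictly inside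
  -- the ball, as the continuation argument requires.
  refine ⟨ε ^ (-N) * L + 1, by positivity, fun y₀ h0 hD0 hH0 γ τ hτ hγ0 hγc hγ => ?_⟩
  have hderiv : ∀ t ∈ Set.Icc (0 : ℝ) 1, (∀ u ∈ Set.Icc 0 t, γ u ∈ energyRegion D H₀ E E₀ Ω ∩
      Metric.closedBall y₀ (ε ^ (-N) * L + 1)) → ∀ u ∈ Set.Icc 0 t, γ u ∈ energyRegion D H₀ E E₀ Ω ∧
        HasDerivWithinAt γ (τ • hamField Ω F (γ u)) (Set.Icc 0 t) u := by
    intro t ht hu u hu'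
    have h1 := hu u hu'
    exact ⟨h1.1, (hγ u ⟨hu'.1, hu'.2.trans ht.2⟩ h1.1 (mem_closedBall_iff_norm.1 h1.2)).mono
      (Set.Icc_subset_Icc_right ht.2)⟩
  have hmain' := fun t ht hu => hmain Ω ε hε hεs hΩ γ τ hτ (by rwa [hγ0]) (by rwa [hγ0]) t ht
    (hderiv t ht hu)
  have hin : ∀ t ∈ Set.Icc (0 : ℝ) 1, γ t ∈ energyRegion D H₀ E E₀ Ω ∩
      Metric.closedBall y₀ (ε ^ (-N) * L + 1) := by
    -- As long as the trajectory has stayed in the closed region and ball, the a priori bounds put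
    -- it in the interior, so it never leaves.
    refine forall_mem_of_forall_mem_interior ((h.isClosed_energyRegion hE₀.le Ω).inter
      Metric.isClosed_closedBall) hγc ?_ fun t ht hu => ?_
    · rw [hγ0]
      exact ⟨⟨by linarith, hD0, by linarith⟩, Metric.mem_closedBall_self (by positivity)⟩
    · obtain ⟨-, h2, h3⟩ := hmain' t ht hu
      rw [interior_inter]
      refine ⟨h.mem_interior_energyRegion h2 (hu t ⟨ht.1, le_rfl⟩).1.2.1 h3,
        Metric.ball_subset_interior_closedBall ?_⟩
      rw [mem_ball_iff_norm, ← hγ0]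
      have := (convex_Icc (0 : ℝ) t).norm_image_sub_le_of_norm_hasDerivWithin_le
        (C := ε ^ (-N) * L) (fun u hu' => (hderiv t ht hu u hu').2)
        (fun u hu' => by
          rw [norm_smul, Real.norm_eq_abs]
          exact mul_le_mul hτ (hLreg _ (hu u hu').1) (norm_nonneg _) hT.le)
        (Set.left_mem_Icc.2 ht.1) (Set.right_mem_Icc.2 ht.1)
      refine (this.trans (mul_le_of_le_one_right (by positivity) ?_)).trans_lt (lt_add_one _)
      rw [sub_zero, Real.norm_eq_abs, abs_of_nonneg ht.1]; exact ht.2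
  intro t ht
  have h1 := hin t ht
  refine ⟨h1.1, mem_closedBall_iff_norm.1 h1.2, ?_⟩
  have := (hmain' t ht fun u hu => hin u ⟨hu.1, hu.2.trans ht.2⟩).1
  rwa [hγ0] at this

end Bootstrap
end
end FastSlow

namespace FastSlow

noncomputable section

open scoped Topology

/-! ### Solutions of Hamilton's equations as integral curves -/

section Trajectories

variable {n d : ℕ} {D : Set (CoupSpace n d)} {H₀ F : CoupSpace n d → ℝ} {E E₀ : ℝ}

theorem hasDerivWithinAt_fst {X Y : Type*} [NormedAddCommGroup X] [NormedSpace ℝ X]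
    [NormedAddCommGroup Y] [NormedSpace ℝ Y] {α : ℝ → X × Y} {v : X × Y} {I : Set ℝ} {t : ℝ}
    (h : HasDerivWithinAt α v I t) : HasDerivWithinAt (fun t => (α t).1) v.1 I t :=
  (hasFDerivAt_fst (𝕜 := ℝ) (p := α t)).comp_hasDerivWithinAt t h

theorem hasDerivWithinAt_snd {X Y : Type*} [NormedAddCommGroup X] [NormedSpace ℝ X]
    [NormedAddCommGroup Y] [NormedSpace ℝ Y] {α : ℝ → X × Y} {v : X × Y} {I : Set ℝ} {t : ℝ}
    (h : HasDerivWithinAt α v I t) : HasDerivWithinAt (fun t => (α t).2) v.2 I t :=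
  (hasFDerivAt_snd (𝕜 := ℝ) (p := α t)).comp_hasDerivWithinAt t h

theorem hasDerivWithinAt_comp_mul_const {X : Type*} [NormedAddCommGroup X] [NormedSpace ℝ X]
    {α : ℝ → X} {v : X} {I : Set ℝ} {t u : ℝ} (h : HasDerivWithinAt α v I (u * t))
    (hI : ∀ u ∈ Set.Icc (0 : ℝ) 1, u * t ∈ I) :
    HasDerivWithinAt (fun u => α (u * t)) (t • v) (Set.Icc 0 1) u :=
  h.scomp u (((hasDerivAt_id u).mul_const t).hasDerivWithinAt.congr_deriv (one_mul t)) hI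

theorem IsSolution.hasDerivWithinAt {Ω : Fin n → ℝ} {I : Set ℝ}
    {p q : ℝ → EuclideanSpace ℝ (Fin n)} {P Q : ℝ → EuclideanSpace ℝ (Fin d)}
    (h : IsSolution Ω D H₀ I p q P Q) (hF : Differentiable ℝ F) {t : ℝ} (ht : t ∈ I)
    (hFH : F =ᶠ[𝓝 (P t, Q t, q t)] H₀) :
    HasDerivWithinAt (fun t => (((P t, Q t, q t), p t) : PhaseSpace n d))
      (hamField Ω F ((P t, Q t, q t), p t)) I t := by
  rw [← gradient_fastEnergy_add Ω (y := ((P t, Q t, q t), p t)) hF hFH]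
  exact ((h.deriv_P t ht).prodMk ((h.deriv_Q t ht).prodMk (h.deriv_q t ht))).prodMk (h.deriv_p t ht)

theorem isSolution_of_hasDerivWithinAt {Ω : Fin n → ℝ} {I : Set ℝ} {α : ℝ → PhaseSpace n d}
    (hD : ∀ t ∈ I, (α t).1 ∈ D) (hF : Differentiable ℝ F) (hFH : ∀ t ∈ I, F =ᶠ[𝓝 (α t).1] H₀)
    (h : ∀ t ∈ I, HasDerivWithinAt α (hamField Ω F (α t)) I t) :
    IsSolution Ω D H₀ I (fun t => (α t).2) (fun t => (α t).1.2.2) (fun t => (α t).1.1)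
      (fun t => (α t).1.2.1) := by
  have hfst : ∀ t ∈ I, HasDerivWithinAt (fun t => (α t).1) (hamField Ω F (α t)).1 I t :=
    fun t ht => hasDerivWithinAt_fst (h t ht)
  have hsnd : ∀ t ∈ I, HasDerivWithinAt (fun t => (α t).1.2) (hamField Ω F (α t)).1.2 I t :=
    fun t ht => hasDerivWithinAt_snd (hfst t ht)
  have hgrad := fun t ht => gradient_fastEnergy_add Ω (y := α t) hF (hFH t ht)
  refine ⟨hD, fun t ht => ?_, fun t ht => ?_, fun t ht => ?_, fun t ht => ?_⟩
  · exact (hasDerivWithinAt_snd (h t ht)).congr_deriv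
      (congrArg Prod.snd (hgrad t ht)).symm
  · exact (hasDerivWithinAt_snd (hsnd t ht)).congr_deriv
      (congrArg (fun x : PhaseSpace n d => x.1.2.2) (hgrad t ht)).symm
  · exact (hasDerivWithinAt_fst (hfst t ht)).congr_deriv
      (congrArg (fun x : PhaseSpace n d => x.1.1) (hgrad t ht)).symm
  · exact (hasDerivWithinAt_fst (hsnd t ht)).congr_deriv
      (congrArg (fun x : PhaseSpace n d => x.1.2.1) (hgrad t ht)).symm

end Trajectories
end
end FastSlow

/-- One confinement statement serves both claims: it requires the differential equation only inside
the energy region and the ball, so it applies to the cut-off flow as well as to an arbitrary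
solution. Uniqueness of solutions is never used. -/
theorem theorem2 {n d : ℕ}
    (D : Set (EuclideanSpace ℝ (Fin d) × EuclideanSpace ℝ (Fin d) × EuclideanSpace ℝ (Fin n)))
    (H₀ : EuclideanSpace ℝ (Fin d) × EuclideanSpace ℝ (Fin d) × EuclideanSpace ℝ (Fin n) → ℝ)
    (Estar E₀star : ℝ) (hE : 0 < Estar) (hE₀ : 0 < E₀star)
    (hH₀ : FastSlow.IsAdmissible D H₀ Estar E₀star)
    (b : ℝ) (hb : 0 < b) (N : ℝ) (hN : 0 < N) :
    ∃ εstar > 0, ∃ K > 0,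
      ∀ (ω : Fin n → ℝ) (ε : ℝ), 0 < ε → IsLeast (Set.range ω) (1 / ε) → ε < εstar →
      ∀ (p₀ q₀ : EuclideanSpace ℝ (Fin n)) (P₀ Q₀ : EuclideanSpace ℝ (Fin d)),
        FastSlow.fastEnergy ω p₀ q₀ < Estar →
        (P₀, Q₀, 0) ∈ D → H₀ (P₀, Q₀, 0) < E₀star →
        -- the solution exists for all `|t| ≤ ε ^ (-N)`
        (∃ (p q : ℝ → EuclideanSpace ℝ (Fin n)) (P Q : ℝ → EuclideanSpace ℝ (Fin d)),
          FastSlow.IsSolution ω D H₀ (Set.Icc (-ε ^ (-N)) (ε ^ (-N))) p q P Q ∧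
          p 0 = p₀ ∧ q 0 = q₀ ∧ P 0 = P₀ ∧ Q 0 = Q₀) ∧
        -- and along any solution the fast energy is almost conserved for these times
        (∀ (I : Set ℝ) (p q : ℝ → EuclideanSpace ℝ (Fin n)) (P Q : ℝ → EuclideanSpace ℝ (Fin d)),
          I.OrdConnected → 0 ∈ I → FastSlow.IsSolution ω D H₀ I p q P Q →
          p 0 = p₀ → q 0 = q₀ → P 0 = P₀ → Q 0 = Q₀ →
          ∀ t ∈ I, |t| ≤ ε ^ (-N) →
            |FastSlow.fastEnergy ω (p t) (q t) - FastSlow.fastEnergy ω p₀ q₀| ≤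
              max (FastSlow.fastEnergy ω p₀ q₀) (K * ε) * b) := by
  obtain ⟨F, hF, hFH⟩ := hH₀.exists_extension hE.le hE₀.le
  -- The conclusion is monotone in `b`, so `b` may be shrunk until `b ≤ 1` and `4 * Estar * b ≤
  -- E₀star`.
  have hb' : 0 < min (min b 1) (E₀star / (4 * Estar)) := by positivity
  have hb'E : 4 * Estar * min (min b 1) (E₀star / (4 * Estar)) ≤ E₀star := by
    have := min_le_right (min b 1) (E₀star / (4 * Estar))
    rw [le_div_iff₀ (by positivity)] at this
    linarith
  obtain ⟨εstar, hεstar, K, hK, hε1, hmain⟩ := FastSlow.exists_fastEnergy_almost_conserved hH₀ hE hE₀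
    hF (fun z hz => (hFH z hz).eq_of_nhds) hb' ((min_le_left _ _).trans (min_le_right _ _)) hb'E N
  refine ⟨εstar, hεstar, K, hK, fun ω ε hε hω hεs p₀ q₀ P₀ Q₀ h0 hD0 hH0 => ?_⟩
  have hle1 : ε ≤ 1 := (hεs.trans_le hε1).le
  have hωε : ∀ j, 1 ≤ ε * ω j := fun j => by
    have := hω.2 ⟨j, rfl⟩
    rwa [div_le_iff₀' hε] at this
  obtain ⟨R, hR, hmain⟩ := hmain ω ε hε hεs hωε
  have hmain := hmain ((P₀, Q₀, q₀), p₀) h0 hD0 hH0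
  have hreg : ∀ y ∈ FastSlow.energyRegion D H₀ Estar E₀star ω,
      y.1 ∈ FastSlow.couplingRegion D H₀ Estar E₀star := fun y hy =>
    FastSlow.mem_couplingRegion_of_mem_energyRegion hE.le hε.le hle1 hωε hy
  have hT : 0 < ε ^ (-N) := Real.rpow_pos_of_pos hε _
  have hone : (1 : ℝ) ∈ Set.Icc (0 : ℝ) 1 := ⟨zero_le_one, le_rfl⟩
  have hseg : ∀ I : Set ℝ, I.OrdConnected → 0 ∈ I → ∀ t ∈ I, ∀ u ∈ Set.Icc (0 : ℝ) 1, u * t ∈ I :=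
    fun I hI h0I t ht u hu => by
      have := hI.convex.smul_mem_of_zero_mem h0I ht hu
      rwa [smul_eq_mul] at this
  constructor
  -- Existence: the cut-off flow never leaves the ball and the region, hence solves the original
  -- equations.
  · obtain ⟨α, hα0, hαc, hα⟩ := FastSlow.exists_solution_of_ball _
      (FastSlow.contDiff_hamField ω hF.contDiff) ((P₀, Q₀, q₀), p₀) hR hT.le
    have hstay : ∀ t ∈ Set.Icc (-ε ^ (-N)) (ε ^ (-N)),
        α t ∈ FastSlow.energyRegion D H₀ Estar E₀star ω ∧ ‖α t - ((P₀, Q₀, q₀), p₀)‖ ≤ R := by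
      intro t ht
      have hmaps := hseg _ Set.ordConnected_Icc ⟨by linarith, hT.le⟩ t ht
      -- Running `u * t` over `[0, 1]` treats positive and negative times alike, with `τ = t`.
      have := hmain (fun u => α (u * t)) t (abs_le.2 ht) (by rwa [zero_mul])
        (hαc.comp (by fun_prop) hmaps)
        (fun u hu _ h2 => FastSlow.hasDerivWithinAt_comp_mul_const (hα _ (hmaps u hu) h2) hmaps) 1 hone
      rw [one_mul] at this
      exact ⟨this.1, this.2.1⟩
    refine ⟨_, _, _, _, FastSlow.isSolution_of_hasDerivWithinAt (α := α) (fun t ht =>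
      hH₀.couplingRegion_subset hE.le hE₀.le (hreg _ (hstay t ht).1)) hF.differentiable
      (fun t ht => hFH _ (hreg _ (hstay t ht).1)) (fun t ht => hα t ht (hstay t ht).2), ?_⟩
    rw [hα0]
    exact ⟨rfl, rfl, rfl, rfl⟩
  · intro I p q P Q hI h0I hsol hp hq hP hQ t ht htT
    have hmaps := hseg I hI h0I t ht
    have hc : ContinuousOn (fun t => (((P t, Q t, q t), p t) : FastSlow.PhaseSpace n d)) I :=
      fun t ht => ((hsol.deriv_P t ht).continuousWithinAt.prodMk
        ((hsol.deriv_Q t ht).continuousWithinAt.prodMk (hsol.deriv_q t ht).continuousWithinAt)).prodMk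
        (hsol.deriv_p t ht).continuousWithinAt
    have := hmain (fun u => ((P (u * t), Q (u * t), q (u * t)), p (u * t))) t htT
      (by rw [zero_mul, hp, hq, hP, hQ]) (hc.comp (by fun_prop) hmaps)
      (fun u hu h1 _ => FastSlow.hasDerivWithinAt_comp_mul_const
        (hsol.hasDerivWithinAt hF.differentiable (hmaps u hu) (hFH _ (hreg _ h1))) hmaps) 1 hone
    have := this.2.2
    simp only [one_mul] at this
    exact this.trans (mul_le_mul_of_nonneg_left ((min_le_left _ _).trans (min_le_left _ _))
      (le_max_of_le_left (FastSlow.fastEnergy_nonneg _ _ _)))
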